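/- Let $\ell>0$. For $m\in\mathbb C$ and $r>0$ let $J_m(r)$ be the Bessel function and $H^+_m(r)=H^{(1)}_m(r)$, $H^-_m(r)=H^{(2)}_m(r)$ the Hankel functions; in particular $H^\pm_{1/2}(r)=\mp i\big(\tfrac{2}{\pi r}\big)^{1/2}e^{\pm i r}$. Let $\mathcal W(\Phi,\Xi)=\Phi\,\Xi'-\Phi'\,\Xi$ be the Wronskian. Let $M^{\max}_{i\ell}$ be the maximal realization of $-\partial_x^2-\ell^2e^{2x}$ on $L^2(\mathbb R)$: its domain consists of the $f\in L^2(\mathbb R)$ that are differentiable with locally absolutely continuous derivative and satisfy $-f''-\ell^2e^{2x}f\in L^2(\mathbb R)$. (1) For every $\gamma\in\mathbb C\setminus\{0\}$ there is a unique closed operator $M^\gamma_{i\ell}$ on $L^2(\mathbb R)$ that is a restriction of $M^{\max}_{i\ell}$ (in particular, it is given on $C_c^\infty(\mathbb R)$, which its domain contains, by $-\partial_x^2-\ell^2e^{2x}$) and has the domain $$\mathcal D(M^\gamma_{i\ell})=\Big\{\Xi\in\mathcal D(M^{\max}_{i\ell})\ :\ \lim_{x\to+\infty}\mathcal W\big(H^+_{1/2}(\ell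 e^x)-i\gamma H^-_{1/2}(\ell e^x),\,\Xi(x)\big)=0\Big\}.$$ (2) $\mathbb C\setminus\{0\}\ni\gamma\mapsto M^\gamma_{i\ell}$ is a holomorphic family of closed operators. That is, every $\gamma_0\neq0$ has an open neighbourhood $U\subset\mathbb C\setminus\{0\}$ for which there are a Banach space $K$ and injective bounded operators $B_\gamma:K\to L^2(\mathbb R)$, $\gamma\in U$, with range $\mathcal D(M^\gamma_{i\ell})$, such that $M^\gamma_{i\ell}B_\gamma$ is bounded and both $B_\gamma$ and $M^\gamma_{i\ell}B_\gamma$ are holomorphic in $\gamma\in U$. (3) Let $\gamma=e^{i\pi\alpha}$ with $\alpha\in\mathbb C$. The point spectrum of $M^\gamma_{i\ell}$ is $$\sigma_{\mathrm p}(M^\gamma_{i\ell})=\{-(n+\alpha)^2\ :\ n\in2\mathbb Z,\ \operatorname{Re}(n+\alpha)>0\},$$ and for each such $n$ the function $x\mapsto J_{\alpha+n}(\ell e^x)$ belongs to $L^2(\mathbb R)$, is nonzero, and spans the eigenspace of the eigenvalue $-(n+\alpha)^2$. The spectrum is $\sigma(M^\gamma_{i\ell})=[0,\infty[\;\cup\;\sigma_{\mathrm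 p}(M^\gamma_{i\ell})$. (4) If $\gamma\in\mathbb C\setminus\{0\}$, $\operatorname{Re}(m)>0$ and $e^{im\pi}\neq\gamma$, then $-m^2\notin\sigma(M^\gamma_{i\ell})$ and $(M^\gamma_{i\ell}+m^2)^{-1}$ is the integral operator with kernel $$(M^\gamma_{i\ell}+m^2)^{-1}(x,y)=\frac{\pi i}{2(e^{im\pi}-\gamma)}\begin{cases}J_m(\ell e^x)\big(e^{im\pi}H^+_m(\ell e^y)+\gamma H^-_m(\ell e^y)\big),&x<y,\\ J_m(\ell e^y)\big(e^{im\pi}H^+_m(\ell e^x)+\gamma H^-_m(\ell e^x)\big),&y<x.\end{cases}$$ -/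

import Mathlib

open MeasureTheory Filter Topology Set
open scoped ContDiff

noncomputable section

/-! ### Bessel and Hankel functions of complex order on the positive half-line -/

/-- The regularised hypergeometric function `∑ wⁿ / (n! Γ(c + n))`. At a pole of `Γ` the
convention `1 / 0 = 0` gives the value `0` of the entire function `1 / Γ`. -/
def hyp0F1Reg (c w : ℂ) : ℂ :=
  ∑' n : ℕ, w ^ n / ((n.factorial : ℂ) * Complex.Gamma (c + n))

/-- The Bessel function `J_m(r)`, for `m ∈ ℂ` and `r > 0`. -/
def besselJ (m : ℂ) (r : ℝ) : ℂ :=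
  ((r / 2 : ℝ) : ℂ) ^ m * hyp0F1Reg (m + 1) (-((r : ℂ) ^ 2 / 4))

/-- `(J_{-m}(r) - e^{-iπm} J_m(r)) / (i sin πm)`, meaningful for `m ∉ ℤ`. -/
def hankelPlusQuot (m : ℂ) (r : ℝ) : ℂ :=
  (besselJ (-m) r - Complex.exp (-(Complex.I * Real.pi * m)) * besselJ m r) /
    (Complex.I * Complex.sin (Real.pi * m))

/-- `(J_{-m}(r) - e^{iπm} J_m(r)) / (-i sin πm)`, meaningful for `m ∉ ℤ`. -/
def hankelMinusQuot (m : ℂ) (r : ℝ) : ℂ :=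
  (besselJ (-m) r - Complex.exp (Complex.I * Real.pi * m) * besselJ m r) /
    (-(Complex.I * Complex.sin (Real.pi * m)))

open scoped Classical in
/-- The Hankel function `H⁺_m(r) = H⁽¹⁾_m(r)`, for `m ∈ ℂ` and `r > 0`; for integer `m` it is
the limit of the values at non-integer orders. -/
def hankelPlus (m : ℂ) (r : ℝ) : ℂ :=
  if ∃ n : ℤ, m = n then limUnder (𝓝[≠] m) (fun μ => hankelPlusQuot μ r) else hankelPlusQuot m r

open scoped Classical in
/-- The Hankel function `H⁻_m(r) = H⁽²⁾_m(r)`, for `m ∈ ℂ` and `r > 0`; for integer `m` it is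
the limit of the values at non-integer orders. -/
def hankelMinus (m : ℂ) (r : ℝ) : ℂ :=
  if ∃ n : ℤ, m = n then limUnder (𝓝[≠] m) (fun μ => hankelMinusQuot μ r) else hankelMinusQuot m r

/-! ### Unbounded operators on a Hilbert space -/

section Unbounded

variable {E : Type*} [NormedAddCommGroup E] [InnerProductSpace ℂ E]

/-- `R` is the (bounded, everywhere defined) inverse of `A - z : D(A) → E`. -/
def IsResolventAt (A : E →ₗ.[ℂ] E) (z : ℂ) (R : E →L[ℂ] E) : Prop :=
  (∀ g : E, ∃ h : R g ∈ A.domain, A ⟨R g, h⟩ - z • R g = g) ∧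
    ∀ f : A.domain, R (A f - z • (f : E)) = f

/-- The spectrum: the `z` for which `A - z` has no bounded everywhere defined inverse. -/
def opSpectrum (A : E →ₗ.[ℂ] E) : Set ℂ :=
  {z | ¬ ∃ R : E →L[ℂ] E, IsResolventAt A z R}

/-- `f` lies in the domain of `A` and `A f = z f`. -/
def IsEigenpair (A : E →ₗ.[ℂ] E) (z : ℂ) (f : E) : Prop :=
  ∃ h : f ∈ A.domain, A ⟨f, h⟩ = z • f

/-- The point spectrum: the set of eigenvalues. -/
def pointSpectrum (A : E →ₗ.[ℂ] E) : Set ℂ :=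
  {z | ∃ f : E, f ≠ 0 ∧ IsEigenpair A z f}

/-- Holomorphic families of closed operators (in the generalised sense of Kato): locally, the
domain of `T γ` is the range of an injective bounded operator `B γ` defined on a fixed Banach
space, where `B γ` and `T γ ∘ B γ` are bounded and depend holomorphically on `γ`. -/
def IsHolomorphicFamily (T : ℂ → E →ₗ.[ℂ] E) (Ω : Set ℂ) : Prop :=
  (∀ γ ∈ Ω, (T γ).IsClosed) ∧
  ∀ γ₀ ∈ Ω, ∃ (K : Type) (_ : NormedAddCommGroup K) (_ : NormedSpace ℂ K) (_ : CompleteSpace K)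
    (U : Set ℂ) (B C : ℂ → K →L[ℂ] E),
    IsOpen U ∧ γ₀ ∈ U ∧ U ⊆ Ω ∧ DifferentiableOn ℂ B U ∧ DifferentiableOn ℂ C U ∧
    ∀ γ ∈ U, Function.Injective (B γ) ∧ range (B γ) = ((T γ).domain : Set E) ∧
      ∀ (k : K) (h : B γ k ∈ (T γ).domain), T γ ⟨B γ k, h⟩ = C γ k

end Unbounded

/-! ### The maximal realization of `-∂² - ℓ² e^{2x}` on `L²(ℝ)` -/

/-- The Hilbert space `L²(ℝ)`. -/
abbrev L2R : Type := Lp ℂ 2 (volume : Measure ℝ)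

/-- `u ∈ AC¹(ℝ)`: `u` is differentiable with (locally) absolutely continuous derivative. -/
def IsAC1 (u : ℝ → ℂ) : Prop :=
  Differentiable ℝ u ∧ ∀ a b : ℝ, AbsolutelyContinuousOnInterval (deriv u) a b

/-- The expression `-u'' - ℓ² e^{2x} u`. -/
def negExpExpr (ℓ : ℝ) (u : ℝ → ℂ) (x : ℝ) : ℂ :=
  -deriv (deriv u) x - ((ℓ ^ 2 * Real.exp (2 * x) : ℝ) : ℂ) * u x

/-- The Wronskian `Φ u' - Φ' u`. -/
def wronskian (Φ u : ℝ → ℂ) (x : ℝ) : ℂ :=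
  Φ x * deriv u x - deriv Φ x * u x

lemma IsAC1.add {u v : ℝ → ℂ} (hu : IsAC1 u) (hv : IsAC1 v) : IsAC1 (u + v) := by
  refine ⟨hu.1.add hv.1, fun a b => ?_⟩
  have h : deriv (u + v) = deriv u + deriv v := by
    funext x; exact deriv_add (hu.1 x) (hv.1 x)
  rw [h]
  exact (hu.2 a b).add (hv.2 a b)

lemma IsAC1.const_smul {u : ℝ → ℂ} (c : ℂ) (hu : IsAC1 u) : IsAC1 (c • u) := by
  refine ⟨hu.1.const_smul c, fun a b => ?_⟩
  have h : deriv (c • u) = fun x => c • deriv u x := by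
    funext x; exact deriv_const_smul c (hu.1 x)
  rw [h]
  exact (hu.2 a b).const_smul c

lemma isAC1_zero : IsAC1 0 := by
  refine ⟨differentiable_const 0, fun a b => ?_⟩
  have h : deriv (0 : ℝ → ℂ) = fun _ => (0 : ℂ) := by
    funext x; exact deriv_const x 0
  rw [h]
  exact (contDiffOn_const (c := (0 : ℂ))).absolutelyContinuousOnInterval

lemma IsAC1.ae_differentiableAt {u : ℝ → ℂ} (hu : IsAC1 u) :
    ∀ᵐ x, DifferentiableAt ℝ (deriv u) x := by
  apply LocallyBoundedVariationOn.ae_differentiableAt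
  intro a b _ _
  refine ((hu.2 a b).boundedVariationOn).mono ?_
  rw [univ_inter]
  exact Icc_subset_uIcc

lemma negExpExpr_add (ℓ : ℝ) {u v : ℝ → ℂ} (hu : IsAC1 u) (hv : IsAC1 v) :
    negExpExpr ℓ (u + v) =ᵐ[volume] negExpExpr ℓ u + negExpExpr ℓ v := by
  filter_upwards [hu.ae_differentiableAt, hv.ae_differentiableAt] with x hx hy
  have h : deriv (u + v) = deriv u + deriv v := by
    funext x; exact deriv_add (hu.1 x) (hv.1 x)
  simp only [negExpExpr, Pi.add_apply, h, deriv_add hx hy]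
  ring

lemma negExpExpr_const_smul (ℓ : ℝ) (c : ℂ) {u : ℝ → ℂ} (hu : IsAC1 u) :
    negExpExpr ℓ (c • u) =ᵐ[volume] c • negExpExpr ℓ u := by
  filter_upwards [hu.ae_differentiableAt] with x hx
  have h : deriv (c • u) = c • deriv u := by
    funext x; exact deriv_const_smul c (hu.1 x)
  simp only [negExpExpr, Pi.smul_apply, h, deriv_const_smul c hx, smul_eq_mul]
  ring

/-- The graph of the maximal operator: the pairs `(f, -f'' - ℓ² e^{2x} f)`, where `f ∈ L²(ℝ)`
has a representative in `AC¹(ℝ)` and `-f'' - ℓ² e^{2x} f ∈ L²(ℝ)`. -/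
def maxGraph (ℓ : ℝ) : Submodule ℂ (L2R × L2R) where
  carrier := {p | ∃ u : ℝ → ℂ, IsAC1 u ∧ p.1 =ᵐ[volume] u ∧ p.2 =ᵐ[volume] negExpExpr ℓ u}
  zero_mem' := by
    refine ⟨0, isAC1_zero, Lp.coeFn_zero _ _ _, (Lp.coeFn_zero _ _ _).trans ?_⟩
    refine Eventually.of_forall fun x => ?_
    have h : deriv (0 : ℝ → ℂ) = 0 := by
      funext x; exact deriv_const x 0
    simp [negExpExpr, h]
  add_mem' := by
    rintro p q ⟨u, hu, hu1, hu2⟩ ⟨v, hv, hv1, hv2⟩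
    exact ⟨u + v, hu.add hv, (Lp.coeFn_add _ _).trans (hu1.add hv1),
      ((Lp.coeFn_add _ _).trans (hu2.add hv2)).trans (negExpExpr_add ℓ hu hv).symm⟩
  smul_mem' := by
    rintro c p ⟨u, hu, hu1, hu2⟩
    exact ⟨c • u, hu.const_smul c, (Lp.coeFn_smul _ _).trans (hu1.const_smul c),
      ((Lp.coeFn_smul _ _).trans (hu2.const_smul c)).trans (negExpExpr_const_smul ℓ c hu).symm⟩

lemma maxGraph_singleValued (ℓ : ℝ) (p : L2R × L2R) (hp : p ∈ maxGraph ℓ) (h0 : p.1 = 0) :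
    p.2 = 0 := by
  obtain ⟨u, hu, hu1, hu2⟩ := hp
  have hu0 : u = 0 := by
    refine (hu.1.continuous.ae_eq_iff_eq volume continuous_const).1 ?_
    rw [h0] at hu1
    exact hu1.symm.trans (Lp.coeFn_zero _ _ _)
  apply Lp.ext
  refine hu2.trans (EventuallyEq.trans ?_ (Lp.coeFn_zero _ _ _).symm)
  refine Eventually.of_forall fun x => ?_
  have h : deriv (0 : ℝ → ℂ) = 0 := by
    funext x; exact deriv_const x 0
  simp [negExpExpr, hu0, h]

/-- The maximal operator of `-∂² - ℓ² e^{2x}` on `L²(ℝ)`, the operator with graph `maxGraph ℓ`. -/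
def maxOp (ℓ : ℝ) : L2R →ₗ.[ℂ] L2R := (maxGraph ℓ).toLinearPMap

lemma maxOp_graph (ℓ : ℝ) : (maxOp ℓ).graph = maxGraph ℓ :=
  Submodule.toLinearPMap_graph_eq _ fun p hp h0 => maxGraph_singleValued ℓ p hp h0

/-! ### The mixed realizations -/

/-- The function `H⁺_{1/2}(ℓ eˣ) - i γ H⁻_{1/2}(ℓ eˣ)` that sets the boundary condition. -/
def bcFun (ℓ : ℝ) (γ : ℂ) (x : ℝ) : ℂ :=
  hankelPlus (1 / 2) (ℓ * Real.exp x) - Complex.I * γ * hankelMinus (1 / 2) (ℓ * Real.exp x)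

/-- The `f ∈ L²(ℝ)` that have an `AC¹` representative whose Wronskian with `bcFun ℓ γ` tends
to zero at `+∞`. -/
def bcSubmodule (ℓ : ℝ) (γ : ℂ) : Submodule ℂ L2R where
  carrier := {f | ∃ u : ℝ → ℂ, IsAC1 u ∧ f =ᵐ[volume] u ∧
    Tendsto (wronskian (bcFun ℓ γ) u) atTop (𝓝 0)}
  zero_mem' := by
    refine ⟨0, isAC1_zero, Lp.coeFn_zero _ _ _, ?_⟩
    have h : wronskian (bcFun ℓ γ) 0 = fun _ => 0 := by
      have h : deriv (0 : ℝ → ℂ) = 0 := by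
        funext x; exact deriv_const x 0
      funext x
      simp [wronskian, h]
    rw [h]
    exact tendsto_const_nhds
  add_mem' := by
    rintro f g ⟨u, hu, hu1, hu2⟩ ⟨v, hv, hv1, hv2⟩
    refine ⟨u + v, hu.add hv, (Lp.coeFn_add _ _).trans (hu1.add hv1), ?_⟩
    have h : wronskian (bcFun ℓ γ) (u + v) =
        fun x => wronskian (bcFun ℓ γ) u x + wronskian (bcFun ℓ γ) v x := by
      funext x
      simp only [wronskian, Pi.add_apply, deriv_add (hu.1 x) (hv.1 x)]
      ring
    rw [h]
    simpa using hu2.add hv2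
  smul_mem' := by
    rintro c f ⟨u, hu, hu1, hu2⟩
    refine ⟨c • u, hu.const_smul c, (Lp.coeFn_smul _ _).trans (hu1.const_smul c), ?_⟩
    have h : wronskian (bcFun ℓ γ) (c • u) = fun x => c * wronskian (bcFun ℓ γ) u x := by
      funext x
      simp only [wronskian, Pi.smul_apply, deriv_const_smul c (hu.1 x), smul_eq_mul]
      ring
    rw [h]
    simpa using hu2.const_mul c

/-- The operator `M^γ_{iℓ}`: the restriction of the maximal operator to the elements of its
domain that satisfy the boundary condition set by `bcFun ℓ γ` at `+∞`. -/
def mixedOp (ℓ : ℝ) (γ : ℂ) : L2R →ₗ.[ℂ] L2R :=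
  (maxOp ℓ).domRestrict (bcSubmodule ℓ γ)

/-- `A` is a closed realization of `-∂² - ℓ² e^{2x}` (a closed restriction of the maximal
operator, given by the expression on `C_c^∞(ℝ)`) whose domain is described by the boundary
condition set by `bcFun ℓ γ` at `+∞`. -/
structure IsMixedRealization (ℓ : ℝ) (γ : ℂ) (A : L2R →ₗ.[ℂ] L2R) : Prop where
  closed : A.IsClosed
  le_max : A ≤ maxOp ℓ
  test : ∀ φ : ℝ → ℂ, ContDiff ℝ ∞ φ → HasCompactSupport φ →
    ∃ f : A.domain, (f : L2R) =ᵐ[volume] φ ∧ A f =ᵐ[volume] negExpExpr ℓ φ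
  domain : ∀ f : L2R, f ∈ A.domain ↔ f ∈ (maxOp ℓ).domain ∧
    ∃ u : ℝ → ℂ, IsAC1 u ∧ f =ᵐ[volume] u ∧ Tendsto (wronskian (bcFun ℓ γ) u) atTop (𝓝 0)

/-! ### Integral kernels -/

/-- The bounded operator `R` on `L²(ℝ)` has the integral kernel `k`. -/
def HasIntegralKernel (R : L2R →L[ℂ] L2R) (k : ℝ → ℝ → ℂ) : Prop :=
  ∀ g : L2R, ∀ᵐ x, Integrable (fun y => k x y * g y) ∧ R g x = ∫ y, k x y * g y

/-- `e^{imπ} H⁺_m(ℓ eˣ) + γ H⁻_m(ℓ eˣ)`. -/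
def hankelCombination (ℓ : ℝ) (γ m : ℂ) (x : ℝ) : ℂ :=
  Complex.exp (Complex.I * m * Real.pi) * hankelPlus m (ℓ * Real.exp x) +
    γ * hankelMinus m (ℓ * Real.exp x)

/-- The kernel `π i / (2 (e^{imπ} - γ))` times `J_m(ℓ eˣ) (e^{imπ} H⁺_m + γ H⁻_m)(ℓ e^y)` for
`x < y`, and the same with `x` and `y` interchanged for `y < x`. -/
def mixedKernel (ℓ : ℝ) (γ m : ℂ) (x y : ℝ) : ℂ :=
  Real.pi * Complex.I / (2 * (Complex.exp (Complex.I * m * Real.pi) - γ)) *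
    (if x < y then besselJ m (ℓ * Real.exp x) * hankelCombination ℓ γ m y
      else besselJ m (ℓ * Real.exp y) * hankelCombination ℓ γ m x)

end

/-! ### The regularised hypergeometric series -/

/-! In the variable `r = ℓ eˣ` the equation `-u'' - ℓ² e^{2x} u = -m² u` is Bessel's equation of
order `m`. Everything rests on three solutions that are controlled at the ends of the line: `solJ`,
comparable to `e^{mx}` at `-∞`, and two waves `solU`, `solV`, which are multiples of `H⁺` and `H⁻`
of size `e^{-x/2}` at `+∞`. The first comes from its power series. The second is Sommerfeld's
integral along the path of steepest descent of `cosh`; it is even in the order and has no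
exceptional integers. The third is its conjugate. First-order ladder relations between neighbouring
orders yield the differential equation for all three. Wronskians of solutions are constant, so
limits evaluate them: `wronskian_solU_solJ` at `-∞` and `wronskian_solU_solV` at `+∞`. The Plücker
identity then expresses `J` through `U` and `V` (`solJ_eq`), and this identifies the Hankel
functions.

Every solution is square integrable near `+∞`, so a boundary condition is needed there. The leading
asymptotics of `U_m` and `V_m` do not involve `m`; hence the Wronskian with the boundary function of
order `1/2` has a limit that depends on the two wave amplitudes only
(`tendsto_wronskian_bcFun_lincomb`). The combination `U_m - γ V_m` always satisfies the condition,
and `J_m` satisfies it exactly when `e^{imπ} = γ`. At `-∞`, for `Re m ≥ 0`, an `L²` solution must be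
a multiple of `J_m` (`eq_const_mul_solJ_of_memLp`), and for `Re m = 0` even that one is not square
integrable. This gives the eigenvalues.

For `Re m > 0` and `e^{imπ} ≠ γ`, variation of constants with `J_m` on the left and the Hankel
combination on the right inverts `M^γ + m²`. The kernel decays exponentially in `|x - y|`, so the
inverse is bounded (`exists_resolvent_mixedOp`). A resolvent at one point already makes the operator
closed. Every spectral parameter is `-m²` with `Re m ≥ 0`; the case `Re m = 0` is the half-line,
which lies in the spectrum by Weyl's criterion with wave packets far to the left, where the
potential is negligible. Finally, at a fixed `m` the resolvent depends on `γ` only through a scalar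
in front of the rank-one kernel `J_m(x) J_m(y)` (`mixedKernel_eq_add`), so resolvents parametrise
the domains holomorphically. -/

/-- The coefficients of the power series `hyp0F1Reg c`. -/
noncomputable def hypCoeff (c : ℂ) (n : ℕ) : ℂ := ((n.factorial : ℂ) * Complex.Gamma (c + n))⁻¹

lemma hyp0F1Reg_eq (c w : ℂ) : hyp0F1Reg c w = ∑' n, hypCoeff c n * w ^ n := by
  simp only [hyp0F1Reg, hypCoeff, div_eq_inv_mul]

lemma hypCoeff_succ (c : ℂ) (n : ℕ) : (n + 1 : ℂ) * hypCoeff c (n + 1) = hypCoeff (c + 1) n := by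
  have hn : (n + 1 : ℂ) ≠ 0 := by exact_mod_cast n.succ_ne_zero
  simp only [hypCoeff, Nat.factorial_succ, Nat.cast_mul, mul_inv]
  push_cast
  rw [show c + ((n : ℂ) + 1) = c + 1 + n by ring]
  field_simp

/-- `Γ` takes the value `0` at its poles, so its inverse is the entire function `1 / Γ` everywhere.
The functional equation in reciprocal form therefore needs no exception for `c`, and none appears
later for integer orders. -/
lemma hypCoeff_contiguous (c : ℂ) (n : ℕ) : hypCoeff c n = (c + n) * hypCoeff (c + 1) n := by
  have h := Complex.one_div_Gamma_eq_self_mul_one_div_Gamma_add_one (c + n)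
  simp only [hypCoeff, mul_inv]
  rw [show c + 1 + (n : ℂ) = c + n + 1 by ring, h]
  ring

lemma summable_hypCoeff (c w : ℂ) : Summable fun n => hypCoeff c n * w ^ n := by
  refine summable_of_ratio_norm_eventually_le (r := 1 / 2) (by norm_num) ?_
  obtain ⟨N, hN⟩ := exists_nat_gt (‖c‖ + 2 * ‖w‖ + 1)
  filter_upwards [eventually_ge_atTop N] with n hn
  have hn1 : (N : ℝ) ≤ n := by exact_mod_cast hn
  -- The ratio of coefficients is used in multiplied form, since coefficients may vanish for small
  -- `n`.
  have h1 : ((n : ℂ) + 1) * ((c + n) * hypCoeff c (n + 1)) = hypCoeff c n := by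
    rw [hypCoeff_contiguous c n, ← hypCoeff_succ]; ring
  have h2 : 2 * ‖w‖ + 1 ≤ ‖c + n‖ := by
    have h3 : (n : ℝ) ≤ ‖c + n‖ + ‖c‖ := by
      have := norm_sub_le (c + n) c
      rwa [add_sub_cancel_left, Complex.norm_natCast] at this
    linarith
  have h4 : ‖((n : ℂ) + 1)‖ = n + 1 := by
    rw [show ((n : ℂ) + 1) = ((n + 1 : ℕ) : ℂ) by push_cast; rfl, Complex.norm_natCast]
    push_cast; rfl
  have h5 : (1 : ℝ) ≤ (n + 1 : ℝ) := by linarith [(Nat.cast_nonneg n : (0 : ℝ) ≤ n)]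
  rw [← h1]
  simp only [norm_mul, norm_pow, pow_succ, h4]
  have h6 : 2 * ‖w‖ ≤ (n + 1) * ‖c + n‖ := by nlinarith [norm_nonneg w]
  have h7 : 0 ≤ ‖hypCoeff c (n + 1)‖ * ‖w‖ ^ n := by positivity
  nlinarith

lemma summable_norm_hypCoeff (c w : ℂ) : Summable fun n => ‖hypCoeff c n * w ^ n‖ :=
  (summable_hypCoeff c w).norm

lemma hasDerivAt_hyp0F1Reg (c w : ℂ) : HasDerivAt (hyp0F1Reg c) (hyp0F1Reg (c + 1) w) w := by
  set R : ℝ := ‖w‖ + 1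
  have hR : (0 : ℝ) ≤ R := by positivity
  have hsum : Summable fun n : ℕ => ‖(n : ℂ) * hypCoeff c n‖ * R ^ (n - 1) := by
    rw [← summable_nat_add_iff 1]
    have := summable_norm_hypCoeff (c + 1) R
    refine this.congr fun n => ?_
    rw [norm_mul, norm_pow, Complex.norm_real, Real.norm_of_nonneg hR, ← hypCoeff_succ]
    simp
  have key := hasDerivAt_tsum_of_isPreconnected (t := Metric.ball (0 : ℂ) R)
    (g := fun n z => hypCoeff c n * z ^ n) (g' := fun n z => (n : ℂ) * hypCoeff c n * z ^ (n - 1))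
    (y₀ := 0) (y := w) hsum Metric.isOpen_ball (convex_ball _ _).isPreconnected ?_ ?_ ?_ ?_ ?_
  · have h0 : hyp0F1Reg c = fun z => ∑' n, hypCoeff c n * z ^ n := by
      funext z; exact hyp0F1Reg_eq c z
    rw [h0]
    refine key.congr_deriv ?_
    have hs : Summable fun n : ℕ => (n : ℂ) * hypCoeff c n * w ^ (n - 1) := by
      rw [← summable_nat_add_iff 1]
      refine (summable_hypCoeff (c + 1) w).congr fun n => ?_
      rw [← hypCoeff_succ]; simp
    rw [hs.tsum_eq_zero_add, hyp0F1Reg_eq]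
    simp only [← hypCoeff_succ]
    simp
  · intro n y _
    exact ((hasDerivAt_pow n y).const_mul (hypCoeff c n)).congr_deriv (by ring)
  · intro n y hy
    rw [norm_mul, norm_pow]
    have : ‖y‖ ≤ R := by simpa using (mem_ball_zero_iff.1 hy).le
    gcongr
  · simp only [Metric.mem_ball, dist_self]; positivity
  · exact summable_hypCoeff c 0
  · simp [R]

/-- Since differentiation raises `c` by one, this is the differential equation `f = c f' + w f''` in
disguise; it is proved coefficientwise. -/
lemma hyp0F1Reg_contiguous (c w : ℂ) :
    hyp0F1Reg c w = c * hyp0F1Reg (c + 1) w + w * hyp0F1Reg (c + 2) w := by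
  have hs : Summable fun n : ℕ => (n : ℂ) * hypCoeff (c + 1) n * w ^ n := by
    rw [← summable_nat_add_iff 1]
    refine ((summable_hypCoeff (c + 2) w).mul_left w).congr fun n => ?_
    rw [show c + 2 = c + 1 + 1 by ring, ← hypCoeff_succ (c + 1)]; push_cast; ring
  have h2 : ∑' n : ℕ, (n : ℂ) * hypCoeff (c + 1) n * w ^ n = w * hyp0F1Reg (c + 2) w := by
    rw [hs.tsum_eq_zero_add, hyp0F1Reg_eq, ← tsum_mul_left]
    simp only [Nat.cast_zero, zero_mul, zero_add]
    refine tsum_congr fun n => ?_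
    rw [show c + 2 = c + 1 + 1 by ring, ← hypCoeff_succ (c + 1)]; push_cast; ring
  rw [← h2, hyp0F1Reg_eq, hyp0F1Reg_eq, ← tsum_mul_left,
    ← ((summable_hypCoeff (c + 1) w).mul_left c).tsum_add hs]
  refine tsum_congr fun n => ?_
  rw [hypCoeff_contiguous c n]; ring

lemma hyp0F1Reg_zero (c : ℂ) : hyp0F1Reg c 0 = (Complex.Gamma c)⁻¹ := by
  rw [hyp0F1Reg_eq, tsum_eq_single 0]
  · simp [hypCoeff]
  · intro n hn; simp [hn]

/-! ### The ladder relations of the Bessel functions -/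

/-- The factor `(ℓ eˣ / 2) ^ m`. -/
lemma half_exp_cpow {ℓ : ℝ} (hℓ : 0 < ℓ) (m : ℂ) (x : ℝ) :
    ((ℓ * Real.exp x / 2 : ℝ) : ℂ) ^ m = ((ℓ / 2 : ℝ) : ℂ) ^ m * Complex.exp (m * x) := by
  rw [show ℓ * Real.exp x / 2 = ℓ / 2 * Real.exp x by ring, Complex.ofReal_mul,
    Complex.mul_cpow_ofReal_nonneg (by positivity) (Real.exp_pos x).le]
  congr 1
  rw [Complex.cpow_def_of_ne_zero (by exact_mod_cast (Real.exp_pos x).ne'),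
    ← Complex.ofReal_log (Real.exp_pos x).le, Real.log_exp, mul_comm]

lemma hasDerivAt_cexp_ofReal (m : ℂ) (x : ℝ) :
    HasDerivAt (fun x : ℝ => Complex.exp (m * x)) (m * Complex.exp (m * x)) x := by
  have h := ((Complex.ofRealCLM.hasDerivAt (x := x)).const_mul m).cexp
  simpa [mul_comm] using h

lemma hasDerivAt_mul_exp (ℓ : ℝ) (x : ℝ) :
    HasDerivAt (fun x : ℝ => ℓ * Real.exp x) (ℓ * Real.exp x) x :=
  (Real.hasDerivAt_exp x).const_mul ℓ

lemma besselJ_exp_eq {ℓ : ℝ} (hℓ : 0 < ℓ) (m : ℂ) (x : ℝ) :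
    besselJ m (ℓ * Real.exp x) = ((ℓ / 2 : ℝ) : ℂ) ^ m * Complex.exp (m * x) *
      hyp0F1Reg (m + 1) (-(((ℓ * Real.exp x : ℝ) : ℂ) ^ 2 / 4)) := by
  rw [besselJ, half_exp_cpow hℓ]

lemma half_cpow_succ {ℓ : ℝ} (hℓ : 0 < ℓ) (m : ℂ) (x : ℝ) :
    ((ℓ / 2 : ℝ) : ℂ) ^ (m + 1) * Complex.exp ((m + 1) * x) =
      ((ℓ / 2 : ℝ) : ℂ) ^ m * Complex.exp (m * x) * (((ℓ * Real.exp x : ℝ) : ℂ) / 2) := by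
  have h0 : ((ℓ / 2 : ℝ) : ℂ) ≠ 0 := by
    have : ℓ / 2 ≠ 0 := by positivity
    exact_mod_cast this
  rw [Complex.cpow_add _ _ h0, Complex.cpow_one, add_mul, Complex.exp_add, one_mul]
  push_cast
  ring

lemma hasDerivAt_besselJ_exp {ℓ : ℝ} (hℓ : 0 < ℓ) (m : ℂ) (x : ℝ) :
    HasDerivAt (fun x : ℝ => besselJ m (ℓ * Real.exp x))
      (m * besselJ m (ℓ * Real.exp x) -
        ((ℓ * Real.exp x : ℝ) : ℂ) * besselJ (m + 1) (ℓ * Real.exp x)) x := by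
  have h1 := (hasDerivAt_cexp_ofReal m x).const_mul (((ℓ / 2 : ℝ) : ℂ) ^ m)
  have h2 : HasDerivAt (fun x : ℝ => -(((ℓ * Real.exp x : ℝ) : ℂ) ^ 2 / 4))
      (-(((ℓ * Real.exp x : ℝ) : ℂ) ^ 2 / 2)) x := by
    have := (((hasDerivAt_mul_exp ℓ x).ofReal_comp.pow 2).div_const 4).neg
    refine this.congr_deriv ?_
    push_cast; ring
  have h3 := (hasDerivAt_hyp0F1Reg (m + 1) (-(((ℓ * Real.exp x : ℝ) : ℂ) ^ 2 / 4))).comp x h2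
  have h4 := h1.mul h3
  have h5 : (fun x : ℝ => besselJ m (ℓ * Real.exp x)) = fun x : ℝ =>
      ((ℓ / 2 : ℝ) : ℂ) ^ m * Complex.exp (m * x) *
      hyp0F1Reg (m + 1) (-(((ℓ * Real.exp x : ℝ) : ℂ) ^ 2 / 4)) := by
    funext x; exact besselJ_exp_eq hℓ m x
  rw [h5]
  refine h4.congr_deriv ?_
  rw [besselJ_exp_eq hℓ, besselJ_exp_eq hℓ, half_cpow_succ hℓ]
  simp only [Function.comp]
  ring

/-- This is the contiguous relation at `w = -r²/4`: each unit of order contributes a factor `r / 2`.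
-/
lemma besselJ_contiguous {ℓ : ℝ} (hℓ : 0 < ℓ) (m : ℂ) (x : ℝ) :
    ((ℓ * Real.exp x : ℝ) : ℂ) * (besselJ m (ℓ * Real.exp x) + besselJ (m + 2) (ℓ * Real.exp x)) =
      2 * (m + 1) * besselJ (m + 1) (ℓ * Real.exp x) := by
  rw [show m + 2 = m + 1 + 1 by ring, besselJ_exp_eq hℓ, besselJ_exp_eq hℓ, besselJ_exp_eq hℓ,
    half_cpow_succ hℓ (m + 1), half_cpow_succ hℓ m, hyp0F1Reg_contiguous (m + 1),
    show m + 1 + 1 + 1 = m + 1 + 2 by ring]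
  ring

/-- The limit is zero when `m` is a negative integer; uses that need a nonzero limit have to bound
`Re m` from below. -/
lemma tendsto_besselJ_exp_atBot {ℓ : ℝ} (hℓ : 0 < ℓ) (m : ℂ) :
    Tendsto (fun x : ℝ => Complex.exp (-(m * x)) * besselJ m (ℓ * Real.exp x)) atBot
      (𝓝 (((ℓ / 2 : ℝ) : ℂ) ^ m * (Complex.Gamma (m + 1))⁻¹)) := by
  have h1 : Tendsto (fun x : ℝ => -(((ℓ * Real.exp x : ℝ) : ℂ) ^ 2 / 4)) atBot (𝓝 0) := by
    have h : Continuous fun t : ℝ => -(((ℓ * t : ℝ) : ℂ) ^ 2 / 4) := by fun_prop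
    have := (h.tendsto' 0 0 (by simp)).comp Real.tendsto_exp_atBot
    exact this
  have h2 := ((hasDerivAt_hyp0F1Reg (m + 1) 0).continuousAt.tendsto.comp h1).const_mul
    (((ℓ / 2 : ℝ) : ℂ) ^ m)
  rw [hyp0F1Reg_zero] at h2
  refine h2.congr fun x => ?_
  rw [besselJ_exp_eq hℓ, Complex.exp_neg]
  have := Complex.exp_ne_zero (m * x)
  simp only [Function.comp]
  field_simp

/-! ### The steepest descent path -/

lemma one_add_half_sq_le_cosh (s : ℝ) : 1 + s ^ 2 / 2 ≤ Real.cosh s := by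
  have h1 : Real.cosh s = 1 + 2 * Real.sinh (s / 2) ^ 2 := by
    have h := Real.cosh_two_mul (s / 2)
    rw [Real.cosh_sq] at h
    rw [show s = 2 * (s / 2) by ring, h]; ring_nf
  -- The half-angle formula turns the claim into `|t| ≤ |sinh t|` at `t = s / 2`.
  have h2 : |s / 2| ≤ |Real.sinh (s / 2)| := by
    rw [Real.abs_sinh]; exact Real.self_le_sinh_iff.2 (abs_nonneg _)
  have h3 := sq_le_sq.2 h2
  rw [h1]; linarith

/-- The path of steepest descent `s + i arctan (sinh s)` through the saddle of `cosh` at `0`. -/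
noncomputable def descentPath (s : ℝ) : ℂ := s + Complex.I * (Real.arctan (Real.sinh s) : ℝ)

/-- The height `cosh s - 1 / cosh s` of `cosh` along the path of steepest descent. -/
noncomputable def descentHeight (s : ℝ) : ℝ := Real.cosh s - (Real.cosh s)⁻¹

/-- The derivative of the path of steepest descent. -/
noncomputable def descentSpeed (s : ℝ) : ℂ := 1 + Complex.I * ((Real.cosh s)⁻¹ : ℝ)

lemma hasDerivAt_descentPath (s : ℝ) : HasDerivAt descentPath (descentSpeed s) s := by
  have h1 : HasDerivAt (fun s => Real.arctan (Real.sinh s)) (Real.cosh s)⁻¹ s := by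
    refine ((Real.hasDerivAt_arctan _).comp s (Real.hasDerivAt_sinh s)).congr_deriv ?_
    rw [add_comm, ← Real.cosh_sq]
    have := (Real.cosh_pos s).ne'
    field_simp
  have h2 := (h1.ofReal_comp.const_mul Complex.I)
  exact (Complex.ofRealCLM.hasDerivAt (x := s)).add h2

lemma continuous_descentPath : Continuous descentPath :=
  continuous_iff_continuousAt.2 fun s => (hasDerivAt_descentPath s).continuousAt

lemma continuous_descentHeight : Continuous descentHeight :=
  Real.continuous_cosh.sub (Real.continuous_cosh.inv₀ fun s => (Real.cosh_pos s).ne')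

lemma continuous_descentSpeed : Continuous descentSpeed := by
  have := Real.continuous_cosh.inv₀ fun s => (Real.cosh_pos s).ne'
  exact continuous_const.add (continuous_const.mul (Complex.continuous_ofReal.comp this))

lemma descentPath_neg (s : ℝ) : descentPath (-s) = -descentPath s := by
  simp only [descentPath, Real.sinh_neg, Real.arctan_neg]; push_cast; ring

lemma descentSpeed_neg (s : ℝ) : descentSpeed (-s) = descentSpeed s := by
  simp [descentSpeed]

lemma norm_descentSpeed_le (s : ℝ) : ‖descentSpeed s‖ ≤ 2 := by
  refine (norm_add_le _ _).trans ?_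
  rw [norm_one, norm_mul, Complex.norm_I, one_mul, Complex.norm_real, norm_inv,
    Real.norm_of_nonneg (Real.cosh_pos s).le]
  have := inv_le_one_of_one_le₀ (Real.one_le_cosh s)
  linarith

/-- The angle `θ = arctan (sinh s)` has `cos θ = 1 / cosh s` and `sin θ = tanh s`. The real part
`cosh s cos θ` is thus constant, so `exp (i r cosh w)` has a fixed phase along the path and its
modulus decays with the height. -/
lemma cosh_descentPath (s : ℝ) :
    Complex.cosh (descentPath s) = 1 + Complex.I * (descentHeight s : ℝ) := by
  have h0 := Real.cosh_pos s
  have h1 : √(1 + Real.sinh s ^ 2) = Real.cosh s := by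
    rw [add_comm, ← Real.cosh_sq, Real.sqrt_sq h0.le]
  have h2 : Real.cosh s * Real.cos (Real.arctan (Real.sinh s)) = 1 := by
    rw [Real.cos_arctan, h1]; field_simp
  have h3 : Real.sinh s * Real.sin (Real.arctan (Real.sinh s)) = descentHeight s := by
    rw [Real.sin_arctan, h1, descentHeight]
    field_simp
    rw [Real.cosh_sq]; ring
  rw [descentPath, Complex.cosh_add, mul_comm Complex.I, Complex.cosh_mul_I, Complex.sinh_mul_I,
    ← h3, ← Complex.ofReal_cosh, ← Complex.ofReal_sinh, ← Complex.ofReal_cos, ← Complex.ofReal_sin]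
  have h4 : (Real.cosh s : ℂ) * (Real.cos (Real.arctan (Real.sinh s)) : ℝ) = 1 := by
    exact_mod_cast h2
  rw [h4]; push_cast; ring

lemma half_sq_le_descentHeight (s : ℝ) : s ^ 2 / 2 ≤ descentHeight s := by
  have h1 := inv_le_one_of_one_le₀ (Real.one_le_cosh s)
  have h2 := one_add_half_sq_le_cosh s
  simp only [descentHeight]; linarith

/-- The function `exp (i r cosh w - m w)` along the path of steepest descent. -/
noncomputable def descentExp (m : ℂ) (r s : ℝ) : ℂ :=
  Complex.exp (Complex.I * r * Complex.cosh (descentPath s) - m * descentPath s)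

/-- Sommerfeld's integral for the Hankel functions, along the path of steepest descent. -/
noncomputable def sommerfeld (m : ℂ) (r : ℝ) : ℂ := ∫ s, descentExp m r s * descentSpeed s

/-- The path stays in the strip `|Im w| < π / 2 < 2`, which accounts for the summand `2`. -/
lemma norm_exp_mul_descentPath_le (m : ℂ) (s : ℝ) :
    ‖Complex.exp (-(m * descentPath s))‖ ≤ Real.exp (‖m‖ * (|s| + 2)) := by
  rw [Complex.norm_exp]
  refine Real.exp_le_exp.2 ?_
  refine (Complex.re_le_norm _).trans ?_
  rw [norm_neg, norm_mul]
  gcongr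
  refine (norm_add_le _ _).trans ?_
  rw [norm_mul, Complex.norm_I, one_mul, Complex.norm_real, Complex.norm_real, Real.norm_eq_abs,
    Real.norm_eq_abs]
  gcongr
  have h1 := Real.arctan_lt_pi_div_two (Real.sinh s)
  have h2 := Real.neg_pi_div_two_lt_arctan (Real.sinh s)
  have h3 := Real.pi_lt_four
  rw [abs_le]; constructor <;> linarith

lemma descentExp_eq (m : ℂ) (r s : ℝ) : descentExp m r s =
    Complex.exp (Complex.I * r) * Complex.exp (-((r * descentHeight s : ℝ) : ℂ)) *
      Complex.exp (-(m * descentPath s)) := by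
  rw [descentExp, cosh_descentPath, ← Complex.exp_add, ← Complex.exp_add]
  congr 1
  push_cast
  linear_combination (r * descentHeight s : ℂ) * Complex.I_mul_I

lemma norm_descentExp_le {m : ℂ} {A : ℝ} (hA : ‖m‖ ≤ A) (r s : ℝ) :
    ‖descentExp m r s‖ ≤ Real.exp (-(r * descentHeight s) + A * (|s| + 2)) := by
  rw [descentExp_eq, norm_mul, norm_mul, Real.exp_add, mul_comm Complex.I,
    Complex.norm_exp_ofReal_mul_I, one_mul, ← Complex.ofReal_neg, ← Complex.ofReal_exp,
    Complex.norm_real, Real.norm_of_nonneg (Real.exp_pos _).le]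
  gcongr
  refine (norm_exp_mul_descentPath_le m s).trans ?_
  gcongr

lemma continuous_descentExp (m : ℂ) (r : ℝ) : Continuous (descentExp m r) := by
  have := continuous_descentPath
  have h2 := Complex.continuous_cosh
  unfold descentExp
  fun_prop

lemma integrable_exp_sq_add_abs {r : ℝ} (hr : 0 < r) (A : ℝ) :
    Integrable fun s : ℝ => Real.exp (-(r * (s ^ 2 / 2)) + A * (|s| + 2)) := by
  have h := (integrable_exp_neg_mul_sq (b := r / 4) (by positivity)).const_mul
    (Real.exp (A ^ 2 / r + 2 * A))
  refine h.mono' (by fun_prop) (Eventually.of_forall fun s => ?_)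
  rw [Real.norm_of_nonneg (Real.exp_pos _).le, ← Real.exp_add]
  refine Real.exp_le_exp.2 ?_
  -- Completing the square absorbs the linear term `A |s|` into half of the Gaussian exponent.
  have h1 : 0 ≤ r * (|s| / 2 - A / r) ^ 2 := by positivity
  have h2 : r * (|s| / 2 - A / r) ^ 2 = r * s ^ 2 / 4 - A * |s| + A ^ 2 / r := by
    field_simp
    rw [show s ^ 2 = |s| ^ 2 from (sq_abs s).symm]
    ring
  linarith

lemma integrable_descentBound {r : ℝ} (hr : 0 < r) (A : ℝ) :
    Integrable fun s : ℝ => Real.exp (-(r * descentHeight s) + A * (|s| + 2)) := by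
  have hc := continuous_descentHeight
  refine (integrable_exp_sq_add_abs hr A).mono' (by fun_prop) (Eventually.of_forall fun s => ?_)
  rw [Real.norm_of_nonneg (Real.exp_pos _).le]
  have := half_sq_le_descentHeight s
  gcongr

lemma norm_descentIntegrand_le {m : ℂ} {A : ℝ} (hA : ‖m‖ ≤ A) (r s : ℝ) :
    ‖descentExp m r s * descentSpeed s‖ ≤
      Real.exp (-(r * descentHeight s) + A * (|s| + 2)) * 2 := by
  rw [norm_mul]
  exact mul_le_mul (norm_descentExp_le hA r s) (norm_descentSpeed_le s) (norm_nonneg _)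
    (Real.exp_pos _).le

lemma continuous_descentIntegrand (m : ℂ) (r : ℝ) :
    Continuous fun s => descentExp m r s * descentSpeed s :=
  (continuous_descentExp m r).mul continuous_descentSpeed

lemma integrable_descentIntegrand (m : ℂ) {r : ℝ} (hr : 0 < r) :
    Integrable fun s => descentExp m r s * descentSpeed s :=
  ((integrable_descentBound hr ‖m‖).mul_const 2).mono'
    (continuous_descentIntegrand m r).aestronglyMeasurable
    (Eventually.of_forall fun s => norm_descentIntegrand_le le_rfl r s)

lemma integrable_descentExp (m : ℂ) {r : ℝ} (hr : 0 < r) : Integrable (descentExp m r) :=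
  (integrable_descentBound hr ‖m‖).mono' (continuous_descentExp m r).aestronglyMeasurable
    (Eventually.of_forall fun s => norm_descentExp_le le_rfl r s)

/-! ### Evenness, recurrence and derivative of Sommerfeld's integral -/

lemma sommerfeld_neg (m : ℂ) (r : ℝ) : sommerfeld (-m) r = sommerfeld m r := by
  -- Under `s ↦ -s` the path is odd, while its speed and `cosh` are even.
  rw [sommerfeld, sommerfeld, ← integral_neg_eq_self (fun s => descentExp m r s * descentSpeed s)]
  refine integral_congr_ae (Eventually.of_forall fun s => ?_)
  simp only [descentExp, descentPath_neg, descentSpeed_neg, Complex.cosh_neg]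
  ring_nf

lemma descentExp_sub_one (m : ℂ) (r s : ℝ) :
    descentExp (m - 1) r s = descentExp m r s * Complex.exp (descentPath s) := by
  rw [descentExp, descentExp, ← Complex.exp_add]; congr 1; ring

lemma descentExp_add_one (m : ℂ) (r s : ℝ) :
    descentExp (m + 1) r s = descentExp m r s * Complex.exp (-descentPath s) := by
  rw [descentExp, descentExp, ← Complex.exp_add]; congr 1; ring

/-- Integration by parts: the total derivative of `exp (i r cosh w - m w)` along the path integrates
to zero, and `sinh w` is half the difference of the two shifts of the order by one. -/
lemma sommerfeld_contiguous (m : ℂ) {r : ℝ} (hr : 0 < r) :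
    Complex.I * r * (sommerfeld (m - 1) r - sommerfeld (m + 1) r) = 2 * m * sommerfeld m r := by
  have hd : ∀ s, HasDerivAt (descentExp m r)
      (Complex.I * r / 2 * (descentExp (m - 1) r s * descentSpeed s -
        descentExp (m + 1) r s * descentSpeed s) - m * (descentExp m r s * descentSpeed s)) s := by
    intro s
    have hw := hasDerivAt_descentPath s
    have h1 := ((Complex.hasDerivAt_cosh (descentPath s)).comp s hw).const_mul (Complex.I * r)
    have h2 := (h1.sub (hw.const_mul m)).cexp
    refine h2.congr_deriv ?_
    rw [descentExp_sub_one, descentExp_add_one, Complex.sinh, descentExp]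
    simp only [Function.comp, Pi.sub_apply]
    ring
  have i0 := integrable_descentIntegrand m hr
  have i1 := integrable_descentIntegrand (m - 1) hr
  have i2 := integrable_descentIntegrand (m + 1) hr
  have h := integral_eq_zero_of_hasDerivAt_of_integrable hd
    (((i1.sub i2).const_mul _).sub (i0.const_mul m)) (integrable_descentExp m hr)
  have e1 := integral_sub ((i1.sub i2).const_mul (Complex.I * r / 2)) (i0.const_mul m)
  have e2 := integral_sub i1 i2
  simp only [Pi.sub_apply, integral_const_mul] at e1
  rw [e1, e2] at h
  simp only [sommerfeld]
  linear_combination 2 * h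

/-- Differentiation under the integral produces `cosh w`, half the sum of the two shifts of the
order. The dominating function takes the radius `r / 2`, which serves a whole neighbourhood of `r`.
-/
lemma hasDerivAt_sommerfeld (m : ℂ) {r : ℝ} (hr : 0 < r) :
    HasDerivAt (sommerfeld m)
      (Complex.I / 2 * (sommerfeld (m - 1) r + sommerfeld (m + 1) r)) r := by
  have h := hasDerivAt_integral_of_dominated_loc_of_deriv_le (μ := volume)
    (F := fun r s => descentExp m r s * descentSpeed s)
    (F' := fun r s => Complex.I / 2 * (descentExp (m - 1) r s * descentSpeed s +
      descentExp (m + 1) r s * descentSpeed s))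
    (bound := fun s => Real.exp (-(r / 2 * descentHeight s) + (‖m‖ + 1) * (|s| + 2)) * 2)
    (x₀ := r) (s := Ioi (r / 2)) (Ioi_mem_nhds (by linarith))
    (Eventually.of_forall fun r => (continuous_descentIntegrand m r).aestronglyMeasurable)
    (integrable_descentIntegrand m hr) ?_ ?_ ?_ ?_
  · refine h.2.congr_deriv ?_
    rw [integral_const_mul, integral_add (integrable_descentIntegrand _ hr)
      (integrable_descentIntegrand _ hr)]
    rfl
  · exact (continuous_const.mul ((continuous_descentIntegrand _ r).add
      (continuous_descentIntegrand _ r))).aestronglyMeasurable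
  · refine Eventually.of_forall fun s x hx => ?_
    have hb : ∀ k : ℂ, ‖k‖ ≤ ‖m‖ + 1 → ‖descentExp k x s * descentSpeed s‖ ≤
        Real.exp (-(r / 2 * descentHeight s) + (‖m‖ + 1) * (|s| + 2)) * 2 := by
      intro k hk
      refine (norm_descentIntegrand_le hk x s).trans ?_
      have h1 : 0 ≤ descentHeight s := le_trans (by positivity) (half_sq_le_descentHeight s)
      have h2 : r / 2 ≤ x := (mem_Ioi.1 hx).le
      gcongr
    have h1 := hb (m - 1) ((norm_sub_le _ _).trans (by simp))
    have h2 := hb (m + 1) ((norm_add_le _ _).trans (by simp))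
    rw [norm_mul, norm_div, Complex.norm_I]
    have h3 := norm_add_le (descentExp (m - 1) x s * descentSpeed s)
      (descentExp (m + 1) x s * descentSpeed s)
    simp only [Complex.norm_ofNat]
    linarith
  · exact (integrable_descentBound (by positivity) _).mul_const 2
  · refine Eventually.of_forall fun s x _ => ?_
    have h1 := (((Complex.ofRealCLM.hasDerivAt (x := x)).const_mul Complex.I).mul_const
      (Complex.cosh (descentPath s))).sub_const (m * descentPath s)
    refine (h1.cexp.mul_const (descentSpeed s)).congr_deriv ?_
    rw [descentExp_sub_one, descentExp_add_one, descentExp, Complex.cosh]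
    simp only [Complex.ofRealCLM_apply, Complex.ofReal_one]
    ring

/-- This is what gives the Hankel functions of integer order, which are defined as limits. -/
lemma continuous_sommerfeld_order {r : ℝ} (hr : 0 < r) : Continuous fun m => sommerfeld m r := by
  refine continuous_iff_continuousAt.2 fun m => ?_
  refine continuousAt_of_dominated
    (bound := fun s => Real.exp (-(r * descentHeight s) + (‖m‖ + 1) * (|s| + 2)) * 2)
    (Eventually.of_forall fun k => (continuous_descentIntegrand k r).aestronglyMeasurable)
    ?_ ((integrable_descentBound hr _).mul_const 2) (Eventually.of_forall fun s => ?_)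
  · filter_upwards [Metric.ball_mem_nhds m one_pos] with k hk
    refine Eventually.of_forall fun s => norm_descentIntegrand_le ?_ r s
    have h1 : ‖k - m‖ < 1 := by simpa [dist_eq_norm] using hk
    have h2 := norm_add_le (k - m) m
    rw [sub_add_cancel] at h2
    linarith
  · unfold descentExp
    fun_prop

/-! ### Behaviour of Sommerfeld's integral at infinity -/

/-- The height equals `sinh² / cosh`, so after division by `ε²` the limit is the square of the slope
of `sinh (ε σ)` at `ε = 0`. -/
lemma tendsto_descentHeight_scaled (σ : ℝ) :
    Tendsto (fun ε : ℝ => descentHeight (ε * σ) / ε ^ 2) (𝓝[≠] 0) (𝓝 (σ ^ 2)) := by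
  have h1 : HasDerivAt (fun ε : ℝ => Real.sinh (ε * σ)) σ 0 := by
    have h := (Real.hasDerivAt_sinh (0 * σ)).comp 0 ((hasDerivAt_id (0 : ℝ)).mul_const σ)
    exact h.congr_deriv (by simp)
  have h2 := h1.tendsto_slope
  have h3 : Tendsto (fun ε : ℝ => Real.cosh (ε * σ)) (𝓝[≠] 0) (𝓝 1) := by
    have : Continuous fun ε : ℝ => Real.cosh (ε * σ) :=
      Real.continuous_cosh.comp (continuous_id.mul continuous_const)
    exact (this.tendsto' 0 1 (by simp)).mono_left nhdsWithin_le_nhds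
  have h4 := (h2.pow 2).div h3 one_ne_zero
  rw [div_one] at h4
  refine h4.congr fun ε => ?_
  simp only [Pi.div_apply, slope_def_field, zero_mul, Real.sinh_zero, sub_zero,
    descentHeight]
  have hc := (Real.cosh_pos (ε * σ)).ne'
  rw [div_pow, show Real.sinh (ε * σ) ^ 2 = Real.cosh (ε * σ) ^ 2 - 1 by rw [Real.cosh_sq]; ring]
  field_simp

/-- Laplace's method: with `s = σ / √r` the integrand tends to the Gaussian `exp (-σ²)`, of integral
`√π`, times the speed `1 + i` of the path at the saddle. The order drops out of the limit. -/
lemma tendsto_sommerfeld_atTop (m : ℂ) :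
    Tendsto (fun r : ℝ => (√r : ℂ) * Complex.exp (-(Complex.I * r)) * sommerfeld m r) atTop
      (𝓝 ((1 + Complex.I) * (√Real.pi : ℝ))) := by
  have hlim : Tendsto (fun r : ℝ => (√r)⁻¹) atTop (𝓝[≠] 0) := by
    refine tendsto_nhdsWithin_iff.2 ⟨tendsto_inv_atTop_zero.comp Real.tendsto_sqrt_atTop, ?_⟩
    filter_upwards [eventually_gt_atTop 0] with r hr
    have := Real.sqrt_pos.2 hr
    simp only [mem_compl_iff, mem_singleton_iff]
    positivity
  have hlim0 : Tendsto (fun r : ℝ => (√r)⁻¹) atTop (𝓝 0) := hlim.mono_right nhdsWithin_le_nhds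
  have key := tendsto_integral_filter_of_dominated_convergence (μ := volume) (l := atTop)
    (F := fun r σ : ℝ => Complex.exp (-((r * descentHeight ((√r)⁻¹ * σ) : ℝ) : ℂ)) *
      Complex.exp (-(m * descentPath ((√r)⁻¹ * σ))) * descentSpeed ((√r)⁻¹ * σ))
    (f := fun σ : ℝ => ((Real.exp (-1 * σ ^ 2) : ℝ) : ℂ) * (1 + Complex.I))
    (fun σ => Real.exp (-(1 * (σ ^ 2 / 2)) + ‖m‖ * (|σ| + 2)) * 2) ?_ ?_
    ((integrable_exp_sq_add_abs one_pos _).mul_const 2) ?_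
  · rw [integral_mul_const, integral_complex_ofReal, integral_gaussian, div_one] at key
    rw [mul_comm]
    refine key.congr' ?_
    filter_upwards [eventually_gt_atTop 0] with r hr
    have hs := Real.sqrt_pos.2 hr
    have h1 := Measure.integral_comp_mul_left (fun s => descentExp m r s * descentSpeed s) (√r)⁻¹
    rw [inv_inv, abs_of_pos hs, Complex.real_smul] at h1
    rw [sommerfeld, mul_comm (√r : ℂ), mul_assoc, ← h1, ← integral_const_mul]
    refine integral_congr_ae (Eventually.of_forall fun σ => ?_)
    simp only [descentExp_eq, Complex.exp_neg (Complex.I * r)]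
    have := Complex.exp_ne_zero (Complex.I * r)
    field_simp
  · refine Eventually.of_forall fun r => Continuous.aestronglyMeasurable ?_
    have h1 := continuous_descentHeight
    have h2 := continuous_descentPath
    have h3 := continuous_descentSpeed
    fun_prop
  · filter_upwards [eventually_ge_atTop 1] with r hr
    refine Eventually.of_forall fun σ => ?_
    have hs : 1 ≤ √r := by rw [← Real.sqrt_one]; exact Real.sqrt_le_sqrt hr
    have hs1 : (√r)⁻¹ ≤ 1 := inv_le_one_of_one_le₀ hs
    have hs0 : 0 ≤ (√r)⁻¹ := by positivity
    rw [norm_mul, norm_mul, Real.exp_add, ← Complex.ofReal_neg, ← Complex.ofReal_exp,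
      Complex.norm_real, Real.norm_of_nonneg (Real.exp_pos _).le]
    have h1 : 1 * (σ ^ 2 / 2) ≤ r * descentHeight ((√r)⁻¹ * σ) := by
      have h := half_sq_le_descentHeight ((√r)⁻¹ * σ)
      rw [mul_pow, inv_pow, Real.sq_sqrt (by linarith)] at h
      have h' : r * (r⁻¹ * σ ^ 2 / 2) ≤ r * descentHeight ((√r)⁻¹ * σ) :=
        mul_le_mul_of_nonneg_left h (by linarith)
      refine le_trans (le_of_eq ?_) h'
      field_simp
    have h2 : ‖Complex.exp (-(m * descentPath ((√r)⁻¹ * σ)))‖ ≤ Real.exp (‖m‖ * (|σ| + 2)) := by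
      refine (norm_exp_mul_descentPath_le m _).trans ?_
      have : |(√r)⁻¹ * σ| ≤ |σ| := by
        rw [abs_mul, abs_of_nonneg hs0]
        exact mul_le_of_le_one_left (abs_nonneg σ) hs1
      gcongr
    have h3 := norm_descentSpeed_le ((√r)⁻¹ * σ)
    have h4 : Real.exp (-(r * descentHeight ((√r)⁻¹ * σ))) ≤ Real.exp (-(1 * (σ ^ 2 / 2))) :=
      Real.exp_le_exp.2 (neg_le_neg h1)
    exact mul_le_mul (mul_le_mul h4 h2 (norm_nonneg _) (Real.exp_pos _).le) h3 (norm_nonneg _)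
      (by positivity)
  · refine Eventually.of_forall fun σ => ?_
    have hcont : ∀ {f : ℝ → ℂ}, Continuous f →
        Tendsto (fun r : ℝ => f ((√r)⁻¹ * σ)) atTop (𝓝 (f 0)) := by
      intro f hf
      have h := (hf.comp (continuous_mul_const σ)).tendsto' 0 (f 0) (by simp)
      exact h.comp hlim0
    have hexp : Continuous fun s => Complex.exp (-(m * descentPath s)) := by
      have h2 := continuous_descentPath
      fun_prop
    have h1 := (tendsto_descentHeight_scaled σ).comp hlim
    have h2 : Tendsto (fun r : ℝ => r * descentHeight ((√r)⁻¹ * σ)) atTop (𝓝 (σ ^ 2)) := by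
      refine h1.congr' ?_
      filter_upwards [eventually_gt_atTop 0] with r hr
      simp only [Function.comp]
      rw [inv_pow, Real.sq_sqrt hr.le, div_inv_eq_mul, mul_comm]
    have h3 : Tendsto (fun r : ℝ => Complex.exp (-((r * descentHeight ((√r)⁻¹ * σ) : ℝ) : ℂ)))
        atTop (𝓝 (Complex.exp (-((σ ^ 2 : ℝ) : ℂ)))) :=
      ((Complex.continuous_exp.comp (Complex.continuous_ofReal.neg)).tendsto _).comp h2
    have h4 := (h3.mul (hcont hexp)).mul (hcont continuous_descentSpeed)
    convert h4 using 2
    simp [descentPath, descentSpeed]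

/-! ### Behaviour of Sommerfeld's integral at zero -/

/-- The substitution `u = eᵗ` turns this into the Gamma integral of `u^(m-1) e^(-u/2)`. -/
lemma integral_exp_sub_half_exp {m : ℂ} (hm : 0 < m.re) :
    Integrable (fun t : ℝ => Complex.exp (m * t - (Real.exp t : ℂ) / 2)) ∧
      ∫ t : ℝ, Complex.exp (m * t - (Real.exp t : ℂ) / 2) = 2 ^ m * Complex.Gamma m := by
  have himg : Real.exp '' univ = Ioi 0 := by rw [image_univ, Real.range_exp]
  have hd : ∀ x ∈ (univ : Set ℝ), HasDerivWithinAt Real.exp (Real.exp x) univ x :=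
    fun x _ => (Real.hasDerivAt_exp x).hasDerivWithinAt
  have hinj : InjOn Real.exp univ := Real.exp_injective.injOn
  set g : ℝ → ℂ := fun t => (t : ℂ) ^ (m - 1) * Complex.exp (-((1 / 2 : ℝ) * t)) with hg
  have hcongr : ∀ t : ℝ, |Real.exp t| • g (Real.exp t) =
      Complex.exp (m * t - (Real.exp t : ℂ) / 2) := by
    intro t
    have h0 : (Real.exp t : ℂ) ≠ 0 := by exact_mod_cast (Real.exp_pos t).ne'
    rw [abs_of_pos (Real.exp_pos t), Complex.real_smul, hg]
    simp only
    rw [Complex.cpow_def_of_ne_zero h0, ← Complex.ofReal_log (Real.exp_pos t).le, Real.log_exp,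
      Complex.ofReal_exp, ← Complex.exp_add, ← Complex.exp_add]
    congr 1
    push_cast
    ring
  have hval : ∫ t in Ioi 0, g t = 2 ^ m * Complex.Gamma m := by
    rw [hg, Complex.integral_cpow_mul_exp_neg_mul_Ioi hm (by norm_num)]
    norm_num
  have hint : IntegrableOn g (Ioi 0) := by
    -- A function that is not integrable has integral `0` by convention, whereas the value `2 ^ m
    -- Γ(m)` is nonzero.
    by_contra h
    have h1 := integral_undef h
    rw [hval] at h1
    have h2 : (2 : ℂ) ^ m ≠ 0 := by simp [Complex.cpow_eq_zero_iff]
    exact mul_ne_zero h2 (Complex.Gamma_ne_zero_of_re_pos hm) h1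
  constructor
  · rw [← himg, integrableOn_image_iff_integrableOn_abs_deriv_smul MeasurableSet.univ hd hinj,
      integrableOn_univ] at hint
    exact hint.congr (Eventually.of_forall hcongr)
  · rw [← hval, ← himg, integral_image_eq_integral_abs_deriv_smul MeasurableSet.univ hd hinj,
      Measure.restrict_univ]
    exact (integral_congr_ae (Eventually.of_forall hcongr)).symm

lemma tendsto_cosh_atTop : Tendsto Real.cosh atTop atTop := by
  refine tendsto_atTop_mono (f := fun s : ℝ => s) (fun s => ?_) tendsto_id
  have := one_add_half_sq_le_cosh s
  nlinarith [sq_nonneg (s - 1)]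

lemma tendsto_sinh_atTop : Tendsto Real.sinh atTop atTop := by
  refine tendsto_atTop_mono' atTop (f₁ := fun s : ℝ => s) ?_ tendsto_id
  filter_upwards [eventually_ge_atTop 0] with s hs using Real.self_le_sinh_iff.2 hs

lemma exp_mul_cosh_sub (y t : ℝ) :
    Real.exp y * Real.cosh (t - y) = (Real.exp t + Real.exp (2 * y - t)) / 2 := by
  rw [Real.cosh_eq, mul_div_assoc', mul_add, ← Real.exp_add, ← Real.exp_add]
  ring_nf

lemma tendsto_exp_mul_descentHeight (t : ℝ) :
    Tendsto (fun y : ℝ => Real.exp y * descentHeight (t - y)) atBot (𝓝 (Real.exp t / 2)) := by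
  have hs : Tendsto (fun y : ℝ => t - y) atBot atTop :=
    tendsto_atTop_add_const_left _ t tendsto_neg_atBot_atTop
  have h1 : Tendsto (fun y : ℝ => 2 * y - t) atBot atBot :=
    tendsto_atBot_add_const_right _ (-t) (tendsto_id.const_mul_atBot (by norm_num))
  have h2 := (Real.tendsto_exp_atBot.comp h1).const_add (Real.exp t)
  have h3 := (tendsto_inv_atTop_zero.comp (tendsto_cosh_atTop.comp hs)).mul Real.tendsto_exp_atBot
  have h4 := (h2.div_const 2).sub h3
  simp only [add_zero, mul_zero, sub_zero] at h4
  refine h4.congr fun y => ?_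
  simp only [Function.comp, descentHeight, mul_sub, exp_mul_cosh_sub]
  ring

/-- By evenness the order is replaced by `-m`, and the path parameter is shifted to `t - y`: the
factor `e^{my}` then cancels and leaves `e^{mt}`. As `y → -∞` the path flattens to the height `π /
2`, which gives the phase, and `e^y` times the descent height tends to `eᵗ / 2`, which leaves a
Gamma integral. -/
lemma tendsto_sommerfeld_atBot {m : ℂ} (hm : 0 < m.re) :
    Tendsto (fun y : ℝ => Complex.exp (m * y) * sommerfeld m (Real.exp y)) atBot
      (𝓝 (Complex.exp (Complex.I * m * (Real.pi / 2)) * (2 ^ m * Complex.Gamma m))) := by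
  obtain ⟨hint, hval⟩ := integral_exp_sub_half_exp hm
  have key := tendsto_integral_filter_of_dominated_convergence (μ := volume) (l := atBot)
    (F := fun y t : ℝ => Complex.exp (m * y) *
      (descentExp (-m) (Real.exp y) (t - y) * descentSpeed (t - y)))
    (f := fun t : ℝ => Complex.exp (Complex.I * m * (Real.pi / 2)) *
      Complex.exp (m * t - (Real.exp t : ℂ) / 2))
    (fun t => Real.exp (1 + ‖m‖ * 2) * ‖Complex.exp (m * t - (Real.exp t : ℂ) / 2)‖ * 2)
    ?_ ?_ ((hint.norm.const_mul _).mul_const 2) ?_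
  · rw [integral_const_mul, hval] at key
    refine key.congr fun y => ?_
    rw [integral_const_mul, ← sommerfeld_neg m, sommerfeld,
      integral_sub_right_eq_self (fun s => descentExp (-m) (Real.exp y) s * descentSpeed s)]
  · refine Eventually.of_forall fun y => Continuous.aestronglyMeasurable ?_
    exact continuous_const.mul ((continuous_descentIntegrand _ _).comp (continuous_sub_right y))
  · filter_upwards [eventually_le_atBot 0] with y hy
    refine Eventually.of_forall fun t => ?_
    rw [← mul_assoc, norm_mul]
    refine mul_le_mul ?_ (norm_descentSpeed_le _) (norm_nonneg _) (by positivity)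
    rw [descentExp, ← Complex.exp_add, Complex.norm_exp, Complex.norm_exp, ← Real.exp_add]
    refine Real.exp_le_exp.2 ?_
    have e : m * y + (Complex.I * (Real.exp y : ℝ) * Complex.cosh (descentPath (t - y)) -
        -m * descentPath (t - y)) = m * t + (Complex.I * (Real.exp y : ℝ) -
          ((Real.exp y * descentHeight (t - y) : ℝ) : ℂ)) +
          m * (Complex.I * (Real.arctan (Real.sinh (t - y)) : ℝ)) := by
      rw [cosh_descentPath, descentPath]
      push_cast
      linear_combination (Complex.exp y * descentHeight (t - y)) * Complex.I_mul_I
    have e2 : (Complex.I * (Real.exp y : ℝ) -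
        ((Real.exp y * descentHeight (t - y) : ℝ) : ℂ)).re =
        -(Real.exp y * descentHeight (t - y)) := by
      rw [mul_comm Complex.I, Complex.sub_re, Complex.re_ofReal_mul, Complex.I_re,
        Complex.ofReal_re]; ring
    have e3 : (m * (Complex.I * (Real.arctan (Real.sinh (t - y)) : ℝ))).re ≤ ‖m‖ * 2 := by
      refine (Complex.re_le_norm _).trans ?_
      rw [norm_mul, norm_mul, Complex.norm_I, one_mul, Complex.norm_real, Real.norm_eq_abs]
      have h1 := Real.arctan_lt_pi_div_two (Real.sinh (t - y))
      have h2 := Real.neg_pi_div_two_lt_arctan (Real.sinh (t - y))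
      have h3 := Real.pi_lt_four
      have : |Real.arctan (Real.sinh (t - y))| ≤ 2 := by rw [abs_le]; constructor <;> linarith
      gcongr
    -- For `y ≤ 0` the subtracted part `e^y / cosh (t - y)` is at most `1`; this is the `1` in the
    -- dominating constant.
    have e4 : Real.exp t / 2 - 1 ≤ Real.exp y * descentHeight (t - y) := by
      have h1 := exp_mul_cosh_sub y t
      have h2 := inv_le_one_of_one_le₀ (Real.one_le_cosh (t - y))
      have h3 : Real.exp y ≤ 1 := Real.exp_le_one_iff.2 hy
      have h4 := Real.exp_pos (2 * y - t)
      have h5 : Real.exp y * (Real.cosh (t - y))⁻¹ ≤ 1 := by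
        have := mul_le_mul h3 h2 (inv_nonneg.2 (Real.cosh_pos _).le) zero_le_one
        linarith
      rw [descentHeight, mul_sub, h1]
      linarith
    have e5 : ((Real.exp t : ℂ) / 2).re = Real.exp t / 2 := by
      rw [show (Real.exp t : ℂ) / 2 = ((Real.exp t / 2 : ℝ) : ℂ) by push_cast; rfl,
        Complex.ofReal_re]
    rw [e, Complex.add_re, Complex.add_re, e2, Complex.sub_re, e5]
    linarith
  · refine Eventually.of_forall fun t => ?_
    have hs : Tendsto (fun y : ℝ => t - y) atBot atTop :=
      tendsto_atTop_add_const_left _ t tendsto_neg_atBot_atTop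
    have h1 : Tendsto (fun y : ℝ => descentSpeed (t - y)) atBot (𝓝 1) := by
      have h := ((Complex.continuous_ofReal.tendsto 0).comp
        (tendsto_inv_atTop_zero.comp (tendsto_cosh_atTop.comp hs))).const_mul Complex.I
      have h' := h.const_add 1
      simp only [Complex.ofReal_zero, mul_zero, add_zero] at h'
      exact h'
    have h2 : Tendsto (fun y : ℝ => ((Real.arctan (Real.sinh (t - y)) : ℝ) : ℂ)) atBot
        (𝓝 ((Real.pi / 2 : ℝ) : ℂ)) :=
      (Complex.continuous_ofReal.tendsto _).comp ((Real.tendsto_arctan_atTop.mono_right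
        nhdsWithin_le_nhds).comp (tendsto_sinh_atTop.comp hs))
    have h3 : Tendsto (fun y : ℝ => ((Real.exp y * descentHeight (t - y) : ℝ) : ℂ)) atBot
        (𝓝 ((Real.exp t / 2 : ℝ) : ℂ)) :=
      (Complex.continuous_ofReal.tendsto _).comp (tendsto_exp_mul_descentHeight t)
    have h4 : Tendsto (fun y : ℝ => ((Real.exp y : ℝ) : ℂ)) atBot (𝓝 ((0 : ℝ) : ℂ)) :=
      (Complex.continuous_ofReal.tendsto _).comp Real.tendsto_exp_atBot
    have h5 := ((((h4.const_mul Complex.I).sub h3).const_add (m * t)).add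
      ((h2.const_mul Complex.I).const_mul m)).cexp.mul h1
    convert h5.congr fun y => ?_ using 2
    · rw [← Complex.exp_add, mul_one]
      congr 1
      push_cast
      ring
    · rw [← mul_assoc (Complex.exp _), descentExp, ← Complex.exp_add]
      congr 2
      rw [cosh_descentPath, descentPath]
      push_cast
      linear_combination -(Complex.exp y * descentHeight (t - y)) * Complex.I_mul_I

/-! ### Solutions of the homogeneous equation and their Wronskians -/

/-- `u` solves `-u'' - ℓ² e^{2x} u = -m² u`. -/
def IsSolution (ℓ : ℝ) (m : ℂ) (u : ℝ → ℂ) : Prop :=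
  Differentiable ℝ u ∧
    ∀ x, HasDerivAt (deriv u) ((m ^ 2 - ((ℓ * Real.exp x : ℝ) : ℂ) ^ 2) * u x) x

lemma wronskian_eq {Φ u : ℝ → ℂ} {Φ' u' : ℂ} {x : ℝ} (hΦ : HasDerivAt Φ Φ' x)
    (hu : HasDerivAt u u' x) : wronskian Φ u x = Φ x * u' - Φ' * u x := by
  rw [wronskian, hΦ.deriv, hu.deriv]

lemma wronskian_swap (Φ u : ℝ → ℂ) (x : ℝ) : wronskian u Φ x = -wronskian Φ u x := by
  simp only [wronskian]; ring

lemma wronskian_lincomb_right (Φ : ℝ → ℂ) {u v : ℝ → ℂ} (a b : ℂ) {x : ℝ}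
    (hu : DifferentiableAt ℝ u x) (hv : DifferentiableAt ℝ v x) :
    wronskian Φ (fun x => a * u x + b * v x) x = a * wronskian Φ u x + b * wronskian Φ v x := by
  have h : deriv (fun x => a * u x + b * v x) x = a * deriv u x + b * deriv v x :=
    ((hu.hasDerivAt.const_mul a).add (hv.hasDerivAt.const_mul b)).deriv
  simp only [wronskian, h]; ring

lemma wronskian_lincomb_left (Φ : ℝ → ℂ) {u v : ℝ → ℂ} (a b : ℂ) {x : ℝ}
    (hu : DifferentiableAt ℝ u x) (hv : DifferentiableAt ℝ v x) :
    wronskian (fun x => a * u x + b * v x) Φ x = a * wronskian u Φ x + b * wronskian v Φ x := by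
  rw [← neg_inj, ← wronskian_swap, wronskian_lincomb_right Φ a b hu hv, wronskian_swap u,
    wronskian_swap v]
  ring

/-- Any three vectors `(u, u')` in the plane are linearly dependent. Once the Wronskians are known
numbers, one solution is thereby expressed through the two others. -/
lemma wronskian_plucker (u v w : ℝ → ℂ) (x : ℝ) :
    u x * wronskian v w x + v x * wronskian w u x + w x * wronskian u v x = 0 := by
  simp only [wronskian]; ring

lemma IsSolution.hasDerivAt {ℓ : ℝ} {m : ℂ} {u : ℝ → ℂ} (hu : IsSolution ℓ m u) (x : ℝ) :
    HasDerivAt u (deriv u x) x := (hu.1 x).hasDerivAt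

lemma IsSolution.wronskian_const {ℓ : ℝ} {m : ℂ} {u v : ℝ → ℂ} (hu : IsSolution ℓ m u)
    (hv : IsSolution ℓ m v) (x y : ℝ) : wronskian u v x = wronskian u v y := by
  have hd : ∀ x, HasDerivAt (wronskian u v) 0 x := fun x =>
    (((hu.hasDerivAt x).mul (hv.2 x)).sub ((hu.2 x).mul (hv.hasDerivAt x))).congr_deriv (by ring)
  exact is_const_of_deriv_eq_zero (fun x => (hd x).differentiableAt) (fun x => (hd x).deriv) x y

lemma IsSolution.wronskian_eq_of_tendsto {ℓ : ℝ} {m : ℂ} {u v : ℝ → ℂ} (hu : IsSolution ℓ m u)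
    (hv : IsSolution ℓ m v) {l : Filter ℝ} [l.NeBot] {c : ℂ}
    (h : Tendsto (wronskian u v) l (𝓝 c)) (x : ℝ) : wronskian u v x = c := by
  refine tendsto_nhds_unique (tendsto_const_nhds.congr fun y => ?_) h
  exact hu.wronskian_const hv x y

lemma IsSolution.lincomb {ℓ : ℝ} {m : ℂ} {u v : ℝ → ℂ} (hu : IsSolution ℓ m u)
    (hv : IsSolution ℓ m v) (a b : ℂ) : IsSolution ℓ m fun x => a * u x + b * v x := by
  have hd : ∀ x, HasDerivAt (fun x => a * u x + b * v x) (a * deriv u x + b * deriv v x) x :=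
    fun x => ((hu.hasDerivAt x).const_mul a).add ((hv.hasDerivAt x).const_mul b)
  refine ⟨fun x => (hd x).differentiableAt, fun x => ?_⟩
  rw [show deriv (fun x => a * u x + b * v x) = fun x => a * deriv u x + b * deriv v x from
    funext fun x => (hd x).deriv]
  exact (((hu.2 x).const_mul a).add ((hv.2 x).const_mul b)).congr_deriv (by ring)

/-- Raising and then lowering the order composes to the second-order equation, and `κ κ' = -1` fixes
the sign of the `r²` term. The pairs in use are `(-1, 1)` for `J`, `(i, i)` for `U` and `(-i, -i)`
for `V`. -/
lemma isSolution_of_ladder {ℓ : ℝ} {m κ κ' : ℂ} {u v : ℝ → ℂ} (hκ : κ * κ' = -1)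
    (hu : ∀ x, HasDerivAt u (m * u x + κ * (ℓ * Real.exp x : ℝ) * v x) x)
    (hv : ∀ x, HasDerivAt v (κ' * (ℓ * Real.exp x : ℝ) * u x - (m + 1) * v x) x) :
    IsSolution ℓ m u := by
  refine ⟨fun x => (hu x).differentiableAt, fun x => ?_⟩
  rw [show deriv u = fun x => m * u x + κ * (ℓ * Real.exp x : ℝ) * v x from
    funext fun x => (hu x).deriv]
  have hr := (hasDerivAt_mul_exp ℓ x).ofReal_comp
  refine (((hu x).const_mul m).add ((hr.const_mul κ).mul (hv x))).congr_deriv ?_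
  linear_combination ((ℓ * Real.exp x : ℝ) : ℂ) ^ 2 * u x * hκ

/-- The Bessel function in the logarithmic variable. -/
noncomputable def solJ (ℓ : ℝ) (m : ℂ) (x : ℝ) : ℂ := besselJ m (ℓ * Real.exp x)

/-- Sommerfeld's integral in the logarithmic variable, a multiple of `H⁺_m`. -/
noncomputable def solU (ℓ : ℝ) (m : ℂ) (x : ℝ) : ℂ := sommerfeld m (ℓ * Real.exp x)

/-- The conjugate of Sommerfeld's integral in the logarithmic variable, a multiple of `H⁻_m`. -/
noncomputable def solV (ℓ : ℝ) (m : ℂ) (x : ℝ) : ℂ :=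
  (starRingEnd ℂ) (solU ℓ ((starRingEnd ℂ) m) x)

lemma mul_exp_pos {ℓ : ℝ} (hℓ : 0 < ℓ) (x : ℝ) : 0 < ℓ * Real.exp x := mul_pos hℓ (Real.exp_pos x)

lemma hasDerivAt_solJ {ℓ : ℝ} (hℓ : 0 < ℓ) (m : ℂ) (x : ℝ) :
    HasDerivAt (solJ ℓ m) (m * solJ ℓ m x + (-1) * (ℓ * Real.exp x : ℝ) * solJ ℓ (m + 1) x) x :=
  (hasDerivAt_besselJ_exp hℓ m x).congr_deriv (by simp only [solJ]; ring)

lemma hasDerivAt_solJ_add_one {ℓ : ℝ} (hℓ : 0 < ℓ) (m : ℂ) (x : ℝ) :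
    HasDerivAt (solJ ℓ (m + 1)) (1 * (ℓ * Real.exp x : ℝ) * solJ ℓ m x -
      (m + 1) * solJ ℓ (m + 1) x) x := by
  refine (hasDerivAt_solJ hℓ (m + 1) x).congr_deriv ?_
  have h := besselJ_contiguous hℓ m x
  simp only [solJ]
  rw [show m + 1 + 1 = m + 2 by ring]
  linear_combination -h

lemma hasDerivAt_solU_half {ℓ : ℝ} (hℓ : 0 < ℓ) (m : ℂ) (x : ℝ) :
    HasDerivAt (solU ℓ m) (Complex.I / 2 * (ℓ * Real.exp x : ℝ) *
      (solU ℓ (m - 1) x + solU ℓ (m + 1) x)) x := by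
  have h := (hasDerivAt_sommerfeld m (mul_exp_pos hℓ x)).scomp x (hasDerivAt_mul_exp ℓ x)
  refine h.congr_deriv ?_
  simp only [solU, Complex.real_smul]
  ring

/-- The recurrence eliminates the order `m - 1` from the symmetric derivative formula and puts it in
ladder form. -/
lemma hasDerivAt_solU {ℓ : ℝ} (hℓ : 0 < ℓ) (m : ℂ) (x : ℝ) :
    HasDerivAt (solU ℓ m) (m * solU ℓ m x +
      Complex.I * (ℓ * Real.exp x : ℝ) * solU ℓ (m + 1) x) x := by
  refine (hasDerivAt_solU_half hℓ m x).congr_deriv ?_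
  have h := sommerfeld_contiguous m (mul_exp_pos hℓ x)
  simp only [solU]
  linear_combination h / 2

lemma hasDerivAt_solU_add_one {ℓ : ℝ} (hℓ : 0 < ℓ) (m : ℂ) (x : ℝ) :
    HasDerivAt (solU ℓ (m + 1)) (Complex.I * (ℓ * Real.exp x : ℝ) * solU ℓ m x -
      (m + 1) * solU ℓ (m + 1) x) x := by
  refine (hasDerivAt_solU_half hℓ (m + 1) x).congr_deriv ?_
  have h := sommerfeld_contiguous (m + 1) (mul_exp_pos hℓ x)
  rw [add_sub_cancel_right] at h
  simp only [solU, add_sub_cancel_right]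
  linear_combination -h / 2

lemma hasDerivAt_solV {ℓ : ℝ} (hℓ : 0 < ℓ) (m : ℂ) (x : ℝ) :
    HasDerivAt (solV ℓ m) (m * solV ℓ m x +
      (-Complex.I) * (ℓ * Real.exp x : ℝ) * solV ℓ (m + 1) x) x := by
  have h := (hasDerivAt_solU hℓ ((starRingEnd ℂ) m) x).star
  have e : (starRingEnd ℂ) (m + 1) = (starRingEnd ℂ) m + 1 := by simp
  unfold solV
  rw [e]
  refine h.congr_deriv ?_
  simp [-Complex.ofReal_mul]

lemma hasDerivAt_solV_add_one {ℓ : ℝ} (hℓ : 0 < ℓ) (m : ℂ) (x : ℝ) :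
    HasDerivAt (solV ℓ (m + 1)) ((-Complex.I) * (ℓ * Real.exp x : ℝ) * solV ℓ m x -
      (m + 1) * solV ℓ (m + 1) x) x := by
  have h := (hasDerivAt_solU_add_one hℓ ((starRingEnd ℂ) m) x).star
  have e : (starRingEnd ℂ) (m + 1) = (starRingEnd ℂ) m + 1 := by simp
  unfold solV
  rw [e]
  refine h.congr_deriv ?_
  simp [-Complex.ofReal_mul]

lemma isSolution_solJ {ℓ : ℝ} (hℓ : 0 < ℓ) (m : ℂ) : IsSolution ℓ m (solJ ℓ m) :=
  isSolution_of_ladder (by ring) (hasDerivAt_solJ hℓ m) (hasDerivAt_solJ_add_one hℓ m)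

lemma isSolution_solU {ℓ : ℝ} (hℓ : 0 < ℓ) (m : ℂ) : IsSolution ℓ m (solU ℓ m) :=
  isSolution_of_ladder (by simp) (hasDerivAt_solU hℓ m) (hasDerivAt_solU_add_one hℓ m)

lemma isSolution_solV {ℓ : ℝ} (hℓ : 0 < ℓ) (m : ℂ) : IsSolution ℓ m (solV ℓ m) :=
  isSolution_of_ladder (by simp) (hasDerivAt_solV hℓ m) (hasDerivAt_solV_add_one hℓ m)

lemma tendsto_solJ_atBot {ℓ : ℝ} (hℓ : 0 < ℓ) (m : ℂ) :
    Tendsto (fun x : ℝ => Complex.exp (-(m * x)) * solJ ℓ m x) atBot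
      (𝓝 (((ℓ / 2 : ℝ) : ℂ) ^ m * (Complex.Gamma (m + 1))⁻¹)) :=
  tendsto_besselJ_exp_atBot hℓ m

lemma tendsto_solU_atBot {ℓ : ℝ} (hℓ : 0 < ℓ) {m : ℂ} (hm : 0 < m.re) :
    Tendsto (fun x : ℝ => Complex.exp (m * x) * solU ℓ m x) atBot
      (𝓝 ((ℓ : ℂ) ^ (-m) *
        (Complex.exp (Complex.I * m * (Real.pi / 2)) * (2 ^ m * Complex.Gamma m)))) := by
  have h1 : Tendsto (fun x : ℝ => Real.log ℓ + x) atBot atBot :=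
    tendsto_atBot_add_const_left _ _ tendsto_id
  refine (((tendsto_sommerfeld_atBot hm).comp h1).const_mul ((ℓ : ℂ) ^ (-m))).congr fun x => ?_
  have h0 : (ℓ : ℂ) ≠ 0 := by exact_mod_cast hℓ.ne'
  simp only [Function.comp, solU, Real.exp_add, Real.exp_log hℓ]
  rw [← mul_assoc, Complex.cpow_def_of_ne_zero h0, ← Complex.exp_add, ← Complex.ofReal_log hℓ.le]
  congr 2
  push_cast
  ring

lemma tendsto_exp_ofReal_atBot (ℓ : ℝ) :
    Tendsto (fun x : ℝ => ((ℓ * Real.exp x : ℝ) : ℂ)) atBot (𝓝 0) := by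
  have h := Real.tendsto_exp_atBot.const_mul ℓ
  rw [mul_zero] at h
  exact (Complex.continuous_ofReal.tendsto' 0 0 Complex.ofReal_zero).comp h

/-! ### The Wronskian of Sommerfeld's integral and the Bessel function -/

lemma wronskian_solU_solJ_eq {ℓ : ℝ} (hℓ : 0 < ℓ) (m : ℂ) (x : ℝ) :
    wronskian (solU ℓ m) (solJ ℓ m) x =
    -((ℓ * Real.exp x : ℝ) : ℂ) *
      (solU ℓ m x * solJ ℓ (m + 1) x + Complex.I * (solU ℓ (m + 1) x * solJ ℓ m x)) := by
  rw [wronskian_eq (hasDerivAt_solU hℓ m x) (hasDerivAt_solJ hℓ m x)]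
  ring

/-- The factor `i` is the one that `e^{imπ/2}` gains under `m ↦ m + 1`; the value found for `Re m >
0` therefore descends to all orders. -/
lemma wronskian_solU_solJ_add_one {ℓ : ℝ} (hℓ : 0 < ℓ) (m : ℂ) (x : ℝ) :
    wronskian (solU ℓ (m + 1)) (solJ ℓ (m + 1)) x =
      Complex.I * wronskian (solU ℓ m) (solJ ℓ m) x := by
  rw [wronskian_solU_solJ_eq hℓ m,
    wronskian_eq (hasDerivAt_solU_add_one hℓ m x) (hasDerivAt_solJ_add_one hℓ m x)]
  linear_combination ((ℓ * Real.exp x : ℝ) : ℂ) * solU ℓ (m + 1) x * solJ ℓ m x * Complex.I_mul_I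

lemma exp_quarter_add_one (m : ℂ) : Complex.exp (Complex.I * (m + 1) * (Real.pi / 2)) =
    Complex.exp (Complex.I * m * (Real.pi / 2)) * Complex.I := by
  rw [show Complex.I * (m + 1) * (Real.pi / 2) =
    Complex.I * m * (Real.pi / 2) + Real.pi / 2 * Complex.I by ring, Complex.exp_add,
    Complex.exp_pi_div_two_mul_I]

/-- The constant is read off at `-∞`. There `r U_m J_{m+1}` is of size `e^{2x}` and disappears, and
in `r U_{m+1} J_m` the factors `Γ(m + 1)` cancel. -/
lemma wronskian_solU_solJ_of_re_pos {ℓ : ℝ} (hℓ : 0 < ℓ) {m : ℂ} (hm : 0 < m.re) (x : ℝ) :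
    wronskian (solU ℓ m) (solJ ℓ m) x = 2 * Complex.exp (Complex.I * m * (Real.pi / 2)) := by
  refine (isSolution_solU hℓ m).wronskian_eq_of_tendsto (isSolution_solJ hℓ m) (l := atBot) ?_ x
  have hm1 : 0 < (m + 1).re := by simp; linarith
  have hr := tendsto_exp_ofReal_atBot ℓ
  have h1 := ((tendsto_solU_atBot hℓ hm).mul (tendsto_solJ_atBot hℓ (m + 1))).mul (hr.mul hr)
  have h2 := (((tendsto_solU_atBot hℓ hm1).mul (tendsto_solJ_atBot hℓ m)).mul_const (ℓ : ℂ))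
  have h3 := ((h1.div_const (ℓ : ℂ)).add (h2.const_mul Complex.I)).neg
  have hℓ0 : (ℓ : ℂ) ≠ 0 := by exact_mod_cast hℓ.ne'
  convert h3.congr fun y => ?_ using 2
  · have hg : Complex.Gamma (m + 1) ≠ 0 := Complex.Gamma_ne_zero_of_re_pos hm1
    have h20 : (2 : ℂ) ≠ 0 := two_ne_zero
    have e2 : ((ℓ / 2 : ℝ) : ℂ) ^ m = (ℓ : ℂ) ^ m / 2 ^ m := by
      rw [Complex.ofReal_div, Complex.div_cpow_ofReal_nonneg hℓ.le (by norm_num)]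
      norm_num
    have e4 : (ℓ : ℂ) ^ m ≠ 0 := by simp [Complex.cpow_eq_zero_iff, hℓ0]
    have e5 : (2 : ℂ) ^ m ≠ 0 := by simp [Complex.cpow_eq_zero_iff]
    rw [e2, exp_quarter_add_one, Complex.cpow_neg _ (m + 1), Complex.cpow_add _ _ hℓ0,
      Complex.cpow_add m 1 h20, Complex.cpow_one, Complex.cpow_one]
    field_simp
    linear_combination 2 * (ℓ : ℂ) * Complex.I_sq
  · rw [wronskian_solU_solJ_eq hℓ]
    have e1 : Complex.exp ((m + 1) * y) = Complex.exp (m * y) * Real.exp y := by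
      rw [Complex.ofReal_exp, ← Complex.exp_add]; congr 1; ring
    have e0 : (Real.exp y : ℂ) ≠ 0 := by exact_mod_cast (Real.exp_pos y).ne'
    have e2 := Complex.exp_ne_zero (m * y)
    rw [Complex.exp_neg, Complex.exp_neg, e1, Complex.ofReal_mul]
    field_simp

lemma wronskian_solU_solJ {ℓ : ℝ} (hℓ : 0 < ℓ) (m : ℂ) (x : ℝ) :
    wronskian (solU ℓ m) (solJ ℓ m) x = 2 * Complex.exp (Complex.I * m * (Real.pi / 2)) := by
  have key : ∀ (n : ℕ) (m : ℂ), 0 < (m + n).re →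
      wronskian (solU ℓ m) (solJ ℓ m) x = 2 * Complex.exp (Complex.I * m * (Real.pi / 2)) := by
    intro n
    induction n with
    | zero => intro m hm; exact wronskian_solU_solJ_of_re_pos hℓ (by simpa using hm) x
    | succ n ih =>
      intro m hm
      have h := ih (m + 1) (by
        rw [show m + 1 + (n : ℂ) = m + ((n + 1 : ℕ) : ℂ) by push_cast; ring]; exact hm)
      rw [wronskian_solU_solJ_add_one hℓ, exp_quarter_add_one] at h
      have hI := Complex.I_ne_zero
      refine mul_left_cancel₀ hI ?_
      rw [h]; ring
  obtain ⟨n, hn⟩ := exists_nat_gt (-m.re)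
  exact key n m (by simp; linarith)

/-! ### Behaviour at infinity -/

lemma wronskian_conj (u v : ℝ → ℂ) (x : ℝ) :
    wronskian (fun x => (starRingEnd ℂ) (u x)) (fun x => (starRingEnd ℂ) (v x)) x =
      (starRingEnd ℂ) (wronskian u v x) := by
  have h : ∀ f : ℝ → ℂ, deriv (fun x => (starRingEnd ℂ) (f x)) x = (starRingEnd ℂ) (deriv f x) :=
    fun _ => deriv.star
  simp only [wronskian, h, map_sub, map_mul]

lemma hyp0F1Reg_conj (c w : ℂ) :
    hyp0F1Reg ((starRingEnd ℂ) c) ((starRingEnd ℂ) w) = (starRingEnd ℂ) (hyp0F1Reg c w) := by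
  rw [hyp0F1Reg, hyp0F1Reg, Complex.conj_tsum]
  refine tsum_congr fun n => ?_
  have h : (starRingEnd ℂ) c + n = (starRingEnd ℂ) (c + n) := by simp
  rw [h, Complex.Gamma_conj]
  simp

lemma solJ_conj {ℓ : ℝ} (hℓ : 0 < ℓ) (m : ℂ) (x : ℝ) :
    solJ ℓ ((starRingEnd ℂ) m) x = (starRingEnd ℂ) (solJ ℓ m x) := by
  have h0 : (0 : ℝ) ≤ ℓ * Real.exp x / 2 := by positivity
  have harg : ((ℓ * Real.exp x / 2 : ℝ) : ℂ).arg ≠ Real.pi := by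
    rw [Complex.arg_ofReal_of_nonneg h0]; exact Real.pi_pos.ne
  have h1 := Complex.cpow_conj ((ℓ * Real.exp x / 2 : ℝ) : ℂ) m harg
  rw [Complex.conj_ofReal] at h1
  have h2 : -(((ℓ * Real.exp x : ℝ) : ℂ) ^ 2 / 4) =
      (starRingEnd ℂ) (-(((ℓ * Real.exp x : ℝ) : ℂ) ^ 2 / 4)) := by
    rw [map_neg, map_div₀, map_pow, Complex.conj_ofReal, map_ofNat]
  have h3 := hyp0F1Reg_conj (m + 1) (-(((ℓ * Real.exp x : ℝ) : ℂ) ^ 2 / 4))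
  rw [← h2, map_add, map_one] at h3
  rw [solJ, solJ, besselJ, besselJ, map_mul, h1, h3]

lemma wronskian_solV_solJ {ℓ : ℝ} (hℓ : 0 < ℓ) (m : ℂ) (x : ℝ) :
    wronskian (solV ℓ m) (solJ ℓ m) x = 2 * Complex.exp (-(Complex.I * m * (Real.pi / 2))) := by
  have h1 : solJ ℓ m = fun x => (starRingEnd ℂ) (solJ ℓ ((starRingEnd ℂ) m) x) := by
    funext x; rw [solJ_conj hℓ, Complex.conj_conj]
  have h2 : solV ℓ m = fun x => (starRingEnd ℂ) (solU ℓ ((starRingEnd ℂ) m) x) := rfl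
  rw [h1, h2, wronskian_conj, wronskian_solU_solJ hℓ, map_mul, ← Complex.exp_conj]
  simp [map_ofNat]

lemma tendsto_ofReal_mul_exp_atTop {ℓ : ℝ} (hℓ : 0 < ℓ) :
    Tendsto (fun x : ℝ => ℓ * Real.exp x) atTop atTop :=
  Real.tendsto_exp_atTop.const_mul_atTop hℓ

lemma tendsto_solU_atTop {ℓ : ℝ} (hℓ : 0 < ℓ) (m : ℂ) :
    Tendsto (fun x : ℝ => (√(ℓ * Real.exp x) : ℂ) *
      Complex.exp (-(Complex.I * (ℓ * Real.exp x : ℝ))) * solU ℓ m x) atTop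
      (𝓝 ((1 + Complex.I) * (√Real.pi : ℝ))) :=
  (tendsto_sommerfeld_atTop m).comp (tendsto_ofReal_mul_exp_atTop hℓ)

lemma tendsto_solV_atTop {ℓ : ℝ} (hℓ : 0 < ℓ) (m : ℂ) :
    Tendsto (fun x : ℝ => (√(ℓ * Real.exp x) : ℂ) *
      Complex.exp (Complex.I * (ℓ * Real.exp x : ℝ)) * solV ℓ m x) atTop
      (𝓝 ((1 - Complex.I) * (√Real.pi : ℝ))) := by
  have h := (Complex.continuous_conj.tendsto _).comp
    (tendsto_solU_atTop hℓ ((starRingEnd ℂ) m))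
  convert h using 2
  · simp only [Function.comp, map_mul, ← Complex.exp_conj, map_neg, Complex.conj_I,
      Complex.conj_ofReal, solV, neg_mul, neg_neg]
  · simp [sub_eq_add_neg]

lemma tendsto_inv_mul_exp_atTop {ℓ : ℝ} (hℓ : 0 < ℓ) :
    Tendsto (fun x : ℝ => (((ℓ * Real.exp x)⁻¹ : ℝ) : ℂ)) atTop (𝓝 0) :=
  (Complex.continuous_ofReal.tendsto' 0 0 Complex.ofReal_zero).comp
    (tendsto_inv_atTop_zero.comp (tendsto_ofReal_mul_exp_atTop hℓ))

lemma ofReal_sqrt_mul_self {r : ℝ} (hr : 0 < r) : (√r : ℂ) * (√r : ℂ) = r := by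
  exact_mod_cast Real.mul_self_sqrt hr.le

/-- The two orders may differ because the boundary function has order `1/2` and the solutions have
order `m`. By the ladder relations the orders enter only through `(μ - m) U V`, which is of size `1
/ r`. -/
lemma tendsto_wronskian_solU_solV {ℓ : ℝ} (hℓ : 0 < ℓ) (m μ : ℂ) :
    Tendsto (wronskian (solU ℓ m) (solV ℓ μ)) atTop (𝓝 (-4 * Real.pi * Complex.I)) := by
  have a0 := tendsto_solU_atTop hℓ m
  have a1 := tendsto_solU_atTop hℓ (m + 1)
  have b0 := tendsto_solV_atTop hℓ μ
  have b1 := tendsto_solV_atTop hℓ (μ + 1)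
  have h := (((tendsto_inv_mul_exp_atTop hℓ).mul (a0.mul b0)).const_mul (μ - m)).sub
    (((a0.mul b1).add (a1.mul b0)).const_mul Complex.I)
  convert h.congr fun x => ?_ using 2
  · have hp : ((√Real.pi : ℝ) : ℂ) * ((√Real.pi : ℝ) : ℂ) = Real.pi :=
      ofReal_sqrt_mul_self Real.pi_pos
    linear_combination (2 * Complex.I * (1 - Complex.I ^ 2)) * hp -
      2 * Real.pi * Complex.I * Complex.I_sq
  · have hr := mul_exp_pos hℓ x
    have hr0 : ((ℓ * Real.exp x : ℝ) : ℂ) ≠ 0 := by exact_mod_cast hr.ne'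
    have hs := ofReal_sqrt_mul_self hr
    have he := Complex.exp_ne_zero (Complex.I * (ℓ * Real.exp x : ℝ))
    rw [wronskian_eq (hasDerivAt_solU hℓ m x) (hasDerivAt_solV hℓ μ x), Complex.exp_neg,
      Complex.ofReal_inv]
    generalize ((ℓ * Real.exp x : ℝ) : ℂ) = r at *
    generalize ((√(ℓ * Real.exp x) : ℝ) : ℂ) = t at *
    generalize Complex.exp (Complex.I * r) = e at *
    have ht : t ≠ 0 := fun h => hr0 (by rw [← hs, h, zero_mul])
    subst hs
    field_simp
    ring

lemma tendsto_wronskian_solU_solU {ℓ : ℝ} (hℓ : 0 < ℓ) (m μ : ℂ) :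
    Tendsto (wronskian (solU ℓ m) (solU ℓ μ)) atTop (𝓝 0) := by
  have a0 := tendsto_solU_atTop hℓ m
  have a1 := tendsto_solU_atTop hℓ (m + 1)
  have b0 := tendsto_solU_atTop hℓ μ
  have b1 := tendsto_solU_atTop hℓ (μ + 1)
  have h := (((tendsto_inv_mul_exp_atTop hℓ).mul (a0.mul b0)).const_mul (μ - m)).add
    (((a0.mul b1).sub (a1.mul b0)).const_mul Complex.I)
  simp only [zero_mul, mul_zero, sub_self, add_zero] at h
  -- Each known limit carries a factor `e^{-ir}` that the Wronskian lacks. It is unimodular, so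
  -- passing to norms removes the discrepancy.
  rw [tendsto_zero_iff_norm_tendsto_zero] at h ⊢
  refine h.congr fun x => ?_
  have hr := mul_exp_pos hℓ x
  have hr0 : ((ℓ * Real.exp x : ℝ) : ℂ) ≠ 0 := by exact_mod_cast hr.ne'
  have hs := ofReal_sqrt_mul_self hr
  have hn : ‖Complex.exp (Complex.I * (ℓ * Real.exp x : ℝ))‖ = 1 := by
    rw [mul_comm]; exact Complex.norm_exp_ofReal_mul_I _
  have he := Complex.exp_ne_zero (Complex.I * (ℓ * Real.exp x : ℝ))
  have hw : ‖wronskian (solU ℓ m) (solU ℓ μ) x‖ =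
      ‖(Complex.exp (Complex.I * (ℓ * Real.exp x : ℝ)))⁻¹ ^ 2 *
        wronskian (solU ℓ m) (solU ℓ μ) x‖ := by
    rw [norm_mul, norm_pow, norm_inv, hn]; simp
  rw [hw, wronskian_eq (hasDerivAt_solU hℓ m x) (hasDerivAt_solU hℓ μ x), Complex.exp_neg,
    Complex.ofReal_inv]
  congr 1
  generalize ((ℓ * Real.exp x : ℝ) : ℂ) = r at *
  generalize ((√(ℓ * Real.exp x) : ℝ) : ℂ) = t at *
  generalize Complex.exp (Complex.I * r) = e at *
  have ht : t ≠ 0 := fun h => hr0 (by rw [← hs, h, zero_mul])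
  subst hs
  field_simp
  ring

lemma tendsto_wronskian_solV_solV {ℓ : ℝ} (hℓ : 0 < ℓ) (m μ : ℂ) :
    Tendsto (wronskian (solV ℓ m) (solV ℓ μ)) atTop (𝓝 0) := by
  have h := (Complex.continuous_conj.tendsto' 0 0 (map_zero _)).comp
    (tendsto_wronskian_solU_solU hℓ ((starRingEnd ℂ) m) ((starRingEnd ℂ) μ))
  refine h.congr fun x => ?_
  exact (wronskian_conj _ _ x).symm

lemma tendsto_wronskian_solV_solU {ℓ : ℝ} (hℓ : 0 < ℓ) (m μ : ℂ) :
    Tendsto (wronskian (solV ℓ m) (solU ℓ μ)) atTop (𝓝 (4 * Real.pi * Complex.I)) := by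
  have h := (tendsto_wronskian_solU_solV hℓ μ m).neg
  convert h.congr fun x => (wronskian_swap _ _ x).symm using 2
  ring

lemma wronskian_solU_solV {ℓ : ℝ} (hℓ : 0 < ℓ) (m : ℂ) (x : ℝ) :
    wronskian (solU ℓ m) (solV ℓ m) x = -4 * Real.pi * Complex.I :=
  (isSolution_solU hℓ m).wronskian_eq_of_tendsto (isSolution_solV hℓ m)
    (tendsto_wronskian_solU_solV hℓ m m) x

/-! ### The Hankel functions -/

/-- Plücker's identity for `J`, `U`, `V` with the three computed Wronskians. -/
lemma solJ_eq {ℓ : ℝ} (hℓ : 0 < ℓ) (m : ℂ) (x : ℝ) :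
    solJ ℓ m x = (2 * Real.pi * Complex.I)⁻¹ *
      (Complex.exp (-(Complex.I * m * (Real.pi / 2))) * solU ℓ m x -
        Complex.exp (Complex.I * m * (Real.pi / 2)) * solV ℓ m x) := by
  have h := wronskian_plucker (solJ ℓ m) (solU ℓ m) (solV ℓ m) x
  rw [wronskian_solU_solV hℓ, wronskian_solV_solJ hℓ, wronskian_swap (solU ℓ m),
    wronskian_solU_solJ hℓ] at h
  have hp : (Real.pi : ℂ) ≠ 0 := by exact_mod_cast Real.pi_ne_zero
  have hI := Complex.I_ne_zero
  generalize Complex.exp (-(Complex.I * m * (Real.pi / 2))) = e at *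
  generalize Complex.exp (Complex.I * m * (Real.pi / 2)) = e' at *
  field_simp
  linear_combination -h / 2

/-- The Hankel function `H⁺_m(ℓ eˣ)`. -/
noncomputable def solHPlus (ℓ : ℝ) (m : ℂ) (x : ℝ) : ℂ :=
  Complex.exp (-(Complex.I * m * (Real.pi / 2))) / (Real.pi * Complex.I) * solU ℓ m x

/-- The Hankel function `H⁻_m(ℓ eˣ)`. -/
noncomputable def solHMinus (ℓ : ℝ) (m : ℂ) (x : ℝ) : ℂ :=
  -(Complex.exp (Complex.I * m * (Real.pi / 2)) / (Real.pi * Complex.I)) * solV ℓ m x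

lemma solU_neg (ℓ : ℝ) (m : ℂ) (x : ℝ) : solU ℓ (-m) x = solU ℓ m x := sommerfeld_neg _ _

lemma solV_neg (ℓ : ℝ) (m : ℂ) (x : ℝ) : solV ℓ (-m) x = solV ℓ m x := by
  rw [solV, solV, map_neg, solU_neg]

lemma sin_pi_mul_ne_zero_of_not_int {m : ℂ} (hm : ¬∃ n : ℤ, m = n) :
    Complex.sin (Real.pi * m) ≠ 0 := by
  intro h
  obtain ⟨n, hn⟩ := Complex.sin_eq_zero_iff.1 h
  refine hm ⟨n, ?_⟩
  have hp : (Real.pi : ℂ) ≠ 0 := by exact_mod_cast Real.pi_ne_zero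
  exact mul_left_cancel₀ hp (by linear_combination hn)

/-- `U` and `V` are even in the order, so expanding `J_m` and `J_{-m}` leaves a linear combination
of the same two functions; the chosen quotient cancels `V`. -/
lemma hankelPlusQuot_exp {ℓ : ℝ} (hℓ : 0 < ℓ) {m : ℂ} (hm : ¬∃ n : ℤ, m = n) (x : ℝ) :
    hankelPlusQuot m (ℓ * Real.exp x) = solHPlus ℓ m x := by
  have hs := sin_pi_mul_ne_zero_of_not_int hm
  have h1 := solJ_eq hℓ m x
  have h2 := solJ_eq hℓ (-m) x
  have hp : (Real.pi : ℂ) ≠ 0 := by exact_mod_cast Real.pi_ne_zero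
  have hI := Complex.I_ne_zero
  have he := Complex.exp_ne_zero (Complex.I * m * (Real.pi / 2))
  rw [solU_neg, solV_neg] at h2
  unfold solJ at h1 h2
  rw [hankelPlusQuot, h1, h2, solHPlus, div_eq_iff (mul_ne_zero hI hs), Complex.sin]
  rw [show -(Complex.I * -m * (Real.pi / 2)) = Complex.I * m * (Real.pi / 2) by ring,
    show Complex.I * -m * (Real.pi / 2) = -(Complex.I * m * (Real.pi / 2)) by ring,
    show -(Complex.I * Real.pi * m) = -(Complex.I * m * (Real.pi / 2)) +
      -(Complex.I * m * (Real.pi / 2)) by ring,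
    show -(Real.pi * m) * Complex.I = -(Complex.I * m * (Real.pi / 2)) +
      -(Complex.I * m * (Real.pi / 2)) by ring,
    show Real.pi * m * Complex.I = Complex.I * m * (Real.pi / 2) +
      Complex.I * m * (Real.pi / 2) by ring, Complex.exp_add, Complex.exp_add, Complex.exp_neg]
  generalize Complex.exp (Complex.I * m * (Real.pi / 2)) = e at *
  field_simp
  linear_combination (solU ℓ m x) * (e ^ 4 - 1) * Complex.I_sq

lemma hankelMinusQuot_exp {ℓ : ℝ} (hℓ : 0 < ℓ) {m : ℂ} (hm : ¬∃ n : ℤ, m = n) (x : ℝ) :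
    hankelMinusQuot m (ℓ * Real.exp x) = solHMinus ℓ m x := by
  have hs := sin_pi_mul_ne_zero_of_not_int hm
  have h1 := solJ_eq hℓ m x
  have h2 := solJ_eq hℓ (-m) x
  have hp : (Real.pi : ℂ) ≠ 0 := by exact_mod_cast Real.pi_ne_zero
  have hI := Complex.I_ne_zero
  have he := Complex.exp_ne_zero (Complex.I * m * (Real.pi / 2))
  rw [solU_neg, solV_neg] at h2
  unfold solJ at h1 h2
  rw [hankelMinusQuot, h1, h2, solHMinus, div_eq_iff (neg_ne_zero.2 (mul_ne_zero hI hs)),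
    Complex.sin]
  rw [show -(Complex.I * -m * (Real.pi / 2)) = Complex.I * m * (Real.pi / 2) by ring,
    show Complex.I * -m * (Real.pi / 2) = -(Complex.I * m * (Real.pi / 2)) by ring,
    show Complex.I * Real.pi * m = Complex.I * m * (Real.pi / 2) +
      Complex.I * m * (Real.pi / 2) by ring,
    show -(Real.pi * m) * Complex.I = -(Complex.I * m * (Real.pi / 2)) +
      -(Complex.I * m * (Real.pi / 2)) by ring,
    show Real.pi * m * Complex.I = Complex.I * m * (Real.pi / 2) +
      Complex.I * m * (Real.pi / 2) by ring, Complex.exp_add, Complex.exp_add, Complex.exp_neg]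
  generalize Complex.exp (Complex.I * m * (Real.pi / 2)) = e at *
  field_simp
  linear_combination (solV ℓ m x) * (e ^ 4 - 1) * Complex.I_sq

lemma eventually_not_int (n : ℤ) : ∀ᶠ μ : ℂ in 𝓝[≠] (n : ℂ), ¬∃ k : ℤ, μ = k := by
  rw [eventually_nhdsWithin_iff]
  filter_upwards [Metric.ball_mem_nhds (n : ℂ) one_pos] with μ hμ hne
  rintro ⟨k, rfl⟩
  refine hne ?_
  rw [Metric.mem_ball, dist_eq_norm, ← Int.cast_sub, Complex.norm_intCast] at hμ
  have h1 : |k - n| < 1 := by exact_mod_cast hμ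
  have h2 : k = n := by rw [Int.abs_lt_one_iff] at h1; omega
  rw [h2]; rfl

lemma continuous_solU_order {ℓ : ℝ} (hℓ : 0 < ℓ) (x : ℝ) : Continuous fun m => solU ℓ m x :=
  continuous_sommerfeld_order (mul_exp_pos hℓ x)

lemma hankelPlus_exp {ℓ : ℝ} (hℓ : 0 < ℓ) (m : ℂ) (x : ℝ) :
    hankelPlus m (ℓ * Real.exp x) = solHPlus ℓ m x := by
  rw [hankelPlus]
  split_ifs with h
  · obtain ⟨n, rfl⟩ := h
    have hc : Continuous fun μ => solHPlus ℓ μ x := by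
      have := continuous_solU_order hℓ x
      unfold solHPlus
      fun_prop
    refine Tendsto.limUnder_eq ((hc.tendsto _).mono_left nhdsWithin_le_nhds |>.congr' ?_)
    filter_upwards [eventually_not_int n] with μ hμ
    exact (hankelPlusQuot_exp hℓ hμ x).symm
  · exact hankelPlusQuot_exp hℓ h x

lemma hankelMinus_exp {ℓ : ℝ} (hℓ : 0 < ℓ) (m : ℂ) (x : ℝ) :
    hankelMinus m (ℓ * Real.exp x) = solHMinus ℓ m x := by
  rw [hankelMinus]
  split_ifs with h
  · obtain ⟨n, rfl⟩ := h
    have hc : Continuous fun μ => solHMinus ℓ μ x := by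
      have := (Complex.continuous_conj.comp
        ((continuous_solU_order hℓ x).comp Complex.continuous_conj))
      exact (by fun_prop : Continuous fun μ : ℂ =>
        -(Complex.exp (Complex.I * μ * (Real.pi / 2)) / (Real.pi * Complex.I))).mul this
    refine Tendsto.limUnder_eq ((hc.tendsto _).mono_left nhdsWithin_le_nhds |>.congr' ?_)
    filter_upwards [eventually_not_int n] with μ hμ
    exact (hankelMinusQuot_exp hℓ hμ x).symm
  · exact hankelMinusQuot_exp hℓ h x

/-! ### The functions of the boundary condition and of the resolvent kernel -/

lemma exp_quarter_half :
    Complex.exp (Complex.I * (1 / 2) * (Real.pi / 2)) = Complex.exp (Complex.I * Real.pi / 4) := by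
  congr 1; ring

lemma bcFun_eq {ℓ : ℝ} (hℓ : 0 < ℓ) (γ : ℂ) : bcFun ℓ γ = fun x =>
    (Complex.exp (-(Complex.I * Real.pi / 4)) / (Real.pi * Complex.I)) * solU ℓ (1 / 2) x +
      (γ * Complex.exp (Complex.I * Real.pi / 4) / Real.pi) * solV ℓ (1 / 2) x := by
  funext x
  have hp : (Real.pi : ℂ) ≠ 0 := by exact_mod_cast Real.pi_ne_zero
  have hI := Complex.I_ne_zero
  rw [bcFun, hankelPlus_exp hℓ, hankelMinus_exp hℓ, solHPlus, solHMinus, Complex.exp_neg,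
    exp_quarter_half, Complex.exp_neg]
  generalize Complex.exp (Complex.I * Real.pi / 4) = e
  field_simp
  ring

/-- Both terms leave the same factor, so the combination is a multiple of `U_m - γ V_m`. The ratio
of amplitudes is independent of `m`, which is why one boundary condition admits the combination for
every order. -/
lemma hankelCombination_eq {ℓ : ℝ} (hℓ : 0 < ℓ) (γ m : ℂ) : hankelCombination ℓ γ m = fun x =>
    (Complex.exp (Complex.I * m * (Real.pi / 2)) / (Real.pi * Complex.I)) * solU ℓ m x +
      (-(γ * Complex.exp (Complex.I * m * (Real.pi / 2)) / (Real.pi * Complex.I))) *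
        solV ℓ m x := by
  funext x
  have he := Complex.exp_ne_zero (Complex.I * m * (Real.pi / 2))
  rw [hankelCombination, hankelPlus_exp hℓ, hankelMinus_exp hℓ, solHPlus, solHMinus,
    Complex.exp_neg, show Complex.I * m * Real.pi = Complex.I * m * (Real.pi / 2) +
      Complex.I * m * (Real.pi / 2) by ring, Complex.exp_add]
  field_simp

lemma isSolution_hankelCombination {ℓ : ℝ} (hℓ : 0 < ℓ) (γ m : ℂ) :
    IsSolution ℓ m (hankelCombination ℓ γ m) := by
  rw [hankelCombination_eq hℓ]
  exact (isSolution_solU hℓ m).lincomb (isSolution_solV hℓ m) _ _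

/-- The boundary functional depends only on the amplitudes `a` and `b` of the two waves, not on the
order. -/
lemma tendsto_wronskian_bcFun_lincomb {ℓ : ℝ} (hℓ : 0 < ℓ) (γ m a b : ℂ) :
    Tendsto (wronskian (bcFun ℓ γ) fun x => a * solU ℓ m x + b * solV ℓ m x) atTop
      (𝓝 (4 * Complex.I * γ * Complex.exp (Complex.I * Real.pi / 4) * a -
        4 * Complex.exp (-(Complex.I * Real.pi / 4)) * b)) := by
  have dU := fun m => (isSolution_solU hℓ m).1
  have dV := fun m => (isSolution_solV hℓ m).1
  have h1 := (((tendsto_wronskian_solU_solU hℓ (1 / 2) m).const_mul a).add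
    ((tendsto_wronskian_solU_solV hℓ (1 / 2) m).const_mul b)).const_mul
    (Complex.exp (-(Complex.I * Real.pi / 4)) / (Real.pi * Complex.I))
  have h2 := (((tendsto_wronskian_solV_solU hℓ (1 / 2) m).const_mul a).add
    ((tendsto_wronskian_solV_solV hℓ (1 / 2) m).const_mul b)).const_mul
    (γ * Complex.exp (Complex.I * Real.pi / 4) / Real.pi)
  convert (h1.add h2).congr fun x => ?_ using 2
  · have hp : (Real.pi : ℂ) ≠ 0 := by exact_mod_cast Real.pi_ne_zero
    have hI := Complex.I_ne_zero
    field_simp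
    ring
  · rw [bcFun_eq hℓ, wronskian_lincomb_left _ _ _ (dU _ x) (dV _ x),
      wronskian_lincomb_right _ _ _ (dU _ x) (dV _ x),
      wronskian_lincomb_right _ _ _ (dU _ x) (dV _ x)]

lemma exp_eighth_sq :
    Complex.exp (Complex.I * Real.pi / 4) * Complex.exp (Complex.I * Real.pi / 4) =
    Complex.I := by
  rw [← Complex.exp_add, show Complex.I * Real.pi / 4 + Complex.I * Real.pi / 4 =
    Real.pi / 2 * Complex.I by ring, Complex.exp_pi_div_two_mul_I]

lemma tendsto_wronskian_bcFun_hankelCombination {ℓ : ℝ} (hℓ : 0 < ℓ) (γ m : ℂ) :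
    Tendsto (wronskian (bcFun ℓ γ) (hankelCombination ℓ γ m)) atTop (𝓝 0) := by
  rw [hankelCombination_eq hℓ]
  convert tendsto_wronskian_bcFun_lincomb hℓ γ m _ _ using 2
  have hp : (Real.pi : ℂ) ≠ 0 := by exact_mod_cast Real.pi_ne_zero
  have hI := Complex.I_ne_zero
  have he := Complex.exp_ne_zero (Complex.I * Real.pi / 4)
  have h8 := exp_eighth_sq
  rw [Complex.exp_neg]
  generalize Complex.exp (Complex.I * Real.pi / 4) = e at *
  generalize Complex.exp (Complex.I * m * (Real.pi / 2)) = e'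
  field_simp
  linear_combination (-4 * γ * e') * (Complex.I * h8 + Complex.I_sq)

/-- The last factor is the eigenvalue condition: the others never vanish. -/
lemma tendsto_wronskian_bcFun_solJ {ℓ : ℝ} (hℓ : 0 < ℓ) (γ m : ℂ) :
    Tendsto (wronskian (bcFun ℓ γ) (solJ ℓ m)) atTop
      (𝓝 (2 / Real.pi * Complex.exp (-(Complex.I * m * (Real.pi / 2))) *
        Complex.exp (Complex.I * Real.pi / 4) * (γ - Complex.exp (Complex.I * m * Real.pi)))) := by
  have h : solJ ℓ m = fun x => ((2 * Real.pi * Complex.I)⁻¹ *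
      Complex.exp (-(Complex.I * m * (Real.pi / 2)))) * solU ℓ m x +
      (-((2 * Real.pi * Complex.I)⁻¹ * Complex.exp (Complex.I * m * (Real.pi / 2)))) *
        solV ℓ m x := by
    funext x; rw [solJ_eq hℓ]; ring
  rw [h]
  convert tendsto_wronskian_bcFun_lincomb hℓ γ m _ _ using 2
  have hp : (Real.pi : ℂ) ≠ 0 := by exact_mod_cast Real.pi_ne_zero
  have hI := Complex.I_ne_zero
  have he := Complex.exp_ne_zero (Complex.I * Real.pi / 4)
  have he' := Complex.exp_ne_zero (Complex.I * m * (Real.pi / 2))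
  have h8 := exp_eighth_sq
  rw [Complex.exp_neg, Complex.exp_neg, show Complex.I * m * Real.pi =
    Complex.I * m * (Real.pi / 2) + Complex.I * m * (Real.pi / 2) by ring, Complex.exp_add]
  generalize Complex.exp (Complex.I * Real.pi / 4) = e at *
  generalize Complex.exp (Complex.I * m * (Real.pi / 2)) = e' at *
  field_simp
  linear_combination (-4 * e' ^ 2) * (Complex.I * h8 + Complex.I_sq)

/-- This value dictates the prefactor of the resolvent kernel, which is minus its inverse. -/
lemma wronskian_solJ_hankelCombination {ℓ : ℝ} (hℓ : 0 < ℓ) (γ m : ℂ) (x : ℝ) :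
    wronskian (solJ ℓ m) (hankelCombination ℓ γ m) x =
      2 * Complex.I / Real.pi * (Complex.exp (Complex.I * m * Real.pi) - γ) := by
  have dU := (isSolution_solU hℓ m).1 x
  have dV := (isSolution_solV hℓ m).1 x
  have hp : (Real.pi : ℂ) ≠ 0 := by exact_mod_cast Real.pi_ne_zero
  have hI := Complex.I_ne_zero
  have he := Complex.exp_ne_zero (Complex.I * m * (Real.pi / 2))
  rw [hankelCombination_eq hℓ, wronskian_lincomb_right _ _ _ dU dV, wronskian_swap (solU ℓ m),
    wronskian_swap (solV ℓ m), wronskian_solU_solJ hℓ, wronskian_solV_solJ hℓ, Complex.exp_neg,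
    show Complex.I * m * Real.pi =
    Complex.I * m * (Real.pi / 2) + Complex.I * m * (Real.pi / 2) by ring, Complex.exp_add]
  generalize Complex.exp (Complex.I * m * (Real.pi / 2)) = e at *
  field_simp
  linear_combination (-e ^ 2 + γ) * Complex.I_sq

/-! ### Locally absolutely continuous functions -/

lemma absolutelyContinuousOnInterval_of_dist_le {X Y : Type*} [PseudoMetricSpace X]
    [PseudoMetricSpace Y] {f : ℝ → X} {g : ℝ → Y} {a b : ℝ}
    (hg : AbsolutelyContinuousOnInterval g a b) (h : ∀ x ∈ uIcc a b, ∀ y ∈ uIcc a b,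
      dist (f x) (f y) ≤ dist (g x) (g y)) :
    AbsolutelyContinuousOnInterval f a b := by
  refine squeeze_zero' (Eventually.of_forall fun E => Finset.sum_nonneg fun _ _ => dist_nonneg)
    ?_ hg
  refine eventually_inf_principal.2 (Eventually.of_forall fun E hE => ?_)
  exact Finset.sum_le_sum fun i hi => h _ (hE.1 i hi).1 _ (hE.1 i hi).2

lemma absolutelyContinuousOnInterval_of_sub_eq_integral {F f : ℝ → ℂ}
    (hf : LocallyIntegrable f volume) (h : ∀ x y, F y - F x = ∫ t in x..y, f t) (a b : ℝ) :
    AbsolutelyContinuousOnInterval F a b := by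
  have hi : ∀ x y, IntervalIntegrable f volume x y := fun x y =>
    (hf.integrableOn_isCompact isCompact_uIcc).intervalIntegrable
  have hΦ := (hi a b).norm.absolutelyContinuousOnInterval_intervalIntegral (c := a) left_mem_uIcc
  refine absolutelyContinuousOnInterval_of_dist_le hΦ fun x _ y _ => ?_
  rw [dist_comm, dist_eq_norm, h x y, dist_comm, Real.dist_eq,
    intervalIntegral.integral_interval_sub_left (hi a y).norm (hi a x).norm]
  exact intervalIntegral.norm_integral_le_abs_integral_norm

lemma ae_hasDerivAt_of_sub_eq_integral {F f : ℝ → ℂ}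
    (hf : LocallyIntegrable f volume) (h : ∀ x y, F y - F x = ∫ t in x..y, f t) :
    ∀ᵐ x, HasDerivAt F (f x) x := by
  filter_upwards [_root_.LocallyIntegrable.ae_hasDerivAt_integral hf] with x hx
  have e : F = fun y => F 0 + ∫ t in (0 : ℝ)..y, f t := by
    funext y; rw [← h 0 y]; ring
  rw [e]
  exact (hx 0).const_add _

/-- `F` minus the primitive of `f` is absolutely continuous with derivative zero almost everywhere,
hence constant. -/
lemma sub_eq_integral_of_ac {F f : ℝ → ℂ} (hF : ∀ a b, AbsolutelyContinuousOnInterval F a b)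
    (hf : LocallyIntegrable f volume) (h : ∀ᵐ x, HasDerivAt F (f x) x) (x y : ℝ) :
    F y - F x = ∫ t in x..y, f t := by
  have hi : ∀ x y, IntervalIntegrable f volume x y := fun x y =>
    (hf.integrableOn_isCompact isCompact_uIcc).intervalIntegrable
  set Φ : ℝ → ℂ := fun z => ∫ t in x..z, f t
  have hΦ : ∀ u v, Φ v - Φ u = ∫ t in u..v, f t := fun u v =>
    intervalIntegral.integral_interval_sub_left (hi x v) (hi x u)
  have hac := (hF x y).sub (absolutelyContinuousOnInterval_of_sub_eq_integral hf hΦ x y)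
  have hd : ∀ᵐ z, z ∈ uIcc x y → HasDerivAt (F - Φ) 0 z := by
    filter_upwards [h, ae_hasDerivAt_of_sub_eq_integral hf hΦ] with z h1 h2 _
    exact (h1.sub h2).congr_deriv (sub_self _)
  obtain ⟨C, hC⟩ := hac.const_of_ae_hasDerivAt_zero hd
  have h1 := hC x left_mem_uIcc
  have h2 := hC y right_mem_uIcc
  rw [← h1] at h2
  simp only [Pi.sub_apply, Φ, intervalIntegral.integral_same, sub_zero] at h2
  rw [← h2]; ring

/-- Regularity gain: an almost everywhere derivative with a continuous version is a derivative
everywhere. It turns `L²` eigenfunctions into classical solutions. -/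
lemma hasDerivAt_of_ac {F f : ℝ → ℂ} (hF : ∀ a b, AbsolutelyContinuousOnInterval F a b)
    (hf : Continuous f) (h : ∀ᵐ x, HasDerivAt F (f x) x) (x : ℝ) : HasDerivAt F (f x) x := by
  have e : F = fun y => F 0 + ∫ t in (0 : ℝ)..y, f t := by
    funext y; rw [← sub_eq_integral_of_ac hF hf.locallyIntegrable h 0 y]; ring
  rw [e]
  exact (intervalIntegral.integral_hasDerivAt_right (hf.intervalIntegrable _ _)
    hf.stronglyMeasurable.stronglyMeasurableAtFilter hf.continuousAt).const_add _

lemma ac_of_hasDerivAt {F f : ℝ → ℂ} (hf : Continuous f) (h : ∀ x, HasDerivAt F (f x) x)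
    (a b : ℝ) : AbsolutelyContinuousOnInterval F a b :=
  absolutelyContinuousOnInterval_of_sub_eq_integral hf.locallyIntegrable (fun x y =>
    (intervalIntegral.integral_eq_sub_of_hasDerivAt (fun z _ => h z)
      (hf.intervalIntegrable x y)).symm) a b

/-! ### Solutions of the homogeneous and of the inhomogeneous equation -/

lemma ofReal_sq_mul_exp (ℓ x : ℝ) :
    ((ℓ ^ 2 * Real.exp (2 * x) : ℝ) : ℂ) = ((ℓ * Real.exp x : ℝ) : ℂ) ^ 2 := by
  rw [← Complex.ofReal_pow, mul_pow, ← Real.exp_nat_mul]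
  norm_num

lemma IsSolution.continuous {ℓ : ℝ} {m : ℂ} {u : ℝ → ℂ} (hu : IsSolution ℓ m u) : Continuous u :=
  hu.1.continuous

lemma IsSolution.continuous_deriv {ℓ : ℝ} {m : ℂ} {u : ℝ → ℂ} (hu : IsSolution ℓ m u) :
    Continuous (deriv u) :=
  continuous_iff_continuousAt.2 fun x => (hu.2 x).continuousAt

lemma continuous_potential (ℓ : ℝ) (m : ℂ) :
    Continuous fun x : ℝ => m ^ 2 - ((ℓ * Real.exp x : ℝ) : ℂ) ^ 2 := by
  fun_prop

lemma IsSolution.isAC1 {ℓ : ℝ} {m : ℂ} {u : ℝ → ℂ} (hu : IsSolution ℓ m u) : IsAC1 u :=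
  ⟨hu.1, ac_of_hasDerivAt ((continuous_potential ℓ m).mul hu.continuous) hu.2⟩

lemma IsSolution.negExpExpr {ℓ : ℝ} {m : ℂ} {u : ℝ → ℂ} (hu : IsSolution ℓ m u) (x : ℝ) :
    negExpExpr ℓ u x = -m ^ 2 * u x := by
  rw [_root_.negExpExpr, (hu.2 x).deriv, ofReal_sq_mul_exp]; ring

lemma isSolution_of_negExpExpr {ℓ : ℝ} {m : ℂ} {u : ℝ → ℂ} (hu : IsAC1 u)
    (h : ∀ᵐ x, negExpExpr ℓ u x = -m ^ 2 * u x) : IsSolution ℓ m u := by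
  refine ⟨hu.1, hasDerivAt_of_ac hu.2 ((continuous_potential ℓ m).mul hu.1.continuous) ?_⟩
  filter_upwards [h, hu.ae_differentiableAt] with x h1 h2
  refine h2.hasDerivAt.congr_deriv ?_
  rw [negExpExpr, ofReal_sq_mul_exp] at h1
  linear_combination -h1

/-- Variation of constants: the derivative of `G A + J B` when `A' = J g` and `B' = -G g`. -/
lemma variation_of_constants {ℓ : ℝ} {m c : ℂ} {J G A B g : ℝ → ℂ} (hJ : IsSolution ℓ m J)
    (hG : IsSolution ℓ m G) (hc : ∀ x, c * wronskian J G x = -1)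
    (hA : ∀ a b, AbsolutelyContinuousOnInterval A a b)
    (hB : ∀ a b, AbsolutelyContinuousOnInterval B a b)
    (hA' : ∀ᵐ x, HasDerivAt A (J x * g x) x) (hB' : ∀ᵐ x, HasDerivAt B (-(G x * g x)) x) :
    IsAC1 (fun x => c * (G x * A x + J x * B x)) ∧
    (∀ x, deriv (fun x => c * (G x * A x + J x * B x)) x =
      c * (deriv G x * A x + deriv J x * B x)) ∧
    ∀ᵐ x, negExpExpr ℓ (fun x => c * (G x * A x + J x * B x)) x =
      -m ^ 2 * (c * (G x * A x + J x * B x)) + g x := by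
  have cont : ∀ {F : ℝ → ℂ}, (∀ a b, AbsolutelyContinuousOnInterval F a b) → Continuous F := by
    intro F hF
    refine continuous_iff_continuousAt.2 fun x => ?_
    refine (hF (x - 1) (x + 1)).continuousOn.continuousAt ?_
    rw [uIcc_of_le (by linarith)]
    exact Icc_mem_nhds (by linarith) (by linarith)
  have acJ := ac_of_hasDerivAt hJ.continuous_deriv hJ.hasDerivAt
  have acG := ac_of_hasDerivAt hG.continuous_deriv hG.hasDerivAt
  have acJ' := hJ.isAC1.2
  have acG' := hG.isAC1.2
  have hu : ∀ x, HasDerivAt (fun x => c * (G x * A x + J x * B x))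
      (c * (deriv G x * A x + deriv J x * B x)) x := by
    -- The contributions `G J g` and `-J G g` cancel. Hence `g` is absent from the first derivative,
    -- which is continuous and so valid at every point.
    refine hasDerivAt_of_ac (fun a b =>
      (((acG a b).smul (hA a b)).add ((acJ a b).smul (hB a b))).const_smul c) ?_ ?_
    · exact continuous_const.mul ((hG.continuous_deriv.mul (cont hA)).add
        (hJ.continuous_deriv.mul (cont hB)))
    · filter_upwards [hA', hB'] with x h1 h2
      exact ((((hG.hasDerivAt x).mul h1).add ((hJ.hasDerivAt x).mul h2)).const_mul c).congr_deriv
        (by ring)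
  have hu' : deriv (fun x => c * (G x * A x + J x * B x)) =
      fun x => c * (deriv G x * A x + deriv J x * B x) := funext fun x => (hu x).deriv
  refine ⟨⟨fun x => (hu x).differentiableAt, fun a b => ?_⟩, fun x => (hu x).deriv, ?_⟩
  · rw [hu']
    exact (((acG' a b).smul (hA a b)).add ((acJ' a b).smul (hB a b))).const_smul c
  · filter_upwards [hA', hB'] with x h1 h2
    have h3 := (((hG.2 x).mul h1).add ((hJ.2 x).mul h2)).const_mul c
    have h4 : deriv (fun x => c * (deriv G x * A x + deriv J x * B x)) x = _ := h3.deriv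
    have h5 := hc x
    rw [negExpExpr, hu', h4, ofReal_sq_mul_exp]
    rw [wronskian] at h5
    linear_combination (-g x) * h5

/-! ### Integral operators with exponentially decaying kernel -/

lemma integrable_exp_neg_abs {δ : ℝ} (hδ : 0 < δ) (x : ℝ) :
    Integrable fun y : ℝ => Real.exp (-(δ * |x - y|)) := by
  have h : Integrable fun y : ℝ => Real.exp (-(δ * |y|)) := by
    rw [← integrableOn_univ, ← Iic_union_Ioi (a := (0 : ℝ)), integrableOn_union]
    constructor
    · refine (integrableOn_exp_mul_Iic hδ 0).congr_fun (fun y hy => ?_) measurableSet_Iic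
      simp only [abs_of_nonpos (mem_Iic.1 hy)]; ring_nf
    · refine (integrableOn_exp_mul_Ioi (neg_lt_zero.2 hδ) 0).congr_fun (fun y hy => ?_)
        measurableSet_Ioi
      simp only [abs_of_pos (mem_Ioi.1 hy)]; ring_nf
  exact h.comp_sub_left x

-- Cauchy–Schwarz applied to `√w` and `√w f`.
open scoped ENNReal in
lemma lintegral_mul_sq_le (w f : ℝ → ℝ≥0∞) (hw : Measurable w) (hf : Measurable f) :
    (∫⁻ y, w y * f y) ^ 2 ≤ (∫⁻ y, w y) * ∫⁻ y, w y * f y ^ 2 := by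
  have h := ENNReal.lintegral_mul_le_Lp_mul_Lq volume Real.HolderConjugate.two_two
    (hw.pow_const (1 / 2 : ℝ)).aemeasurable ((hw.pow_const (1 / 2 : ℝ)).mul hf).aemeasurable
  have hs : ∀ a : ℝ≥0∞, a ^ (1 / 2 : ℝ) * a ^ (1 / 2 : ℝ) = a := fun a => by
    rw [← ENNReal.rpow_add_of_nonneg _ _ (by norm_num) (by norm_num)]; norm_num
  have hs2 : ∀ a : ℝ≥0∞, (a ^ (1 / 2 : ℝ)) ^ (2 : ℝ) = a := fun a => by
    rw [← ENNReal.rpow_mul]; norm_num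
  simp only [Pi.mul_apply, ← mul_assoc, hs] at h
  have h2 : ∀ y, (w y ^ (1 / 2 : ℝ) * f y) ^ (2 : ℝ) = w y * f y ^ 2 := fun y => by
    rw [ENNReal.mul_rpow_of_nonneg _ _ (by norm_num), hs2]
    norm_num
  simp only [hs2, h2] at h
  calc _ ≤ _ := pow_le_pow_left₀ zero_le h 2
    _ = _ := by rw [mul_pow, sq, sq, hs, hs]

/-- `k` is measurable and dominated by `C exp (-δ |x - y|)`. -/
def IsExpDecaying (k : ℝ → ℝ → ℂ) : Prop :=
  Measurable (Function.uncurry k) ∧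
    ∃ C δ : ℝ, 0 < δ ∧ ∀ x y, ‖k x y‖ ≤ C * Real.exp (-(δ * |x - y|))

lemma IsExpDecaying.memLp {k : ℝ → ℝ → ℂ} (hk : IsExpDecaying k) (x : ℝ) : MemLp (k x) 2 := by
  obtain ⟨hm, C, δ, hδ, hb⟩ := hk
  have hmx : Measurable (k x) := hm.comp measurable_prodMk_left
  rw [memLp_two_iff_integrable_sq_norm hmx.aestronglyMeasurable]
  refine ((integrable_exp_neg_abs (by positivity : 0 < 2 * δ) x).const_mul (C ^ 2)).mono'
    (hmx.norm.pow_const 2).aestronglyMeasurable (Eventually.of_forall fun y => ?_)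
  rw [Real.norm_of_nonneg (by positivity)]
  calc ‖k x y‖ ^ 2 ≤ (C * Real.exp (-(δ * |x - y|))) ^ 2 := by gcongr; exact hb x y
    _ = _ := by rw [mul_pow, ← Real.exp_nat_mul]; congr 2; push_cast; ring

lemma IsExpDecaying.integrable {k : ℝ → ℝ → ℂ} (hk : IsExpDecaying k) (g : L2R) (x : ℝ) :
    Integrable fun y => k x y * g y :=
  (hk.memLp x).integrable_mul (Lp.memLp g)

-- Schur's test: the kernel is dominated by a convolution with an integrable weight. Weighted
-- Cauchy–Schwarz in `y` and Tonelli in `x` bound the operator norm by the integral of the weight.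
open scoped ENNReal in
lemma IsExpDecaying.exists_bound {k : ℝ → ℝ → ℂ} (hk : IsExpDecaying k) :
    ∃ M : ℝ≥0∞, M ≠ ⊤ ∧ ∀ g : L2R, MemLp (fun x => ∫ y, k x y * g y) 2 ∧
      eLpNorm (fun x => ∫ y, k x y * g y) 2 volume ≤ M * eLpNorm g 2 volume := by
  obtain ⟨hm, C, δ, hδ, hb⟩ := hk
  set w : ℝ → ℝ≥0∞ := fun t => ENNReal.ofReal (C * Real.exp (-(δ * |t|))) with hw
  have hwm : Measurable w := by fun_prop
  have hwM : ∫⁻ t, w t ≠ ⊤ := by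
    have h := ((integrable_exp_neg_abs hδ 0).const_mul C).lintegral_lt_top
    simp only [zero_sub, abs_neg] at h
    exact h.ne
  refine ⟨∫⁻ t, w t, hwM, fun g => ?_⟩
  have hg : StronglyMeasurable g := Lp.stronglyMeasurable g
  have hTm : StronglyMeasurable fun x => ∫ y, k x y * g y := by
    have h : StronglyMeasurable (Function.uncurry fun x y => k x y * g y) :=
      hm.stronglyMeasurable.mul (hg.comp_measurable measurable_snd)
    exact h.integral_prod_right
  have hgm : Measurable fun y => ‖g y‖ₑ := hg.measurable.enorm
  have hpt : ∀ x, ‖∫ y, k x y * g y‖ₑ ^ 2 ≤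
      (∫⁻ t, w t) * ∫⁻ y, w (x - y) * ‖g y‖ₑ ^ 2 := by
    intro x
    have hwx : Measurable fun y => w (x - y) := hwm.comp (measurable_const.sub measurable_id)
    have h1 : ‖∫ y, k x y * g y‖ₑ ≤ ∫⁻ y, w (x - y) * ‖g y‖ₑ := by
      refine (enorm_integral_le_lintegral_enorm _).trans (lintegral_mono fun y => ?_)
      rw [enorm_mul]
      gcongr
      rw [← ofReal_norm]
      exact ENNReal.ofReal_le_ofReal (hb x y)
    have h2 := lintegral_mul_sq_le _ _ hwx hgm
    rw [lintegral_sub_left_eq_self w x] at h2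
    exact (pow_le_pow_left₀ zero_le h1 2).trans h2
  have hint : ∫⁻ x, ‖∫ y, k x y * g y‖ₑ ^ 2 ≤ (∫⁻ t, w t) ^ 2 * ∫⁻ y, ‖g y‖ₑ ^ 2 := by
    calc _ ≤ ∫⁻ x, (∫⁻ t, w t) * ∫⁻ y, w (x - y) * ‖g y‖ₑ ^ 2 := lintegral_mono hpt
      _ = (∫⁻ t, w t) * ∫⁻ x, ∫⁻ y, w (x - y) * ‖g y‖ₑ ^ 2 := by
        rw [lintegral_const_mul]
        exact Measurable.lintegral_prod_right' (f := fun p : ℝ × ℝ => w (p.1 - p.2) * ‖g p.2‖ₑ ^ 2)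
          (by fun_prop)
      _ = (∫⁻ t, w t) * ∫⁻ y, (∫⁻ t, w t) * ‖g y‖ₑ ^ 2 := by
        rw [lintegral_lintegral_swap]
        · congr 1
          refine lintegral_congr fun y => ?_
          rw [lintegral_mul_const _ (by fun_prop : Measurable fun x => w (x - y)),
            lintegral_sub_right_eq_self w y]
        · exact Measurable.aemeasurable (by fun_prop)
      _ = _ := by rw [lintegral_const_mul _ (hgm.pow_const 2)]; ring
  have hnorm : ∀ f : ℝ → ℂ, eLpNorm f 2 volume = (∫⁻ x, ‖f x‖ₑ ^ 2) ^ (1 / 2 : ℝ) := by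
    intro f
    rw [eLpNorm_eq_lintegral_rpow_enorm_toReal (by norm_num) (by norm_num)]
    norm_num
  have hle : eLpNorm (fun x => ∫ y, k x y * g y) 2 volume ≤ (∫⁻ t, w t) * eLpNorm g 2 volume := by
    rw [hnorm, hnorm]
    refine (ENNReal.rpow_le_rpow hint (by norm_num)).trans (le_of_eq ?_)
    rw [ENNReal.mul_rpow_of_nonneg _ _ (by norm_num), ← ENNReal.rpow_natCast, ← ENNReal.rpow_mul]
    norm_num
  exact ⟨⟨hTm.aestronglyMeasurable, hle.trans_lt
    (ENNReal.mul_lt_top hwM.lt_top (Lp.eLpNorm_lt_top g))⟩, hle⟩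

lemma IsExpDecaying.exists_operator {k : ℝ → ℝ → ℂ} (hk : IsExpDecaying k) :
    ∃ R : L2R →L[ℂ] L2R, ∀ g : L2R, R g =ᵐ[volume] fun x => ∫ y, k x y * g y := by
  obtain ⟨M, hM, h⟩ := hk.exists_bound
  let T : L2R →ₗ[ℂ] L2R :=
    { toFun := fun g => (h g).1.toLp
      map_add' := by
        intro f g
        rw [← MemLp.toLp_add]
        refine MemLp.toLp_congr _ _ (Eventually.of_forall fun x => ?_)
        simp only [Pi.add_apply]
        rw [← integral_add (hk.integrable f x) (hk.integrable g x)]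
        refine integral_congr_ae ?_
        filter_upwards [Lp.coeFn_add f g] with y hy
        rw [hy, Pi.add_apply, mul_add]
      map_smul' := by
        intro c g
        rw [RingHom.id_apply, ← MemLp.toLp_const_smul]
        refine MemLp.toLp_congr _ _ (Eventually.of_forall fun x => ?_)
        simp only [Pi.smul_apply, smul_eq_mul]
        rw [← integral_const_mul]
        refine integral_congr_ae ?_
        filter_upwards [Lp.coeFn_smul c g] with y hy
        rw [hy, Pi.smul_apply, smul_eq_mul]; ring }
  refine ⟨T.mkContinuous M.toReal fun g => ?_, fun g => (h g).1.coeFn_toLp⟩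
  have hT : T g = (h g).1.toLp := rfl
  rw [hT, Lp.norm_toLp, Lp.norm_def, ← ENNReal.toReal_mul]
  exact ENNReal.toReal_mono (ENNReal.mul_ne_top hM (Lp.eLpNorm_ne_top g)) (h g).2

/-! ### Bounds on the solutions and on the kernel -/

lemma exists_bound_of_tendsto_atTop {h : ℝ → ℝ} {L : ℝ} (hh : Continuous h)
    (hL : Tendsto h atTop (𝓝 L)) (b : ℝ) : ∃ C, 0 ≤ C ∧ ∀ x, b ≤ x → h x ≤ C := by
  obtain ⟨N, hN⟩ := eventually_atTop.1 (hL.eventually (ge_mem_nhds (lt_add_one L)))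
  obtain ⟨C, hC⟩ := isCompact_Icc.exists_bound_of_continuousOn (hh.continuousOn (s := Icc b N))
  refine ⟨max (max C (L + 1)) 0, le_max_right _ _, fun x hx => ?_⟩
  rcases le_total N x with h1 | h1
  · exact (hN x h1).trans ((le_max_right _ _).trans (le_max_left _ _))
  · exact ((le_abs_self _).trans (hC x ⟨hx, h1⟩)).trans ((le_max_left _ _).trans (le_max_left _ _))

lemma exists_exp_bound_Ici {f : ℝ → ℂ} {a : ℝ} {L : ℝ} (hf : Continuous f)
    (h : Tendsto (fun x => Real.exp (a * x) * ‖f x‖) atTop (𝓝 L)) (b : ℝ) :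
    ∃ C, 0 ≤ C ∧ ∀ x, b ≤ x → ‖f x‖ ≤ C * Real.exp (-(a * x)) := by
  obtain ⟨C, hC0, hC⟩ := exists_bound_of_tendsto_atTop (by fun_prop) h b
  refine ⟨C, hC0, fun x hx => ?_⟩
  have h1 := mul_le_mul_of_nonneg_right (hC x hx) (Real.exp_nonneg (-(a * x)))
  rwa [mul_right_comm, ← Real.exp_add, add_neg_cancel, Real.exp_zero, one_mul] at h1

lemma exists_exp_bound_Iic {f : ℝ → ℂ} {a : ℝ} {L : ℝ} (hf : Continuous f)
    (h : Tendsto (fun x => Real.exp (a * x) * ‖f x‖) atBot (𝓝 L)) (b : ℝ) :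
    ∃ C, 0 ≤ C ∧ ∀ x, x ≤ b → ‖f x‖ ≤ C * Real.exp (-(a * x)) := by
  have h1 := h.comp tendsto_neg_atTop_atBot
  obtain ⟨C, hC0, hC⟩ := exists_exp_bound_Ici (f := fun x => f (-x)) (a := -a) (hf.comp continuous_neg)
    (h1.congr fun x => by simp) (-b)
  refine ⟨C, hC0, fun x hx => ?_⟩
  simpa using hC (-x) (neg_le_neg hx)

lemma tendsto_norm_solJ_atBot {ℓ : ℝ} (hℓ : 0 < ℓ) (m : ℂ) :
    Tendsto (fun x : ℝ => Real.exp (-m.re * x) * ‖solJ ℓ m x‖) atBot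
      (𝓝 ‖((ℓ / 2 : ℝ) : ℂ) ^ m * (Complex.Gamma (m + 1))⁻¹‖) := by
  refine (tendsto_solJ_atBot hℓ m).norm.congr fun x => ?_
  rw [norm_mul, Complex.norm_exp]; simp

lemma tendsto_norm_solU_atBot {ℓ : ℝ} (hℓ : 0 < ℓ) {m : ℂ} (hm : 0 < m.re) :
    ∃ L, Tendsto (fun x : ℝ => Real.exp (m.re * x) * ‖solU ℓ m x‖) atBot (𝓝 L) := by
  refine ⟨_, (tendsto_solU_atBot hℓ hm).norm.congr fun x => ?_⟩
  rw [norm_mul, Complex.norm_exp]; simp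

lemma tendsto_norm_solU_atTop {ℓ : ℝ} (hℓ : 0 < ℓ) (m : ℂ) :
    ∃ L, Tendsto (fun x : ℝ => Real.exp (1 / 2 * x) * ‖solU ℓ m x‖) atTop (𝓝 L) := by
  refine ⟨_, ((tendsto_solU_atTop hℓ m).norm.const_mul (√ℓ)⁻¹).congr fun x => ?_⟩
  have hs : 0 < √ℓ := Real.sqrt_pos.2 hℓ
  rw [norm_mul, norm_mul, Complex.norm_exp, Complex.norm_real, Real.sqrt_mul hℓ.le,
    ← Real.exp_half, Real.norm_of_nonneg (by positivity)]
  have : (-(Complex.I * ((ℓ * Real.exp x : ℝ) : ℂ))).re = 0 := by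
    rw [Complex.neg_re, Complex.re_mul_ofReal]; simp
  rw [this, Real.exp_zero, mul_one, show 1 / 2 * x = x / 2 by ring]
  field_simp

lemma norm_solV (ℓ : ℝ) (m : ℂ) (x : ℝ) : ‖solV ℓ m x‖ = ‖solU ℓ ((starRingEnd ℂ) m) x‖ :=
  RCLike.norm_conj _

/-- The exponent of the growth of a solution: `a x` on the left, `- x / 2` on the right. -/
noncomputable def growthExponent (a x : ℝ) : ℝ := if x ≤ 0 then a * x else -(1 / 2 * x)

lemma exists_growth_bound {f : ℝ → ℂ} {a C₁ C₂ : ℝ} (hC₁ : 0 ≤ C₁)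
    (h1 : ∀ x, x ≤ 0 → ‖f x‖ ≤ C₁ * Real.exp (a * x))
    (h2 : ∀ x, 0 ≤ x → ‖f x‖ ≤ C₂ * Real.exp (-(1 / 2 * x))) :
    ∃ C, 0 ≤ C ∧ ∀ x, ‖f x‖ ≤ C * Real.exp (growthExponent a x) := by
  refine ⟨max C₁ C₂, hC₁.trans (le_max_left _ _), fun x => ?_⟩
  unfold growthExponent
  split_ifs with hx
  · exact (h1 x hx).trans (by gcongr; exact le_max_left _ _)
  · exact (h2 x (not_le.1 hx).le).trans (by gcongr; exact le_max_right _ _)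

lemma exists_growth_bound_solU {ℓ : ℝ} (hℓ : 0 < ℓ) {m : ℂ} (hm : 0 < m.re) :
    ∃ C, 0 ≤ C ∧ ∀ x, ‖solU ℓ m x‖ ≤ C * Real.exp (growthExponent (-m.re) x) := by
  have hc := (isSolution_solU hℓ m).continuous
  obtain ⟨L₁, hL₁⟩ := tendsto_norm_solU_atBot hℓ hm
  obtain ⟨L₂, hL₂⟩ := tendsto_norm_solU_atTop hℓ m
  obtain ⟨C₁, hC₁, h1⟩ := exists_exp_bound_Iic hc hL₁ 0
  obtain ⟨C₂, hC₂, h2⟩ := exists_exp_bound_Ici hc hL₂ 0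
  exact exists_growth_bound hC₁ (fun x hx => by simpa using h1 x hx) h2

lemma exists_growth_bound_lincomb {u v : ℝ → ℂ} {a : ℝ} (p q : ℂ)
    (hu : ∃ C, 0 ≤ C ∧ ∀ x, ‖u x‖ ≤ C * Real.exp (growthExponent a x))
    (hv : ∃ C, 0 ≤ C ∧ ∀ x, ‖v x‖ ≤ C * Real.exp (growthExponent a x)) :
    ∃ C, 0 ≤ C ∧ ∀ x, ‖p * u x + q * v x‖ ≤ C * Real.exp (growthExponent a x) := by
  obtain ⟨C, hC, h1⟩ := hu
  obtain ⟨D, hD, h2⟩ := hv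
  refine ⟨‖p‖ * C + ‖q‖ * D, by positivity, fun x => (norm_add_le _ _).trans ?_⟩
  rw [norm_mul, norm_mul, add_mul, mul_assoc, mul_assoc]
  gcongr
  exacts [h1 x, h2 x]

lemma exists_growth_bound_hankelCombination {ℓ : ℝ} (hℓ : 0 < ℓ) (γ : ℂ) {m : ℂ} (hm : 0 < m.re) :
    ∃ C, 0 ≤ C ∧ ∀ x, ‖hankelCombination ℓ γ m x‖ ≤ C * Real.exp (growthExponent (-m.re) x) := by
  have hm' : 0 < ((starRingEnd ℂ) m).re := by simpa using hm
  rw [hankelCombination_eq hℓ]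
  refine exists_growth_bound_lincomb _ _ (exists_growth_bound_solU hℓ hm) ?_
  simp only [norm_solV]
  simpa using exists_growth_bound_solU hℓ hm'

lemma exists_bound_solJ_atTop {ℓ : ℝ} (hℓ : 0 < ℓ) (m : ℂ) (b : ℝ) :
    ∃ C, 0 ≤ C ∧ ∀ x, b ≤ x → ‖solJ ℓ m x‖ ≤ C * Real.exp (-(1 / 2 * x)) := by
  have hU := (isSolution_solU hℓ m).continuous
  have hU' := (isSolution_solU hℓ ((starRingEnd ℂ) m)).continuous
  obtain ⟨L₁, hL₁⟩ := tendsto_norm_solU_atTop hℓ m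
  obtain ⟨L₂, hL₂⟩ := tendsto_norm_solU_atTop hℓ ((starRingEnd ℂ) m)
  obtain ⟨C, hC, h1⟩ := exists_exp_bound_Ici hU hL₁ b
  obtain ⟨D, hD, h2⟩ := exists_exp_bound_Ici hU' hL₂ b
  set p := Complex.exp (-(Complex.I * m * (Real.pi / 2)))
  set q := Complex.exp (Complex.I * m * (Real.pi / 2))
  refine ⟨‖(2 * Real.pi * Complex.I : ℂ)⁻¹‖ * (‖p‖ * C + ‖q‖ * D), by positivity, fun x hx => ?_⟩
  rw [solJ_eq hℓ, norm_mul, mul_assoc ‖_‖, add_mul, mul_assoc ‖p‖,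
    mul_assoc ‖q‖]
  gcongr
  refine (norm_sub_le _ _).trans ?_
  rw [norm_mul, norm_mul, norm_solV]
  gcongr
  exacts [h1 x hx, h2 x hx]

lemma exists_growth_bound_solJ {ℓ : ℝ} (hℓ : 0 < ℓ) (m : ℂ) :
    ∃ C, 0 ≤ C ∧ ∀ x, ‖solJ ℓ m x‖ ≤ C * Real.exp (growthExponent m.re x) := by
  obtain ⟨C₁, hC₁, h1⟩ := exists_exp_bound_Iic (isSolution_solJ hℓ m).continuous
    (tendsto_norm_solJ_atBot hℓ m) 0
  obtain ⟨C₂, hC₂, h2⟩ := exists_bound_solJ_atTop hℓ m 0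
  exact exists_growth_bound hC₁ (fun x hx => by simpa using h1 x hx) h2

/-- On the left the rates `a` and `-a` combine to `-a (y - x)`; on the right both factors decay, and
`-(x + y) / 2 ≤ -(y - x) / 2` because `x ≥ 0`. The smaller of the two rates also covers the mixed
case. -/
lemma growthExponent_add_le {a x y : ℝ} (hxy : x ≤ y) :
    growthExponent a x + growthExponent (-a) y ≤ -(min a (1 / 2) * |x - y|) := by
  have h1 := min_le_left a (1 / 2)
  have h2 := min_le_right a (1 / 2)
  set δ := min a (1 / 2)
  rw [abs_of_nonpos (by linarith)]
  unfold growthExponent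
  split_ifs with hx hy hy
  · nlinarith
  · nlinarith
  · linarith
  · nlinarith

lemma isExpDecaying_mixedKernel {ℓ : ℝ} (hℓ : 0 < ℓ) (γ : ℂ) {m : ℂ} (hm : 0 < m.re) :
    IsExpDecaying (mixedKernel ℓ γ m) := by
  have hJc := (isSolution_solJ hℓ m).continuous
  have hGc := (isSolution_hankelCombination hℓ γ m).continuous
  obtain ⟨C, hC, hJ⟩ := exists_growth_bound_solJ hℓ m
  obtain ⟨D, hD, hG⟩ := exists_growth_bound_hankelCombination hℓ γ hm
  set c := Real.pi * Complex.I / (2 * (Complex.exp (Complex.I * m * Real.pi) - γ)) with hcdef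
  have hk : ∀ x y, mixedKernel ℓ γ m x y = c * if x < y then
    solJ ℓ m x * hankelCombination ℓ γ m y else solJ ℓ m y * hankelCombination ℓ γ m x :=
    fun x y => rfl
  have key : ∀ x y, x ≤ y → ‖c * (solJ ℓ m x * hankelCombination ℓ γ m y)‖ ≤
      (‖c‖ * (C * D)) * Real.exp (-(min m.re (1 / 2) * |x - y|)) := by
    intro x y hxy
    rw [norm_mul, norm_mul, mul_assoc]
    refine mul_le_mul_of_nonneg_left ?_ (norm_nonneg c)
    calc _ ≤ (C * Real.exp (growthExponent m.re x)) *
          (D * Real.exp (growthExponent (-m.re) y)) := by gcongr; exacts [hJ x, hG y]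
      _ = (C * D) * Real.exp (growthExponent m.re x + growthExponent (-m.re) y) := by
        rw [Real.exp_add]; ring
      _ ≤ _ := by gcongr; exact growthExponent_add_le hxy
  refine ⟨?_, ‖c‖ * (C * D), min m.re (1 / 2), lt_min hm (by norm_num), fun x y => ?_⟩
  · have h : Function.uncurry (mixedKernel ℓ γ m) = fun p : ℝ × ℝ => c * if p.1 < p.2 then
        solJ ℓ m p.1 * hankelCombination ℓ γ m p.2 else
        solJ ℓ m p.2 * hankelCombination ℓ γ m p.1 := by
      funext p; exact hk p.1 p.2
    rw [h]
    refine Measurable.const_mul (Measurable.ite (measurableSet_lt measurable_fst measurable_snd)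
      ?_ ?_) c
    · exact ((hJc.comp continuous_fst).mul (hGc.comp continuous_snd)).measurable
    · exact ((hJc.comp continuous_snd).mul (hGc.comp continuous_fst)).measurable
  · rw [hk]
    split_ifs with hxy
    · exact key x y hxy.le
    · rw [abs_sub_comm]
      exact key y x (not_lt.1 hxy)

lemma exists_exp_abs_bound_solJ {ℓ : ℝ} (hℓ : 0 < ℓ) {m : ℂ} (hm : 0 < m.re) :
    ∃ C δ, 0 ≤ C ∧ 0 < δ ∧ ∀ x, ‖solJ ℓ m x‖ ≤ C * Real.exp (-(δ * |x|)) := by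
  obtain ⟨C, hC, hJ⟩ := exists_growth_bound_solJ hℓ m
  refine ⟨C, min m.re (1 / 2), hC, lt_min hm (by norm_num), fun x => (hJ x).trans ?_⟩
  have h1 := min_le_left m.re (1 / 2)
  have h2 := min_le_right m.re (1 / 2)
  set δ := min m.re (1 / 2)
  gcongr
  unfold growthExponent
  split_ifs with h
  · rw [abs_of_nonpos h]; nlinarith
  · rw [abs_of_pos (not_le.1 h)]; nlinarith

lemma memLp_solJ {ℓ : ℝ} (hℓ : 0 < ℓ) {m : ℂ} (hm : 0 < m.re) : MemLp (solJ ℓ m) 2 := by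
  have hc := (isSolution_solJ hℓ m).continuous
  obtain ⟨C, δ, hC, hδ, hJ⟩ := exists_exp_abs_bound_solJ hℓ hm
  rw [memLp_two_iff_integrable_sq_norm hc.aestronglyMeasurable]
  refine ((integrable_exp_neg_abs (by positivity : 0 < 2 * δ) 0).const_mul
    (C ^ 2)).mono' (hc.norm.pow 2).aestronglyMeasurable (Eventually.of_forall fun y => ?_)
  rw [Real.norm_of_nonneg (by positivity)]
  calc ‖solJ ℓ m y‖ ^ 2 ≤ (C * Real.exp (-(δ * |y|))) ^ 2 := by gcongr; exact hJ y
    _ = _ := by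
      rw [mul_pow, ← Real.exp_nat_mul, zero_sub, abs_neg]; congr 2; push_cast; ring

/-- This kernel carries the whole dependence of the resolvent on `γ`. -/
lemma isExpDecaying_solJ_mul_solJ {ℓ : ℝ} (hℓ : 0 < ℓ) {m : ℂ} (hm : 0 < m.re) :
    IsExpDecaying fun x y => solJ ℓ m x * solJ ℓ m y := by
  have hc := (isSolution_solJ hℓ m).continuous
  obtain ⟨C, δ, hC, hδ, hJ⟩ := exists_exp_abs_bound_solJ hℓ hm
  refine ⟨((hc.comp continuous_fst).mul (hc.comp continuous_snd)).measurable, C * C, δ, hδ,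
    fun x y => ?_⟩
  rw [norm_mul]
  calc _ ≤ (C * Real.exp (-(δ * |x|))) * (C * Real.exp (-(δ * |y|))) := by
        gcongr; exacts [hJ x, hJ y]
    _ = C * C * Real.exp (-(δ * (|x| + |y|))) := by
        rw [mul_add, neg_add, Real.exp_add]; ring
    _ ≤ _ := by gcongr; exact abs_sub x y

lemma memLp_Ioi_of_exp_bound {f : ℝ → ℂ} {C b : ℝ} (hf : Continuous f)
    (h : ∀ x, b ≤ x → ‖f x‖ ≤ C * Real.exp (-(1 / 2 * x))) :
    MemLp f 2 (volume.restrict (Ioi b)) := by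
  rw [memLp_two_iff_integrable_sq_norm hf.aestronglyMeasurable]
  refine ((integrableOn_exp_mul_Ioi (by norm_num : (-1 : ℝ) < 0) b).const_mul (C ^ 2)).mono'
    (hf.norm.pow 2).aestronglyMeasurable ?_
  filter_upwards [ae_restrict_mem measurableSet_Ioi] with y hy
  rw [Real.norm_of_nonneg (by positivity)]
  calc ‖f y‖ ^ 2 ≤ (C * Real.exp (-(1 / 2 * y))) ^ 2 := by gcongr; exact h y (mem_Ioi.1 hy).le
    _ = _ := by rw [mul_pow, ← Real.exp_nat_mul]; congr 2; push_cast; ring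

lemma memLp_Ioi_hankelCombination {ℓ : ℝ} (hℓ : 0 < ℓ) (γ m : ℂ) (b : ℝ) :
    MemLp (hankelCombination ℓ γ m) 2 (volume.restrict (Ioi b)) := by
  have hU := (isSolution_solU hℓ m).continuous
  have hU' := (isSolution_solU hℓ ((starRingEnd ℂ) m)).continuous
  obtain ⟨L₁, hL₁⟩ := tendsto_norm_solU_atTop hℓ m
  obtain ⟨L₂, hL₂⟩ := tendsto_norm_solU_atTop hℓ ((starRingEnd ℂ) m)
  obtain ⟨C, hC, h1⟩ := exists_exp_bound_Ici hU hL₁ b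
  obtain ⟨D, hD, h2⟩ := exists_exp_bound_Ici hU' hL₂ b
  have hVc := (isSolution_solV hℓ m).continuous
  have h3 := memLp_Ioi_of_exp_bound hU h1
  have h4 : MemLp (solV ℓ m) 2 (volume.restrict (Ioi b)) :=
    memLp_Ioi_of_exp_bound hVc (fun x hx => (norm_solV ℓ m x).trans_le (h2 x hx))
  rw [hankelCombination_eq hℓ]
  exact (h3.const_mul _).add (h4.const_mul _)

/-! ### The graph of the mixed realization -/

/-- The maximal operator and the boundary condition each come with their own representative. Both
are continuous and equal almost everywhere, hence equal, so a single `u` serves for both. -/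
lemma mem_graph_mixedOp {ℓ : ℝ} {γ : ℂ} {f g : L2R} : (f, g) ∈ (mixedOp ℓ γ).graph ↔
    ∃ u : ℝ → ℂ, IsAC1 u ∧ f =ᵐ[volume] u ∧ g =ᵐ[volume] negExpExpr ℓ u ∧
      Tendsto (wronskian (bcFun ℓ γ) u) atTop (𝓝 0) := by
  constructor
  · intro h
    have hmax : (f, g) ∈ maxGraph ℓ := by
      rw [← maxOp_graph]
      exact LinearPMap.le_graph_of_le LinearPMap.domRestrict_le h
    obtain ⟨u, hu, hfu, hgu⟩ := hmax
    have hd : f ∈ bcSubmodule ℓ γ := (LinearPMap.mem_domain_of_mem_graph h).1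
    obtain ⟨v, hv, hfv, hb⟩ := hd
    have e : u = v := (hu.1.continuous.ae_eq_iff_eq volume hv.1.continuous).1 (hfu.symm.trans hfv)
    exact ⟨u, hu, hfu, hgu, e ▸ hb⟩
  · rintro ⟨u, hu, hfu, hgu, hb⟩
    have hmax : (f, g) ∈ (maxOp ℓ).graph := by
      rw [maxOp_graph]; exact ⟨u, hu, hfu, hgu⟩
    have hd : f ∈ (mixedOp ℓ γ).domain :=
      ⟨⟨u, hu, hfu, hb⟩, LinearPMap.mem_domain_of_mem_graph hmax⟩
    have h1 := LinearPMap.mem_graph (mixedOp ℓ γ) ⟨f, hd⟩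
    have h2 := LinearPMap.le_graph_of_le LinearPMap.domRestrict_le h1
    have h3 : mixedOp ℓ γ ⟨f, hd⟩ = g := LinearPMap.mem_graph_snd_inj _ h2 hmax rfl
    rwa [h3] at h1

/-! ### Eigenpairs and resolvents in terms of the graph -/

lemma isEigenpair_iff_mem_graph {E : Type*} [NormedAddCommGroup E] [InnerProductSpace ℂ E]
    {A : E →ₗ.[ℂ] E} {z : ℂ} {f : E} : IsEigenpair A z f ↔ (f, z • f) ∈ A.graph := by
  constructor
  · rintro ⟨h, e⟩
    have := LinearPMap.mem_graph A ⟨f, h⟩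
    rwa [e] at this
  · intro h
    exact ⟨LinearPMap.mem_domain_of_mem_graph h, LinearPMap.mem_graph_snd_inj _
      (LinearPMap.mem_graph A ⟨f, LinearPMap.mem_domain_of_mem_graph h⟩) h rfl⟩

/-- A right inverse of an injective `A - z` is also a left inverse: `R (A f - z f) - f` is
annihilated by `A - z`. -/
lemma isResolventAt_of_mem_graph {E : Type*} [NormedAddCommGroup E] [InnerProductSpace ℂ E]
    {A : E →ₗ.[ℂ] E} {z : ℂ} {R : E →L[ℂ] E} (h1 : ∀ g, (R g, g + z • R g) ∈ A.graph)
    (h2 : ∀ f, (f, z • f) ∈ A.graph → f = 0) : IsResolventAt A z R := by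
  refine ⟨fun g => ⟨LinearPMap.mem_domain_of_mem_graph (h1 g), ?_⟩, fun f => ?_⟩
  · rw [LinearPMap.mem_graph_snd_inj _
      (LinearPMap.mem_graph A ⟨R g, LinearPMap.mem_domain_of_mem_graph (h1 g)⟩) (h1 g) rfl,
      add_sub_cancel_right]
  · have h3 := A.graph.sub_mem (h1 (A f - z • (f : E))) (LinearPMap.mem_graph A f)
    refine sub_eq_zero.1 (h2 _ ?_)
    convert h3 using 1
    rw [Prod.mk_sub_mk, smul_sub]
    congr 1
    abel

lemma IsResolventAt.mem_graph {E : Type*} [NormedAddCommGroup E] [InnerProductSpace ℂ E]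
    {A : E →ₗ.[ℂ] E} {z : ℂ} {R : E →L[ℂ] E} (h : IsResolventAt A z R) (g : E) :
    (R g, g + z • R g) ∈ A.graph := by
  obtain ⟨hd, e⟩ := h.1 g
  have := LinearPMap.mem_graph A ⟨R g, hd⟩
  rwa [sub_eq_iff_eq_add.1 e] at this

lemma IsResolventAt.eq_of_mem_graph {E : Type*} [NormedAddCommGroup E] [InnerProductSpace ℂ E]
    {A : E →ₗ.[ℂ] E} {z : ℂ} {R : E →L[ℂ] E} (h : IsResolventAt A z R) {f g : E}
    (hfg : (f, g) ∈ A.graph) : R (g - z • f) = f := by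
  have hd := LinearPMap.mem_domain_of_mem_graph hfg
  have := h.2 ⟨f, hd⟩
  rwa [LinearPMap.mem_graph_snd_inj _ (LinearPMap.mem_graph A ⟨f, hd⟩) hfg rfl] at this

/-- A bounded `R` describes the graph as the closed set where `R (g - z f) = f`. -/
lemma IsResolventAt.isClosed {E : Type*} [NormedAddCommGroup E] [InnerProductSpace ℂ E]
    {A : E →ₗ.[ℂ] E} {z : ℂ} {R : E →L[ℂ] E} (h : IsResolventAt A z R) : A.IsClosed := by
  have e : (A.graph : Set (E × E)) = {p | R (p.2 - z • p.1) = p.1} := by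
    ext ⟨f, g⟩
    refine ⟨fun hp => h.eq_of_mem_graph hp, fun hp => ?_⟩
    have h1 := h.mem_graph (g - z • f)
    rw [mem_ofPred_eq] at hp
    dsimp only at hp
    rw [hp, sub_add_cancel] at h1
    exact h1
  rw [LinearPMap.IsClosed, e]
  exact isClosed_eq (by fun_prop) (by fun_prop)

/-! ### Square integrable solutions -/

lemma not_memLp_of_eventually_le_atBot {f : ℝ → ℂ} {δ : ℝ} (hδ : 0 < δ)
    (h : ∀ᶠ x in atBot, δ ≤ ‖f x‖) : ¬MemLp f 2 volume := by
  intro hf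
  obtain ⟨T, hT⟩ := eventually_atBot.1 h
  have h1 := (hf.integrable_norm_pow (by norm_num)).integrableOn (s := Iic T)
  have h2 : IntegrableOn (fun _ : ℝ => δ ^ 2) (Iic T) := by
    refine h1.mono' aestronglyMeasurable_const ?_
    filter_upwards [ae_restrict_mem measurableSet_Iic] with x hx
    rw [Real.norm_of_nonneg (by positivity)]
    exact pow_le_pow_left₀ hδ.le (hT x hx) 2
  rw [integrableOn_const_iff] at h2
  simp [hδ.ne'] at h2

/-- On the imaginary axis `|J_m|` tends at `-∞` to a nonzero constant, since `Re (m + 1) = 1`. -/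
lemma not_memLp_solJ {ℓ : ℝ} (hℓ : 0 < ℓ) {m : ℂ} (hm : m.re = 0) : ¬MemLp (solJ ℓ m) 2 := by
  have h := tendsto_norm_solJ_atBot hℓ m
  have hL : 0 < ‖((ℓ / 2 : ℝ) : ℂ) ^ m * (Complex.Gamma (m + 1))⁻¹‖ := by
    refine norm_pos_iff.2 (mul_ne_zero ?_ (inv_ne_zero (Complex.Gamma_ne_zero_of_re_pos ?_)))
    · rw [Complex.cpow_def_of_ne_zero]
      · exact Complex.exp_ne_zero _
      · exact_mod_cast (half_pos hℓ).ne'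
    · simp [hm]
  refine not_memLp_of_eventually_le_atBot (half_pos hL) ?_
  filter_upwards [h.eventually (le_mem_nhds (half_lt_self hL))] with x hx
  simpa [hm] using hx

lemma exists_bound_solJ_deriv {ℓ : ℝ} (hℓ : 0 < ℓ) {m : ℂ} (hm : 0 ≤ m.re) :
    ∃ M, 0 < M ∧ ∀ x ≤ 0, ‖solJ ℓ m x‖ ≤ M ∧ ‖deriv (solJ ℓ m) x‖ ≤ M := by
  have bd : ∀ μ : ℂ, 0 ≤ μ.re → ∃ C, 0 ≤ C ∧ ∀ x ≤ 0, ‖solJ ℓ μ x‖ ≤ C := by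
    intro μ hμ
    obtain ⟨C, hC, h⟩ := exists_exp_bound_Iic (isSolution_solJ hℓ μ).continuous
      (tendsto_norm_solJ_atBot hℓ μ) 0
    refine ⟨C, hC, fun x hx => (h x hx).trans (mul_le_of_le_one_right hC ?_)⟩
    rw [Real.exp_le_one_iff]
    nlinarith
  obtain ⟨C, hC, h1⟩ := bd m hm
  obtain ⟨D, hD, h2⟩ := bd (m + 1) (by simp; linarith)
  refine ⟨‖m‖ * C + ℓ * D + C + 1, by positivity, fun x hx => ⟨?_, ?_⟩⟩
  · have := h1 x hx
    have : 0 ≤ ‖m‖ * C + ℓ * D := by positivity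
    linarith [h1 x hx]
  · rw [(hasDerivAt_solJ hℓ m x).deriv]
    refine (norm_add_le _ _).trans ?_
    have e : ‖(-1 : ℂ) * (ℓ * Real.exp x : ℝ) * solJ ℓ (m + 1) x‖ ≤ ℓ * D := by
      rw [norm_mul, norm_mul, norm_neg, norm_one, one_mul, Complex.norm_real,
        Real.norm_of_nonneg (by positivity)]
      gcongr
      · exact mul_le_of_le_one_right hℓ.le (Real.exp_le_one_iff.2 hx)
      · exact h2 x hx
    have e2 : ‖m * solJ ℓ m x‖ ≤ ‖m‖ * C := by
      rw [norm_mul]; gcongr; exact h1 x hx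
    linarith

/-- If the constant Wronskian `c` were nonzero, integrating `(u J)' = 2 u J' - c` from `X` to `0`
would give a term `c |X|`. As `J'` is bounded on the left and `u` is square integrable, the integral
of `u J'` can absorb only part of it, so `u` would have to grow at least linearly at `-∞`. The
argument needs no second solution and includes `Re m = 0`. -/
lemma wronskian_solJ_eq_zero_of_memLp {ℓ : ℝ} (hℓ : 0 < ℓ) {m : ℂ} (hm : 0 ≤ m.re) {u : ℝ → ℂ}
    (hu : IsSolution ℓ m u) (hu2 : MemLp u 2 volume) : wronskian u (solJ ℓ m) 0 = 0 := by
  by_contra hc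
  set J := solJ ℓ m with hJdef
  have hJ : IsSolution ℓ m J := isSolution_solJ hℓ m
  set c := wronskian u J 0 with hcdef
  obtain ⟨M, hM, hbd⟩ := exists_bound_solJ_deriv hℓ hm
  have hcp : 0 < ‖c‖ := norm_pos_iff.2 hc
  -- Chosen so that `M ε = ‖c‖ / 2`: half of the linear growth survives the estimate of the
  -- integral.
  set ε := ‖c‖ / (2 * M) with hε
  have hεp : 0 < ε := by positivity
  have hsq : Integrable fun x => ‖u x‖ ^ 2 := hu2.integrable_norm_pow (by norm_num)
  set N := ∫ x, ‖u x‖ ^ 2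
  have hder : ∀ x, HasDerivAt (fun x => u x * J x) (2 * (u x * deriv J x) - c) x := by
    intro x
    refine ((hu.hasDerivAt x).mul (hJ.hasDerivAt x)).congr_deriv ?_
    have := hu.wronskian_const hJ x 0
    rw [← hcdef, wronskian] at this
    linear_combination -this
  have huJ : Continuous fun x => u x * deriv J x := hu.continuous.mul hJ.continuous_deriv
  have key : ∀ X ≤ 0, ‖c‖ * (-X) / 2 - (‖u 0 * J 0‖ + 2 * M * (1 / (2 * ε) * N)) ≤ M * ‖u X‖ := by
    intro X hX
    have h1 := intervalIntegral.integral_eq_sub_of_hasDerivAt (a := X) (b := 0)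
      (fun x _ => hder x) ((by fun_prop : Continuous fun x => 2 * (u x * deriv J x) - c).intervalIntegrable _ _)
    rw [intervalIntegral.integral_sub ((huJ.const_mul 2).intervalIntegrable _ _) (by simp),
      intervalIntegral.integral_const_mul, intervalIntegral.integral_const] at h1
    have h2 : ‖∫ x in X..0, u x * deriv J x‖ ≤ M * (ε / 2 * (-X) + 1 / (2 * ε) * N) := by
      have h3 : ∀ x ∈ Icc X 0, ‖u x * deriv J x‖ ≤ M * (ε / 2 + 1 / (2 * ε) * ‖u x‖ ^ 2) := by
        intro x hx
        have h4 := (hbd x hx.2).2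
        rw [norm_mul, mul_comm]
        have h5 : ‖u x‖ ≤ ε / 2 + 1 / (2 * ε) * ‖u x‖ ^ 2 := by
          have : ε / 2 + 1 / (2 * ε) * ‖u x‖ ^ 2 - ‖u x‖ = (‖u x‖ - ε) ^ 2 / (2 * ε) := by
            field_simp; ring
          have h6 : 0 ≤ (‖u x‖ - ε) ^ 2 / (2 * ε) := by positivity
          linarith
        gcongr
      have hcu := hu.continuous
      refine (intervalIntegral.norm_integral_le_of_norm_le hX (Eventually.of_forall fun x hx =>
        h3 x (Ioc_subset_Icc_self hx)) ((by fun_prop : Continuous fun x =>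
          M * (ε / 2 + 1 / (2 * ε) * ‖u x‖ ^ 2)).intervalIntegrable _ _)).trans ?_
      rw [intervalIntegral.integral_const_mul, intervalIntegral.integral_add
        intervalIntegrable_const ((by fun_prop : Continuous fun x =>
          1 / (2 * ε) * ‖u x‖ ^ 2).intervalIntegrable _ _), intervalIntegral.integral_const,
        intervalIntegral.integral_const_mul, intervalIntegral.integral_of_le hX]
      have h7 : ∫ x in Ioc X 0, ‖u x‖ ^ 2 ≤ N :=
        setIntegral_le_integral hsq (Eventually.of_forall fun x => by positivity)
      rw [smul_eq_mul, zero_sub, mul_comm (-X)]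
      gcongr
    have h8 : ((-X : ℝ) : ℂ) * c = 2 * (∫ x in X..0, u x * deriv J x) - u 0 * J 0 + u X * J X := by
      rw [zero_sub, Complex.real_smul] at h1
      linear_combination -h1
    have h9 : (-X) * ‖c‖ ≤ 2 * (M * (ε / 2 * (-X) + 1 / (2 * ε) * N)) + ‖u 0 * J 0‖ +
        ‖u X‖ * M := by
      have := congrArg norm h8
      rw [norm_mul, Complex.norm_real, Real.norm_of_nonneg (neg_nonneg.2 hX)] at this
      rw [this]
      refine (norm_add_le _ _).trans (add_le_add ((norm_sub_le _ _).trans (add_le_add ?_ le_rfl)) ?_)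
      · rw [norm_mul, Complex.norm_ofNat]; gcongr
      · rw [norm_mul]; gcongr; exact (hbd X hX).1
    have h10 : M * ε = ‖c‖ / 2 := by rw [hε]; field_simp
    have h11 : 2 * (M * (ε / 2 * (-X) + 1 / (2 * ε) * N)) =
      (M * ε) * (-X) + 2 * M * (1 / (2 * ε) * N) := by ring
    rw [h11, h10] at h9
    linarith
  refine not_memLp_of_eventually_le_atBot one_pos ?_ hu2
  set K := ‖u 0 * J 0‖ + 2 * M * (1 / (2 * ε) * N)
  filter_upwards [eventually_le_atBot 0, eventually_le_atBot (-((K + M) * 2 / ‖c‖))] with X h1 h2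
  have h3 := key X h1
  have h4 : K + M ≤ ‖c‖ * (-X) / 2 := by
    have : (K + M) * 2 / ‖c‖ ≤ -X := by linarith
    rw [div_le_iff₀ hcp] at this
    linarith
  have h5 : M * 1 ≤ M * ‖u X‖ := by linarith
  exact le_of_mul_le_mul_left h5 hM

/-- `u` has zero Wronskian with `J`, while `U` does not; Plücker's identity for `u`, `J`, `U` solves
for `u`. -/
lemma eq_const_mul_solJ_of_memLp {ℓ : ℝ} (hℓ : 0 < ℓ) {m : ℂ} (hm : 0 ≤ m.re) {u : ℝ → ℂ}
    (hu : IsSolution ℓ m u) (hu2 : MemLp u 2 volume) : ∃ a : ℂ, u = fun x => a * solJ ℓ m x := by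
  have hJ := isSolution_solJ hℓ m
  have hU := isSolution_solU hℓ m
  have h0 := wronskian_solJ_eq_zero_of_memLp hℓ hm hu hu2
  have hW := wronskian_solU_solJ hℓ m 0
  have hne : wronskian (solU ℓ m) (solJ ℓ m) 0 ≠ 0 := by
    rw [hW]; exact mul_ne_zero two_ne_zero (Complex.exp_ne_zero _)
  refine ⟨wronskian (solU ℓ m) u 0 / wronskian (solU ℓ m) (solJ ℓ m) 0, funext fun x => ?_⟩
  have h1 := wronskian_plucker u (solJ ℓ m) (solU ℓ m) x
  rw [hJ.wronskian_const hU x 0, hU.wronskian_const hu x 0, hu.wronskian_const hJ x 0, h0,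
    wronskian_swap (solU ℓ m)] at h1
  field_simp
  linear_combination -h1

lemma memLp_of_ae_eq {f : L2R} {u : ℝ → ℂ} (h : f =ᵐ[volume] u) : MemLp u 2 volume :=
  (memLp_congr_ae h).1 (Lp.memLp f)

lemma bcFun_solJ_const_ne_zero (m : ℂ) : 2 / (Real.pi : ℂ) *
    Complex.exp (-(Complex.I * m * (Real.pi / 2))) * Complex.exp (Complex.I * Real.pi / 4) ≠ 0 := by
  have hp : (Real.pi : ℂ) ≠ 0 := by exact_mod_cast Real.pi_ne_zero
  exact mul_ne_zero (mul_ne_zero (div_ne_zero two_ne_zero hp) (Complex.exp_ne_zero _))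
    (Complex.exp_ne_zero _)

lemma wronskian_const_mul_right (Φ : ℝ → ℂ) {u : ℝ → ℂ} (a : ℂ) (hu : Differentiable ℝ u) :
    wronskian Φ (fun x => a * u x) = fun x => a * wronskian Φ u x := by
  funext x
  have h : deriv (fun x => a * u x) x = a * deriv u x := ((hu x).hasDerivAt.const_mul a).deriv
  rw [wronskian, h, wronskian]; ring

/-- An eigenfunction of the mixed realization is a multiple of a Bessel function. -/
lemma eigenvector_mixedOp {ℓ : ℝ} (hℓ : 0 < ℓ) {γ m : ℂ} (hm : 0 ≤ m.re) {f : L2R} (hf : f ≠ 0)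
    (h : (f, (-m ^ 2) • f) ∈ (mixedOp ℓ γ).graph) :
    0 < m.re ∧ Complex.exp (Complex.I * m * Real.pi) = γ ∧
      ∃ a : ℂ, f =ᵐ[volume] fun x => a * solJ ℓ m x := by
  obtain ⟨u, hu, hfu, hgu, hb⟩ := mem_graph_mixedOp.1 h
  have hsol : IsSolution ℓ m u := by
    refine isSolution_of_negExpExpr hu ?_
    filter_upwards [hfu, hgu, Lp.coeFn_smul (-m ^ 2) f] with x h1 h2 h3
    rw [← h2, h3, Pi.smul_apply, smul_eq_mul, h1]
  have hu2 := memLp_of_ae_eq hfu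
  obtain ⟨a, rfl⟩ := eq_const_mul_solJ_of_memLp hℓ hm hsol hu2
  have ha : a ≠ 0 := by
    rintro rfl
    refine hf (Lp.ext (hfu.trans ?_))
    simp only [zero_mul]
    exact (Lp.coeFn_zero _ _ _).symm
  have hre : m.re ≠ 0 := by
    intro h0
    refine not_memLp_solJ hℓ h0 ?_
    convert hu2.const_mul a⁻¹ using 1
    funext x
    field_simp
  rw [wronskian_const_mul_right _ _ (isSolution_solJ hℓ m).1] at hb
  -- The boundary limit of `a J_m` is known explicitly; it can vanish only through the factor `γ -
  -- e^{imπ}`.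
  have h2 := tendsto_nhds_unique hb ((tendsto_wronskian_bcFun_solJ hℓ γ m).const_mul a)
  have h3 := (mul_eq_zero.1 h2.symm).resolve_left ha
  have h4 := (mul_eq_zero.1 h3).resolve_left (bcFun_solJ_const_ne_zero m)
  exact ⟨lt_of_le_of_ne hm hre.symm, (sub_eq_zero.1 h4).symm, a, hfu⟩

lemma solJ_mem_graph_mixedOp {ℓ : ℝ} (hℓ : 0 < ℓ) {m : ℂ} {f : L2R} {a : ℂ}
    (hf : f =ᵐ[volume] fun x => a * solJ ℓ m x) :
    (f, (-m ^ 2) • f) ∈ (mixedOp ℓ (Complex.exp (Complex.I * m * Real.pi))).graph := by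
  have hJ := isSolution_solJ hℓ m
  have hs : IsSolution ℓ m fun x => a * solJ ℓ m x := by
    simpa using hJ.lincomb hJ a 0
  refine mem_graph_mixedOp.2 ⟨_, hs.isAC1, hf, ?_, ?_⟩
  · filter_upwards [hf, Lp.coeFn_smul (-m ^ 2) f] with x h1 h2
    rw [hs.negExpExpr, h2, Pi.smul_apply, smul_eq_mul, h1]
  · rw [wronskian_const_mul_right _ _ hJ.1]
    simpa using (tendsto_wronskian_bcFun_solJ hℓ (Complex.exp (Complex.I * m * Real.pi)) m).const_mul a

lemma solJ_ne_zero {ℓ : ℝ} (hℓ : 0 < ℓ) (m : ℂ) : solJ ℓ m ≠ 0 := by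
  intro h
  have hW := wronskian_solU_solJ hℓ m 0
  rw [wronskian, h] at hW
  have h0 : deriv (0 : ℝ → ℂ) = 0 := by funext x; exact deriv_const x 0
  rw [h0] at hW
  simp at hW

/-! ### The resolvent -/

/-- Variation of constants with `A` the integral of `J g` from `-∞` and `B` the integral of `G g` to
`+∞`, which is the kernel split at `y = x`. `J` is square integrable on the line and `G` near `+∞`,
so both integrals converge. -/
lemma solution_operator_mixedOp {ℓ : ℝ} (hℓ : 0 < ℓ) {γ m : ℂ} (hm : 0 < m.re)
    (hγ : Complex.exp (Complex.I * m * Real.pi) ≠ γ) (g : L2R) :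
    ∃ u : ℝ → ℂ, IsAC1 u ∧ (∀ x, u x = ∫ y, mixedKernel ℓ γ m x y * g y) ∧
      (∀ᵐ x, negExpExpr ℓ u x = -m ^ 2 * u x + g x) ∧
      Tendsto (wronskian (bcFun ℓ γ) u) atTop (𝓝 0) := by
  set J := solJ ℓ m with hJdef
  set G := hankelCombination ℓ γ m with hGdef
  set c := Real.pi * Complex.I / (2 * (Complex.exp (Complex.I * m * Real.pi) - γ)) with hcdef
  have hJ : IsSolution ℓ m J := isSolution_solJ hℓ m
  have hG : IsSolution ℓ m G := isSolution_hankelCombination hℓ γ m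
  have hJg : Integrable fun y => J y * g y := (memLp_solJ hℓ hm).integrable_mul (Lp.memLp g)
  have hGg : ∀ b, IntegrableOn (fun y => G y * g y) (Ioi b) := fun b =>
    (memLp_Ioi_hankelCombination hℓ γ m b).integrable_mul ((Lp.memLp g).restrict _)
  have hGg' : LocallyIntegrable (fun y => -(G y * g y)) := fun x =>
    ⟨Ioi (x - 1), Ioi_mem_nhds (by linarith), (hGg _).neg⟩
  set A : ℝ → ℂ := fun x => ∫ y in Iic x, J y * g y with hA
  set B : ℝ → ℂ := fun x => ∫ y in Ioi x, G y * g y with hB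
  have hAsub : ∀ x y, A y - A x = ∫ t in x..y, J t * g t := fun x y =>
    intervalIntegral.integral_Iic_sub_Iic hJg.integrableOn hJg.integrableOn
  have hBsub : ∀ x y, B y - B x = ∫ t in x..y, -(G t * g t) := fun x y => by
    rw [intervalIntegral.integral_neg, ← intervalIntegral.integral_Ioi_sub_Ioi' (hGg x) (hGg y)]
    ring
  have hc : ∀ x, c * wronskian J G x = -1 := fun x => by
    have hp : (Real.pi : ℂ) ≠ 0 := by exact_mod_cast Real.pi_ne_zero
    have h0 := sub_ne_zero.2 hγ
    rw [hJdef, hGdef, wronskian_solJ_hankelCombination hℓ, hcdef]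
    generalize Complex.exp (Complex.I * m * Real.pi) = e at h0 ⊢
    field_simp
    exact Complex.I_sq
  obtain ⟨h1, h2, h3⟩ := variation_of_constants hJ hG hc
    (absolutelyContinuousOnInterval_of_sub_eq_integral hJg.locallyIntegrable hAsub)
    (absolutelyContinuousOnInterval_of_sub_eq_integral hGg' hBsub)
    (ae_hasDerivAt_of_sub_eq_integral hJg.locallyIntegrable hAsub)
    (ae_hasDerivAt_of_sub_eq_integral hGg' hBsub)
  refine ⟨_, h1, fun x => ?_, h3, ?_⟩
  · have hi := (isExpDecaying_mixedKernel hℓ γ hm).integrable g x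
    rw [← intervalIntegral.integral_Iic_add_Ioi hi.integrableOn hi.integrableOn (b := x), mul_add]
    congr 1
    · rw [hA, ← mul_assoc, ← integral_const_mul]
      refine setIntegral_congr_fun measurableSet_Iic fun y hy => ?_
      simp only [mixedKernel, if_neg (not_lt.2 (mem_Iic.1 hy))]
      change _ = c * (J y * G x) * g y
      ring
    · rw [hB, ← mul_assoc, ← integral_const_mul]
      refine setIntegral_congr_fun measurableSet_Ioi fun y hy => ?_
      simp only [mixedKernel, if_pos (mem_Ioi.1 hy)]
      change _ = c * (J x * G y) * g y
      ring
  · have hAlim : Tendsto A atTop (𝓝 (A 0 + ∫ t in Ioi 0, J t * g t)) := by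
      refine ((intervalIntegral_tendsto_integral_Ioi 0 hJg.integrableOn tendsto_id).const_add
        (A 0)).congr fun x => ?_
      rw [id, ← hAsub 0 x]; ring
    have hBlim : Tendsto B atTop (𝓝 0) := by
      have h := ((intervalIntegral_tendsto_integral_Ioi 0 (hGg 0) tendsto_id).const_sub (B 0))
      rw [hB, sub_self] at h
      refine h.congr fun x => ?_
      have := hBsub 0 x
      rw [intervalIntegral.integral_neg] at this
      simp only [hB] at this
      rw [id]
      linear_combination -this
    -- The boundary Wronskian of `u` is `c` times the sum of that of `G` times `A` and that of `J`
    -- times `B`. In the first product the Wronskian tends to zero and `A` converges; in the second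
    -- the Wronskian converges and `B` tends to zero.
    have h := (((tendsto_wronskian_bcFun_hankelCombination hℓ γ m).mul hAlim).add
      ((tendsto_wronskian_bcFun_solJ hℓ γ m).mul hBlim)).const_mul c
    rw [zero_mul, mul_zero, add_zero, mul_zero] at h
    refine h.congr fun x => ?_
    rw [wronskian, wronskian, wronskian, h2 x]
    ring

lemma exists_resolvent_mixedOp {ℓ : ℝ} (hℓ : 0 < ℓ) {γ m : ℂ} (hm : 0 < m.re)
    (hγ : Complex.exp (Complex.I * m * Real.pi) ≠ γ) :
    ∃ R : L2R →L[ℂ] L2R, IsResolventAt (mixedOp ℓ γ) (-m ^ 2) R ∧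
      HasIntegralKernel R (mixedKernel ℓ γ m) := by
  have hk := isExpDecaying_mixedKernel hℓ γ hm
  obtain ⟨R, hR⟩ := hk.exists_operator
  refine ⟨R, isResolventAt_of_mem_graph (fun g => ?_) fun f hf => ?_, fun g => ?_⟩
  · obtain ⟨u, hu, hk, hg, hb⟩ := solution_operator_mixedOp hℓ hm hγ g
    have hRu : R g =ᵐ[volume] u := (hR g).trans (Eventually.of_forall fun x => (hk x).symm)
    refine mem_graph_mixedOp.2 ⟨u, hu, hRu, ?_, hb⟩
    filter_upwards [hRu, hg, Lp.coeFn_add g ((-m ^ 2) • R g), Lp.coeFn_smul (-m ^ 2) (R g)]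
      with x h1 h2 h3 h4
    rw [h3, Pi.add_apply, h4, Pi.smul_apply, smul_eq_mul, h1, h2, add_comm]
  · by_contra h0
    exact hγ (eigenvector_mixedOp hℓ hm.le h0 hf).2.1
  · filter_upwards [hR g] with x hx
    exact ⟨hk.integrable g x, hx⟩

/-- The orders `1` and `2` give `-1` and `1`, and `γ` cannot equal both. Hence every realization has
a nonempty resolvent set. -/
lemma exists_order_ne (γ : ℂ) : ∃ m : ℂ, 0 < m.re ∧ Complex.exp (Complex.I * m * Real.pi) ≠ γ := by
  by_cases h : γ = 1
  · refine ⟨1, by simp, ?_⟩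
    rw [h, mul_one, mul_comm, Complex.exp_pi_mul_I]
    norm_num
  · refine ⟨2, by simp, ?_⟩
    rw [show Complex.I * 2 * Real.pi = 2 * Real.pi * Complex.I by ring, Complex.exp_two_pi_mul_I]
    exact Ne.symm h

lemma isClosed_mixedOp {ℓ : ℝ} (hℓ : 0 < ℓ) (γ : ℂ) : (mixedOp ℓ γ).IsClosed := by
  obtain ⟨m, hm, hγ⟩ := exists_order_ne γ
  obtain ⟨R, hR, _⟩ := exists_resolvent_mixedOp hℓ hm hγ
  exact hR.isClosed

/-! ### Test functions and the characterization of the realization -/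

lemma isAC1_of_contDiff {φ : ℝ → ℂ} (hφ : ContDiff ℝ ∞ φ) : IsAC1 φ := by
  have h1 : ContDiff ℝ ∞ (deriv φ) := (contDiff_infty_iff_deriv.1 hφ).2
  have h2 := (contDiff_infty_iff_deriv.1 h1)
  exact ⟨hφ.differentiable (by simp),
    ac_of_hasDerivAt h2.2.continuous fun x => (h2.1 x).hasDerivAt⟩

lemma hasCompactSupport_negExpExpr (ℓ : ℝ) {φ : ℝ → ℂ} (hs : HasCompactSupport φ) :
    HasCompactSupport (negExpExpr ℓ φ) :=
  hs.deriv.deriv.neg.sub hs.mul_left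

lemma continuous_negExpExpr (ℓ : ℝ) {φ : ℝ → ℂ} (hφ : ContDiff ℝ ∞ φ) :
    Continuous (negExpExpr ℓ φ) := by
  have h1 : ContDiff ℝ ∞ (deriv φ) := (contDiff_infty_iff_deriv.1 hφ).2
  have h2 : Continuous (deriv (deriv φ)) := (contDiff_infty_iff_deriv.1 h1).2.continuous
  have h3 := hφ.continuous
  unfold negExpExpr
  fun_prop

lemma memLp_test {φ : ℝ → ℂ} (hφ : ContDiff ℝ ∞ φ) (hs : HasCompactSupport φ) :
    MemLp φ 2 volume := hφ.continuous.memLp_of_hasCompactSupport hs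

lemma memLp_negExpExpr (ℓ : ℝ) {φ : ℝ → ℂ} (hφ : ContDiff ℝ ∞ φ) (hs : HasCompactSupport φ) :
    MemLp (negExpExpr ℓ φ) 2 volume :=
  (continuous_negExpExpr ℓ hφ).memLp_of_hasCompactSupport (hasCompactSupport_negExpExpr ℓ hs)

lemma test_mem_graph_mixedOp (ℓ : ℝ) (γ : ℂ) {φ : ℝ → ℂ} (hφ : ContDiff ℝ ∞ φ)
    (hs : HasCompactSupport φ) : ((memLp_test hφ hs).toLp, (memLp_negExpExpr ℓ hφ hs).toLp) ∈
      (mixedOp ℓ γ).graph := by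
  refine mem_graph_mixedOp.2 ⟨φ, isAC1_of_contDiff hφ, MemLp.coeFn_toLp _, MemLp.coeFn_toLp _, ?_⟩
  have h1 : ∀ {f : ℝ → ℂ}, HasCompactSupport f → ∀ᶠ x in atTop, f x = 0 := fun hf =>
    (hasCompactSupport_iff_eventuallyEq.1 hf).filter_mono
      (coclosedCompact_eq_cocompact (X := ℝ) ▸ atTop_le_cocompact)
  refine tendsto_const_nhds.congr' ?_
  filter_upwards [h1 hs, h1 hs.deriv] with x h2 h3
  rw [wronskian, h2, h3]; ring

lemma isMixedRealization_mixedOp {ℓ : ℝ} (hℓ : 0 < ℓ) (γ : ℂ) :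
    IsMixedRealization ℓ γ (mixedOp ℓ γ) where
  closed := isClosed_mixedOp hℓ γ
  le_max := LinearPMap.domRestrict_le
  test φ hφ hs := by
    have h := test_mem_graph_mixedOp ℓ γ hφ hs
    have hd := LinearPMap.mem_domain_of_mem_graph h
    refine ⟨⟨_, hd⟩, (memLp_test hφ hs).coeFn_toLp, ?_⟩
    rw [LinearPMap.mem_graph_snd_inj _ (LinearPMap.mem_graph (mixedOp ℓ γ) ⟨_, hd⟩) h rfl]
    exact MemLp.coeFn_toLp _
  domain f := and_comm

lemma IsMixedRealization.eq {ℓ : ℝ} {γ : ℂ} {A B : L2R →ₗ.[ℂ] L2R}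
    (hA : IsMixedRealization ℓ γ A) (hB : IsMixedRealization ℓ γ B) : A = B := by
  refine LinearPMap.ext (Submodule.ext fun f => (hA.domain f).trans (hB.domain f).symm) ?_
  intro f h1 h2
  have h3 := ((hA.domain f).1 h1).1
  rw [hA.le_max.2 (x := ⟨f, h1⟩) (y := ⟨f, h3⟩) rfl, hB.le_max.2 (x := ⟨f, h2⟩) (y := ⟨f, h3⟩) rfl]

/-! ### Holomorphic dependence on the boundary condition -/

/-- From `H⁺ + H⁻ = 2 J`. Divided by `e^{imπ} - γ`, the second term no longer contains `γ`. -/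
lemma hankelCombination_eq_solJ {ℓ : ℝ} (hℓ : 0 < ℓ) (γ m : ℂ) (x : ℝ) :
    hankelCombination ℓ γ m x = 2 * Complex.exp (Complex.I * m * Real.pi) * solJ ℓ m x -
      (Complex.exp (Complex.I * m * Real.pi) - γ) * solHMinus ℓ m x := by
  have hp : (Real.pi : ℂ) ≠ 0 := by exact_mod_cast Real.pi_ne_zero
  have hI := Complex.I_ne_zero
  rw [hankelCombination, hankelPlus_exp hℓ, hankelMinus_exp hℓ, solJ_eq hℓ, solHPlus, solHMinus]
  field_simp
  ring

/-- A formula of Krein type: changing the boundary condition perturbs the resolvent by a rank-one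
operator with a scalar coefficient holomorphic in `γ`. -/
lemma mixedKernel_eq_add {ℓ : ℝ} (hℓ : 0 < ℓ) {γ γ₀ m : ℂ}
    (hγ : Complex.exp (Complex.I * m * Real.pi) ≠ γ)
    (hγ₀ : Complex.exp (Complex.I * m * Real.pi) ≠ γ₀) (x y : ℝ) :
    mixedKernel ℓ γ m x y = mixedKernel ℓ γ₀ m x y +
      Real.pi * Complex.I * Complex.exp (Complex.I * m * Real.pi) *
        ((Complex.exp (Complex.I * m * Real.pi) - γ)⁻¹ -
          (Complex.exp (Complex.I * m * Real.pi) - γ₀)⁻¹) * (solJ ℓ m x * solJ ℓ m y) := by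
  have h1 := sub_ne_zero.2 hγ
  have h2 := sub_ne_zero.2 hγ₀
  have key : ∀ x y, Real.pi * Complex.I / (2 * (Complex.exp (Complex.I * m * Real.pi) - γ)) *
      (solJ ℓ m x * hankelCombination ℓ γ m y) =
      Real.pi * Complex.I / (2 * (Complex.exp (Complex.I * m * Real.pi) - γ₀)) *
      (solJ ℓ m x * hankelCombination ℓ γ₀ m y) +
      Real.pi * Complex.I * Complex.exp (Complex.I * m * Real.pi) *
        ((Complex.exp (Complex.I * m * Real.pi) - γ)⁻¹ -
          (Complex.exp (Complex.I * m * Real.pi) - γ₀)⁻¹) * (solJ ℓ m x * solJ ℓ m y) := by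
    intro x y
    rw [hankelCombination_eq_solJ hℓ γ, hankelCombination_eq_solJ hℓ γ₀]
    generalize Complex.exp (Complex.I * m * Real.pi) = e at h1 h2 ⊢
    field_simp
    ring
  unfold mixedKernel
  split_ifs with h
  · exact key x y
  · rw [mul_comm (solJ ℓ m x)]
    exact key y x

/-- Near `γ₀` the parametrising space is `L²` itself, with `B γ` the resolvent at a fixed point
`-m²`. Then `M^γ B γ = 1 - m² B γ`, so holomorphy of `B` suffices. -/
lemma isHolomorphicFamily_mixedOp {ℓ : ℝ} (hℓ : 0 < ℓ) :
    IsHolomorphicFamily (mixedOp ℓ) {γ : ℂ | γ ≠ 0} := by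
  refine ⟨fun γ _ => isClosed_mixedOp hℓ γ, fun γ₀ hγ₀ => ?_⟩
  obtain ⟨m, hm, hne⟩ := exists_order_ne γ₀
  obtain ⟨R₀, -, hk₀⟩ := exists_resolvent_mixedOp hℓ hm hne
  have hkP := isExpDecaying_solJ_mul_solJ hℓ hm
  obtain ⟨P, hP⟩ := hkP.exists_operator
  set e := Complex.exp (Complex.I * m * Real.pi) with he
  set s : ℂ → ℂ := fun γ => Real.pi * Complex.I * e * ((e - γ)⁻¹ - (e - γ₀)⁻¹) with hs
  set B : ℂ → L2R →L[ℂ] L2R := fun γ => R₀ + s γ • P with hB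
  set C : ℂ → L2R →L[ℂ] L2R := fun γ => 1 + (-m ^ 2 : ℂ) • B γ with hC
  have hBd : DifferentiableOn ℂ B {γ | γ ≠ 0 ∧ e ≠ γ} := by
    have hsd : DifferentiableOn ℂ s {γ | γ ≠ 0 ∧ e ≠ γ} := by
      intro γ hγ
      have h0 : e - γ ≠ 0 := sub_ne_zero.2 hγ.2
      refine DifferentiableAt.differentiableWithinAt ?_
      exact ((((differentiableAt_const e).sub differentiableAt_id).inv h0).sub_const _).const_mul _
    exact (hsd.smul_const P).const_add R₀
  have hres : ∀ γ, e ≠ γ → IsResolventAt (mixedOp ℓ γ) (-m ^ 2) (B γ) := by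
    intro γ hγ
    obtain ⟨R, hR, hk⟩ := exists_resolvent_mixedOp hℓ hm hγ
    have hRB : R = B γ := by
      ext1 g
      refine Lp.ext ?_
      filter_upwards [hk g, hk₀ g, hP g, Lp.coeFn_add (R₀ g) (s γ • P g), Lp.coeFn_smul (s γ) (P g)]
        with x h1 h2 h3 h4 h5
      have h6 : B γ g = R₀ g + s γ • P g := rfl
      rw [h6, h4, Pi.add_apply, h5, Pi.smul_apply, h1.2, h2.2, h3, smul_eq_mul,
        ← integral_const_mul, ← integral_add h2.1 ((hkP.integrable g x).const_mul _)]
      refine integral_congr_ae (Eventually.of_forall fun y => ?_)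
      simp only [mixedKernel_eq_add hℓ hγ hne x y]
      ring
    rwa [← hRB]
  refine ⟨L2R, inferInstance, inferInstance, inferInstance, {γ | γ ≠ 0 ∧ e ≠ γ}, B, C, ?_,
    ⟨hγ₀, hne⟩, fun γ hγ => hγ.1, hBd, (hBd.const_smul (-m ^ 2 : ℂ)).const_add 1, ?_⟩
  · exact isOpen_ne.inter (isOpen_ne_fun continuous_const continuous_id)
  · intro γ hγ
    have hR := hres γ hγ.2
    refine ⟨fun g g' hgg => ?_, ?_, fun g h => ?_⟩
    · have h1 := LinearPMap.mem_graph_snd_inj _ (hR.mem_graph g) (hR.mem_graph g') hgg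
      rw [hgg] at h1
      exact add_right_cancel h1
    · ext f
      refine ⟨?_, fun hf => ?_⟩
      · rintro ⟨g, rfl⟩
        exact (hR.1 g).1
      · exact ⟨_, hR.2 ⟨f, hf⟩⟩
    · exact LinearPMap.mem_graph_snd_inj _ (LinearPMap.mem_graph (mixedOp ℓ γ) ⟨B γ g, h⟩)
        (hR.mem_graph g) rfl

/-! ### The spectrum -/

lemma exists_sqrt_neg (z : ℂ) : ∃ m : ℂ, 0 ≤ m.re ∧ z = -m ^ 2 := by
  obtain ⟨m, hm⟩ := IsAlgClosed.exists_pow_nat_eq (-z) two_pos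
  rcases le_total 0 m.re with h | h
  · exact ⟨m, h, by rw [hm, neg_neg]⟩
  · exact ⟨-m, by simpa using h, by rw [neg_sq, hm, neg_neg]⟩

lemma exp_mul_pi_eq_iff (m α : ℂ) :
    Complex.exp (Complex.I * m * Real.pi) = Complex.exp (Complex.I * Real.pi * α) ↔
      ∃ n : ℤ, Even n ∧ m = n + α := by
  have hp : (Real.pi : ℂ) ≠ 0 := by exact_mod_cast Real.pi_ne_zero
  have hI := Complex.I_ne_zero
  rw [Complex.exp_eq_exp_iff_exists_int]
  constructor
  · rintro ⟨n, hn⟩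
    refine ⟨2 * n, even_two_mul n, ?_⟩
    have h : (Complex.I * Real.pi) * m = (Complex.I * Real.pi) * ((2 * n : ℤ) + α) := by
      push_cast; linear_combination hn
    exact mul_left_cancel₀ (mul_ne_zero hI hp) h
  · rintro ⟨n, ⟨k, rfl⟩, rfl⟩
    exact ⟨k, by push_cast; ring⟩

lemma toLp_solJ_ne_zero {ℓ : ℝ} (hℓ : 0 < ℓ) {m : ℂ} (h : MemLp (solJ ℓ m) 2 volume) :
    h.toLp ≠ 0 := by
  intro h0
  refine solJ_ne_zero hℓ m ?_
  refine ((isSolution_solJ hℓ m).continuous.ae_eq_iff_eq volume continuous_const).1 ?_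
  refine h.coeFn_toLp.symm.trans ?_
  rw [h0]
  exact Lp.coeFn_zero ℂ 2 volume

lemma isEigenpair_mixedOp_iff {ℓ : ℝ} (hℓ : 0 < ℓ) {m : ℂ} (hm : 0 < m.re)
    (hJ : MemLp (solJ ℓ m) 2 volume) (f : L2R) :
    IsEigenpair (mixedOp ℓ (Complex.exp (Complex.I * m * Real.pi))) (-m ^ 2) f ↔
      ∃ c : ℂ, f = c • hJ.toLp := by
  have hc : ∀ c : ℂ, (c • hJ.toLp : L2R) =ᵐ[volume] fun x => c * solJ ℓ m x := fun c => by
    filter_upwards [Lp.coeFn_smul c hJ.toLp, hJ.coeFn_toLp] with x h1 h2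
    rw [h1, Pi.smul_apply, h2, smul_eq_mul]
  rw [isEigenpair_iff_mem_graph]
  constructor
  · intro h
    by_cases hf : f = 0
    · exact ⟨0, by rw [hf, zero_smul]⟩
    · obtain ⟨-, -, a, ha⟩ := eigenvector_mixedOp hℓ hm.le hf h
      exact ⟨a, Lp.ext (ha.trans (hc a).symm)⟩
  · rintro ⟨c, rfl⟩
    exact solJ_mem_graph_mixedOp hℓ (hc c)

lemma neg_sq_mem_pointSpectrum_iff {ℓ : ℝ} (hℓ : 0 < ℓ) {γ m : ℂ} (hm : 0 ≤ m.re) :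
    -m ^ 2 ∈ pointSpectrum (mixedOp ℓ γ) ↔
      0 < m.re ∧ Complex.exp (Complex.I * m * Real.pi) = γ := by
  constructor
  · rintro ⟨f, hf, h⟩
    obtain ⟨h1, h2, -⟩ := eigenvector_mixedOp hℓ hm hf (isEigenpair_iff_mem_graph.1 h)
    exact ⟨h1, h2⟩
  · rintro ⟨h1, rfl⟩
    have hJ := memLp_solJ hℓ h1
    exact ⟨hJ.toLp, toLp_solJ_ne_zero hℓ hJ, (isEigenpair_mixedOp_iff hℓ h1 hJ _).2
      ⟨1, (one_smul _ _).symm⟩⟩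

lemma pointSpectrum_mixedOp {ℓ : ℝ} (hℓ : 0 < ℓ) (α : ℂ) :
    pointSpectrum (mixedOp ℓ (Complex.exp (Complex.I * Real.pi * α))) =
      {z : ℂ | ∃ n : ℤ, Even n ∧ 0 < (n + α).re ∧ z = -(n + α) ^ 2} := by
  ext z
  constructor
  · intro h
    obtain ⟨m, hm, rfl⟩ := exists_sqrt_neg z
    obtain ⟨h1, h2⟩ := (neg_sq_mem_pointSpectrum_iff hℓ hm).1 h
    obtain ⟨n, hn, rfl⟩ := (exp_mul_pi_eq_iff m α).1 h2
    exact ⟨n, hn, h1, rfl⟩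
  · rintro ⟨n, hn, h1, rfl⟩
    exact (neg_sq_mem_pointSpectrum_iff hℓ h1.le).2 ⟨h1, (exp_mul_pi_eq_iff _ α).2 ⟨n, hn, rfl⟩⟩

lemma pointSpectrum_subset_opSpectrum {E : Type*} [NormedAddCommGroup E] [InnerProductSpace ℂ E]
    (A : E →ₗ.[ℂ] E) : pointSpectrum A ⊆ opSpectrum A := by
  rintro z ⟨f, hf, h⟩ ⟨R, hR⟩
  refine hf ?_
  rw [← hR.eq_of_mem_graph (isEigenpair_iff_mem_graph.1 h), sub_self, map_zero]

/-! ### Weyl's criterion and the half-line -/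

lemma norm_toLp_sq {f : ℝ → ℂ} (hf : MemLp f 2 volume) : ‖hf.toLp‖ ^ 2 = ∫ x, ‖f x‖ ^ 2 := by
  have h := L2.inner_def (𝕜 := ℂ) hf.toLp hf.toLp
  rw [inner_self_eq_norm_sq_to_K] at h
  have h2 : ∫ x, inner ℂ ((hf.toLp : L2R) x) ((hf.toLp : L2R) x) = ∫ x, ((‖f x‖ ^ 2 : ℝ) : ℂ) := by
    refine integral_congr_ae ?_
    filter_upwards [hf.coeFn_toLp] with x hx
    rw [hx, inner_self_eq_norm_sq_to_K]
    push_cast; rfl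
  rw [h2, integral_complex_ofReal] at h
  exact Complex.ofReal_injective (by rw [Complex.ofReal_pow]; exact h)

/-- Weyl's criterion for the mixed realization: test functions almost annihilated by the
shifted expression produce points of the spectrum. -/
lemma mem_opSpectrum_of_test {ℓ : ℝ} {γ z : ℂ} (h : ∀ ε > 0, ∃ φ : ℝ → ℂ, ContDiff ℝ ∞ φ ∧
    HasCompactSupport φ ∧ 0 < ∫ x, ‖φ x‖ ^ 2 ∧
      ∫ x, ‖negExpExpr ℓ φ x - z * φ x‖ ^ 2 ≤ ε * ∫ x, ‖φ x‖ ^ 2) :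
    z ∈ opSpectrum (mixedOp ℓ γ) := by
  rintro ⟨R, hR⟩
  -- This `ε` makes `‖R‖² ε ≤ 1/2`, so a bounded inverse would give `‖φ‖² ≤ ‖φ‖² / 2`.
  obtain ⟨φ, hφ, hs, hpos, hle⟩ := h (1 / (2 * (‖R‖ ^ 2 + 1))) (by positivity)
  have h1 := memLp_test hφ hs
  have h2 := memLp_negExpExpr ℓ hφ hs
  have h3 := hR.eq_of_mem_graph (test_mem_graph_mixedOp ℓ γ hφ hs)
  have h4 : h2.toLp - z • h1.toLp = (h2.sub (h1.const_smul z)).toLp := by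
    rw [MemLp.toLp_sub h2 (h1.const_smul z), MemLp.toLp_const_smul]
  rw [h4] at h3
  have h5 := R.le_opNorm (h2.sub (h1.const_smul z)).toLp
  rw [h3] at h5
  have h6 := pow_le_pow_left₀ (norm_nonneg _) h5 2
  rw [mul_pow, norm_toLp_sq, norm_toLp_sq] at h6
  simp only [Pi.sub_apply, Pi.smul_apply, smul_eq_mul] at h6
  set N := ∫ x, ‖φ x‖ ^ 2
  have h7 : ‖R‖ ^ 2 * (1 / (2 * (‖R‖ ^ 2 + 1)) * N) ≤ N / 2 := by
    have : ‖R‖ ^ 2 * (1 / (2 * (‖R‖ ^ 2 + 1)) * N) = ‖R‖ ^ 2 / (‖R‖ ^ 2 + 1) * (N / 2) := by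
      field_simp
    rw [this]
    refine mul_le_of_le_one_left (by positivity) ?_
    rw [div_le_one (by positivity)]
    linarith
  have h8 := mul_le_mul_of_nonneg_left hle (sq_nonneg ‖R‖)
  linarith

/-- The plane wave `e^{ikx}` cut off by `ψ ((x + s) / N)`. -/
noncomputable def wavePacket (ψ : ℝ → ℝ) (k a s x : ℝ) : ℂ :=
  Complex.exp (Complex.I * k * x) * (ψ (a * (x + s)) : ℂ)

lemma contDiff_wavePacket {ψ : ℝ → ℝ} (hψ : ContDiff ℝ ∞ ψ) (k a s : ℝ) :
    ContDiff ℝ ∞ (wavePacket ψ k a s) := by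
  have h1 : ContDiff ℝ ∞ fun x : ℝ => (ψ (a * (x + s)) : ℂ) :=
    Complex.ofRealCLM.contDiff.comp (hψ.comp (by fun_prop))
  have h2 : ContDiff ℝ ∞ fun x : ℝ => Complex.exp (Complex.I * k * x) :=
    (contDiff_const.mul Complex.ofRealCLM.contDiff).cexp
  exact h2.mul h1

lemma hasDerivAt_wavePacket {ψ ψ' : ℝ → ℝ} (hψ : ∀ x, HasDerivAt ψ (ψ' x) x) (k a s x : ℝ) :
    HasDerivAt (wavePacket ψ k a s)
      (Complex.I * k * wavePacket ψ k a s x + a * wavePacket ψ' k a s x) x := by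
  have h1 : HasDerivAt (fun x : ℝ => (ψ (a * (x + s)) : ℂ)) ((ψ' (a * (x + s)) * a : ℝ) : ℂ) x := by
    refine HasDerivAt.ofReal_comp ((hψ _).comp x ?_)
    simpa using ((hasDerivAt_id x).add_const s).const_mul a
  have h2 : HasDerivAt (fun x : ℝ => Complex.exp (Complex.I * k * x))
      (Complex.exp (Complex.I * k * x) * (Complex.I * k)) x := by
    have := ((hasDerivAt_id x).ofReal_comp.const_mul (Complex.I * k)).cexp
    simpa using this
  refine (h2.mul h1).congr_deriv ?_
  simp only [wavePacket]
  push_cast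
  ring

lemma negExpExpr_wavePacket {ψ ψ' ψ'' : ℝ → ℝ} (hψ : ∀ x, HasDerivAt ψ (ψ' x) x)
    (hψ' : ∀ x, HasDerivAt ψ' (ψ'' x) x) (ℓ k a s x : ℝ) :
    negExpExpr ℓ (wavePacket ψ k a s) x - ((k ^ 2 : ℝ) : ℂ) * wavePacket ψ k a s x =
      -(2 * Complex.I * k * a * wavePacket ψ' k a s x) - a ^ 2 * wavePacket ψ'' k a s x -
        ((ℓ ^ 2 * Real.exp (2 * x) : ℝ) : ℂ) * wavePacket ψ k a s x := by
  have h1 : deriv (wavePacket ψ k a s) = fun x =>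
      Complex.I * k * wavePacket ψ k a s x + a * wavePacket ψ' k a s x :=
    funext fun x => (hasDerivAt_wavePacket hψ k a s x).deriv
  have h2 := (((hasDerivAt_wavePacket hψ k a s x).const_mul (Complex.I * k)).add
    ((hasDerivAt_wavePacket hψ' k a s x).const_mul (a : ℂ))).deriv
  have h3 : deriv (deriv (wavePacket ψ k a s)) x =
      Complex.I * k * (Complex.I * k * wavePacket ψ k a s x + a * wavePacket ψ' k a s x) +
        a * (Complex.I * k * wavePacket ψ' k a s x + a * wavePacket ψ'' k a s x) := by rw [h1]; exact h2
  rw [negExpExpr, h3]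
  push_cast
  linear_combination (-(k : ℂ) ^ 2 * wavePacket ψ k a s x) * Complex.I_sq

lemma norm_wavePacket (ψ : ℝ → ℝ) (k a s x : ℝ) : ‖wavePacket ψ k a s x‖ = |ψ (a * (x + s))| := by
  rw [wavePacket, norm_mul, Complex.norm_real, Complex.norm_exp, Real.norm_eq_abs]
  have : (Complex.I * k * x).re = 0 := by simp
  rw [this, Real.exp_zero, one_mul]

lemma integral_comp_mul_add (F : ℝ → ℝ) {a : ℝ} (ha : 0 < a) (s : ℝ) :
    ∫ x, F (a * (x + s)) = a⁻¹ * ∫ x, F x := by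
  rw [integral_add_right_eq_self (fun x => F (a * x)) s, Measure.integral_comp_mul_left,
    abs_of_pos (inv_pos.2 ha), smul_eq_mul]

lemma hasCompactSupport_wavePacket {ψ : ℝ → ℝ} (hψ : HasCompactSupport ψ) (k : ℝ) {a : ℝ}
    (ha : a ≠ 0) (s : ℝ) : HasCompactSupport (wavePacket ψ k a s) := by
  have h1 : HasCompactSupport fun x : ℝ => ψ (a * (x + s)) :=
    hψ.comp_homeomorph ((Homeomorph.addRight s).trans (Homeomorph.mulLeft₀ a ha))
  have h2 : HasCompactSupport fun x : ℝ => (ψ (a * (x + s)) : ℂ) :=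
    h1.comp_left (g := fun r : ℝ => (r : ℂ)) Complex.ofReal_zero
  exact h2.mul_left

/-- Plane waves `e^{ikx}` under a cutoff of width about `1 / a`, moved far to the left. Derivatives
of the cutoff cost factors `a` and `a²`, and the shift makes the potential at most `a` on the
support. -/
lemma sq_mem_opSpectrum_mixedOp {ℓ : ℝ} (γ : ℂ) (k : ℝ) :
    ((k ^ 2 : ℝ) : ℂ) ∈ opSpectrum (mixedOp ℓ γ) := by
  let b : ContDiffBump (0 : ℝ) := ⟨1, 2, one_pos, one_lt_two⟩
  set ψ : ℝ → ℝ := fun x => b x with hψdef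
  have hψ : ContDiff ℝ ∞ ψ := b.contDiff
  have hψs : HasCompactSupport ψ := b.hasCompactSupport
  have hψ1 : ContDiff ℝ ∞ (deriv ψ) := (contDiff_infty_iff_deriv.1 hψ).2
  have hψ2 : ContDiff ℝ ∞ (deriv (deriv ψ)) := (contDiff_infty_iff_deriv.1 hψ1).2
  have hd1 : ∀ x, HasDerivAt ψ (deriv ψ x) x := fun x =>
    ((contDiff_infty_iff_deriv.1 hψ).1 x).hasDerivAt
  have hd2 : ∀ x, HasDerivAt (deriv ψ) (deriv (deriv ψ) x) x := fun x =>
    ((contDiff_infty_iff_deriv.1 hψ1).1 x).hasDerivAt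
  have hint : ∀ {F : ℝ → ℝ}, Continuous F → HasCompactSupport F → Integrable fun x => F x ^ 2 :=
    fun hF hs => (hF.pow 2).integrable_of_hasCompactSupport (by
      simpa only [sq] using hs.mul_left)
  have i0 := hint hψ.continuous hψs
  have i1 := hint hψ1.continuous hψs.deriv
  have i2 := hint hψ2.continuous hψs.deriv.deriv
  have hI0 : 0 < ∫ x, ψ x ^ 2 := by
    refine (integral_pos_iff_support_of_nonneg (fun x => sq_nonneg _) i0).2 ?_
    refine (Metric.measure_ball_pos volume (0 : ℝ) one_pos).trans_le (measure_mono fun x hx => ?_)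
    have h1 : ψ x = 1 := b.one_of_mem_closedBall (Metric.ball_subset_closedBall hx)
    simp [h1]
  set I0 := ∫ x, ψ x ^ 2 with hI0def
  set I1 := ∫ x, deriv ψ x ^ 2 with hI1def
  set I2 := ∫ x, deriv (deriv ψ) x ^ 2 with hI2def
  have hI1 : 0 ≤ I1 := integral_nonneg fun x => sq_nonneg _
  have hI2 : 0 ≤ I2 := integral_nonneg fun x => sq_nonneg _
  refine mem_opSpectrum_of_test fun ε hε => ?_
  -- The `3` comes from `(p + q + r)² ≤ 3 (p² + q² + r²)`, with one summand for each of the three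
  -- error terms.
  have hlim : Tendsto (fun a : ℝ => 3 * ((2 * k * a) ^ 2 * I1 + (a ^ 2) ^ 2 * I2 + a ^ 2 * I0))
      (𝓝[>] 0) (𝓝 0) := by
    refine Tendsto.mono_left ?_ nhdsWithin_le_nhds
    exact (by fun_prop : Continuous fun a : ℝ =>
      3 * ((2 * k * a) ^ 2 * I1 + (a ^ 2) ^ 2 * I2 + a ^ 2 * I0)).tendsto' 0 0 (by simp)
  obtain ⟨a, ha1, ha⟩ := ((hlim.eventually (ge_mem_nhds (mul_pos hε hI0))).and
    self_mem_nhdsWithin).exists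
  have ha : 0 < a := ha
  -- The cutoff vanishes to the right of `2 / a - s`, because the bump has outer radius `2`.
  obtain ⟨s, hs⟩ : ∃ s : ℝ, ℓ ^ 2 * Real.exp (2 * (2 / a - s)) ≤ a := by
    have h : Tendsto (fun s : ℝ => ℓ ^ 2 * Real.exp (2 * (2 / a - s))) atTop (𝓝 (ℓ ^ 2 * 0)) := by
      refine (Real.tendsto_exp_atBot.comp ?_).const_mul _
      exact ((tendsto_const_nhds (x := 2 / a)).add_atBot tendsto_neg_atTop_atBot).const_mul_atBot
        two_pos
    rw [mul_zero] at h
    exact (h.eventually (ge_mem_nhds ha)).exists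
  have hnorm : ∫ x, ‖wavePacket ψ k a s x‖ ^ 2 = a⁻¹ * I0 := by
    simp only [norm_wavePacket, sq_abs]
    exact integral_comp_mul_add (fun x => ψ x ^ 2) ha s
  refine ⟨wavePacket ψ k a s, contDiff_wavePacket hψ k a s, hasCompactSupport_wavePacket hψs k
    ha.ne' s, by rw [hnorm]; positivity, ?_⟩
  set F : ℝ → ℝ := fun x => 3 * ((2 * k * a) ^ 2 * deriv ψ x ^ 2 +
    (a ^ 2) ^ 2 * deriv (deriv ψ) x ^ 2 + a ^ 2 * ψ x ^ 2) with hF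
  have i12 : Integrable fun x => (2 * k * a) ^ 2 * deriv ψ x ^ 2 +
      (a ^ 2) ^ 2 * deriv (deriv ψ) x ^ 2 := (i1.const_mul _).add (i2.const_mul _)
  have hFi : Integrable F :=
    (i12.add (i0.const_mul _)).const_mul 3
  have hFint : ∫ x, F x = 3 * ((2 * k * a) ^ 2 * I1 + (a ^ 2) ^ 2 * I2 + a ^ 2 * I0) := by
    rw [hF, integral_const_mul, integral_add i12
      (i0.const_mul _), integral_add (i1.const_mul _) (i2.const_mul _), integral_const_mul,
      integral_const_mul, integral_const_mul]
  have hpt : ∀ x, ‖negExpExpr ℓ (wavePacket ψ k a s) x -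
      ((k ^ 2 : ℝ) : ℂ) * wavePacket ψ k a s x‖ ^ 2 ≤ F (a * (x + s)) := by
    intro x
    rw [negExpExpr_wavePacket hd1 hd2]
    have h1 : ‖2 * Complex.I * k * a * wavePacket (deriv ψ) k a s x‖ =
        |2 * k * a * deriv ψ (a * (x + s))| := by
      rw [norm_mul, norm_wavePacket, abs_mul (2 * k * a)]
      congr 1
      simp [abs_mul]
    have h2 : ‖(a : ℂ) ^ 2 * wavePacket (deriv (deriv ψ)) k a s x‖ =
        |a ^ 2 * deriv (deriv ψ) (a * (x + s))| := by
      rw [norm_mul, norm_wavePacket, abs_mul]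
      congr 1
      simp
    have h3 : ‖((ℓ ^ 2 * Real.exp (2 * x) : ℝ) : ℂ) * wavePacket ψ k a s x‖ ≤
        |a * ψ (a * (x + s))| := by
      rw [norm_mul, norm_wavePacket, abs_mul, Complex.norm_real, Real.norm_eq_abs]
      by_cases hx : ψ (a * (x + s)) = 0
      · simp [hx]
      · have h4 : a * (x + s) ∈ Function.support ψ := hx
        rw [b.support_eq, Metric.mem_ball, dist_zero_right, Real.norm_eq_abs] at h4
        have h5 : a * (x + s) < 2 := (le_abs_self _).trans_lt h4
        have h6 : x ≤ 2 / a - s := by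
          have : x + s ≤ 2 / a := by rw [le_div_iff₀ ha]; linarith
          linarith
        rw [abs_of_nonneg (by positivity), abs_of_pos ha]
        gcongr
        exact le_trans (by gcongr) hs
    have h4 := (norm_sub_le (-(2 * Complex.I * k * a * wavePacket (deriv ψ) k a s x) -
      (a : ℂ) ^ 2 * wavePacket (deriv (deriv ψ)) k a s x)
      (((ℓ ^ 2 * Real.exp (2 * x) : ℝ) : ℂ) * wavePacket ψ k a s x)).trans
      (add_le_add ((norm_sub_le _ _).trans (add_le_add (norm_neg _).le le_rfl)) h3)
    rw [h1, h2] at h4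
    refine (pow_le_pow_left₀ (norm_nonneg _) h4 2).trans ?_
    have h5 : ∀ p q r : ℝ, (|p| + |q| + |r|) ^ 2 ≤ 3 * (p ^ 2 + q ^ 2 + r ^ 2) := fun p q r => by
      rw [← sq_abs p, ← sq_abs q, ← sq_abs r]
      nlinarith [sq_nonneg (|p| - |q|), sq_nonneg (|q| - |r|), sq_nonneg (|p| - |r|)]
    refine (h5 _ _ _).trans (le_of_eq ?_)
    simp only [hF]
    ring
  have hFi' : Integrable fun x => F (a * (x + s)) :=
    (hFi.comp_mul_left' ha.ne').comp_add_right s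
  calc _ ≤ ∫ x, F (a * (x + s)) := integral_mono_of_nonneg
        (Eventually.of_forall fun x => by positivity) hFi' (Eventually.of_forall hpt)
    _ = a⁻¹ * ∫ x, F x := integral_comp_mul_add F ha s
    _ ≤ a⁻¹ * (ε * I0) := by rw [hFint]; gcongr
    _ = _ := by rw [hnorm]; ring

/-- Write `z = -m²` with `Re m ≥ 0`. For `Re m = 0` the point lies on the half-line; for `Re m > 0`
it is an eigenvalue or a resolvent point, according to whether `e^{imπ} = γ`. -/
lemma opSpectrum_mixedOp {ℓ : ℝ} (hℓ : 0 < ℓ) (γ : ℂ) : opSpectrum (mixedOp ℓ γ) =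
    ((fun t : ℝ => (t : ℂ)) '' Set.Ici 0) ∪ pointSpectrum (mixedOp ℓ γ) := by
  refine Subset.antisymm (fun z hz => ?_) (union_subset ?_ (pointSpectrum_subset_opSpectrum _))
  · by_contra hn
    rw [mem_union, not_or] at hn
    obtain ⟨m, hm, rfl⟩ := exists_sqrt_neg z
    have hre : m.re ≠ 0 := by
      intro h0
      refine hn.1 ⟨m.im ^ 2, mem_Ici.2 (sq_nonneg _), ?_⟩
      have h1 : m = m.im * Complex.I := by
        apply Complex.ext <;> simp [h0]
      change ((m.im ^ 2 : ℝ) : ℂ) = -m ^ 2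
      conv_rhs => rw [h1]
      rw [mul_pow, Complex.I_sq]
      push_cast
      ring
    have hpos : 0 < m.re := lt_of_le_of_ne hm hre.symm
    have hne : Complex.exp (Complex.I * m * Real.pi) ≠ γ := fun h =>
      hn.2 ((neg_sq_mem_pointSpectrum_iff hℓ hm).2 ⟨hpos, h⟩)
    obtain ⟨R, hR, -⟩ := exists_resolvent_mixedOp hℓ hpos hne
    exact hz ⟨R, hR⟩
  · rintro _ ⟨t, ht, rfl⟩
    have h := sq_mem_opSpectrum_mixedOp (ℓ := ℓ) γ (√t)
    rwa [Real.sq_sqrt ht] at h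

theorem mainTheorem4 (ℓ : ℝ) (hℓ : 0 < ℓ) :
    (∀ γ : ℂ, γ ≠ 0 →
      IsMixedRealization ℓ γ (mixedOp ℓ γ) ∧
      ∀ A : L2R →ₗ.[ℂ] L2R, IsMixedRealization ℓ γ A → A = mixedOp ℓ γ) ∧
    IsHolomorphicFamily (mixedOp ℓ) {γ : ℂ | γ ≠ 0} ∧
    (∀ γ α : ℂ, γ = Complex.exp (Complex.I * Real.pi * α) →
      (∀ n : ℤ, Even n → 0 < (α + n).re →
        ∃ hJ : MemLp (fun x : ℝ => besselJ (α + n) (ℓ * Real.exp x)) 2 volume,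
          hJ.toLp ≠ 0 ∧
          ∀ f : L2R, IsEigenpair (mixedOp ℓ γ) (-(α + n) ^ 2) f ↔
            ∃ c : ℂ, f = c • hJ.toLp) ∧
      pointSpectrum (mixedOp ℓ γ) =
        {z : ℂ | ∃ n : ℤ, Even n ∧ 0 < (n + α).re ∧ z = -(n + α) ^ 2} ∧
      opSpectrum (mixedOp ℓ γ) =
        ((fun t : ℝ => (t : ℂ)) '' Set.Ici 0) ∪ pointSpectrum (mixedOp ℓ γ)) ∧
    (∀ γ m : ℂ, γ ≠ 0 → 0 < m.re → Complex.exp (Complex.I * m * Real.pi) ≠ γ →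
      ∃ R : L2R →L[ℂ] L2R, IsResolventAt (mixedOp ℓ γ) (-m ^ 2) R ∧
        HasIntegralKernel R (mixedKernel ℓ γ m)) := by
  refine ⟨fun γ _ => ⟨isMixedRealization_mixedOp hℓ γ, fun A hA =>
    hA.eq (isMixedRealization_mixedOp hℓ γ)⟩, isHolomorphicFamily_mixedOp hℓ, ?_,
    fun γ m _ hm hγ => exists_resolvent_mixedOp hℓ hm hγ⟩
  rintro γ α rfl
  refine ⟨fun n hn hre => ?_, pointSpectrum_mixedOp hℓ α, opSpectrum_mixedOp hℓ _⟩
  have hJ := memLp_solJ hℓ hre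
  refine ⟨hJ, toLp_solJ_ne_zero hℓ hJ, fun f => ?_⟩
  -- For even `n` the orders `α` and `α + n` give the same `γ`.
  rw [← (exp_mul_pi_eq_iff (α + n) α).2 ⟨n, hn, add_comm _ _⟩]
  exact isEigenpair_mixedOp_iff hℓ hre hJ f
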